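/- Let $M$ be a smooth $d$-dimensional Riemannian manifold (Hausdorff, second countable, without boundary) and let $\Omega\subset M$ be an open set with compact Lipschitz boundary $\Gamma=\partial\Omega$ (near each point of $\Gamma$, some smooth chart followed by a bi-Lipschitz homeomorphism maps $\Omega$ to a half space). Assume that $\overline\Omega$ is compact, or that outside of some compact set $\Omega$ is diffeomorphic to $\{x\in\mathbb{R}^d : |x|>1\}$. Let $\Gamma_D$ be a relatively open subset of $\Gamma$ and $\Gamma_N:=\Gamma\setminus\overline{\Gamma_D}$. Let $q\ge 0$. Let $L^{2,k}$ be the space of square integrable real $k$-forms on $\Omega$ with $\langle\varphi,\psi\rangle_{L^{2,k}}=\int_\Omega\varphi\wedge *\psi=\int_\Omega\langle\varphi,\psi\rangle\,d\mathrm{vol}$, let $d$ be the exterior derivative and $\delta=\pm *d*$ the co-derivative, with the sign such that $-\delta$ is the formal adjoint of $d$. Put $D^{q}=\{\varphi\in L^{2,q}: d\varphi\in L^{2,q+1}\}$ and $\Delta^{q+1}=\{\psi\in L^{2,q+1}:\delta\psi\in L^{2,q}\}$ (weak derivatives, defined by testing with smooth forms compactly supported in $\Omega$), with the graph norms. Let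 $D^q_{\Gamma_D}$ (resp. $\Delta^{q+1}_{\Gamma_N}$) be the closure in $D^q$ (resp. $\Delta^{q+1}$) of the restrictions to $\Omega$ of the smooth compactly supported forms on $M$ whose supports are bounded away from $\Gamma_D$ (resp. $\Gamma_N$). Let $\rho$ and $\alpha$ be measurable fields of linear transformations of $q$-forms and $(q+1)$-forms, respectively, on $\Omega$, which are symmetric, essentially bounded and uniformly positive definite. For $A\in\{\rho,\rho^{-1},\alpha,\alpha^{-1}\}$ write $\|\varphi\|_A^2=\langle A\varphi,\varphi\rangle_{L^2}$, and set $$|||(\varphi,\psi)|||^2:=\|\varphi\|_{\rho}^2+\|d\varphi\|_{\alpha}^2+\|\psi\|_{\alpha^{-1}}^2+\|\delta\psi\|_{\rho^{-1}}^2 .$$ Let $f\in L^{2,q}$ and let $(u,p)\in D^q_{\Gamma_D}\times\Delta^{q+1}_{\Gamma_N}$ be the exact solution of the mixed formulation $$-\delta p+\rho u=f,\qquad \alpha\, du=p\qquad\text{in }\Omega$$ of the problem $-\delta\alpha\, du+\rho u=f$ with mixed boundary conditions. Then for every $(\tilde u,\tilde p)\in D^q_{\Gamma_D}\times\Delta^{q+1}_{\Gamma_N}$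 $$|||(u,p)-(\tilde u,\tilde p)|||^2=\mathcal M(\tilde u,\tilde p):=\|f-\rho\tilde u+\delta\tilde p\|_{\rho^{-1}}^2+\|\tilde p-\alpha\, d\tilde u\|_{\alpha^{-1}}^2 ,$$ and, if $f\neq 0$, then $|||(u,p)|||>0$, $\|f\|_{\rho^{-1}}>0$ and $$\frac{|||(u,p)-(\tilde u,\tilde p)|||^2}{|||(u,p)|||^2}=\frac{\mathcal M(\tilde u,\tilde p)}{\|f\|_{\rho^{-1}}^2}.$$ -/

import Mathlib

open MeasureTheory Set
open scoped Manifold ContDiff Matrix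

noncomputable section

namespace RiemForms

/-! ### Multilinear algebra: inner product of alternating forms and the Hodge star -/

/-- The model space `ℝ^d`. -/
abbrev Euc (d : ℕ) : Type := EuclideanSpace ℝ (Fin d)

/-- Inner product of alternating `k`-forms on a vector space with a frame `b` whose Gram matrix is
`G`: `⟨φ, η⟩ = (1/k!) ∑_{I,J} G^{i₁j₁} ⋯ G^{i_k j_k} φ(b_I) η(b_J)`.
If `b` is a basis and `G` is its Gram matrix, the value does not depend on the basis; the forms
`e^{i₁} ∧ ⋯ ∧ e^{i_k}`, `i₁ < ⋯ < i_k`, built from an orthonormal basis are orthonormal. -/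
def altInner {d k : ℕ} {V : Type*} [AddCommGroup V] [Module ℝ V] [TopologicalSpace V]
    (b : Fin d → V) (G : Matrix (Fin d) (Fin d) ℝ) (φ η : V [⋀^Fin k]→L[ℝ] ℝ) : ℝ :=
  ((k.factorial : ℝ))⁻¹ * ∑ I : Fin k → Fin d, ∑ J : Fin k → Fin d,
    (∏ a, G⁻¹ (I a) (J a)) * (φ (fun a => b (I a)) * η (fun a => b (J a)))

/-- The standard basis of `ℝ^d`. -/
def stdVec (d : ℕ) (i : Fin d) : Euc d := EuclideanSpace.single i 1

/-- The determinant `dx¹ ∧ ⋯ ∧ dx^d` as a continuous alternating form on `ℝ^d`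
(where the number of arguments is written as `m = d`). -/
def detForm {d m : ℕ} (h : d = m) : Euc d [⋀^Fin m]→L[ℝ] ℝ :=
  { (EuclideanSpace.basisFun (Fin d) ℝ).toBasis.det.domDomCongr (finCongr h) with
    cont := by
      change Continuous fun v : Fin m → Euc d =>
        (EuclideanSpace.basisFun (Fin d) ℝ).toBasis.det fun i => v (finCongr h i)
      simp only [Module.Basis.det_apply]
      refine Continuous.matrix_det (continuous_matrix fun i j => ?_)
      simp only [Module.Basis.toMatrix_apply, OrthonormalBasis.coe_toBasis_repr_apply,
        EuclideanSpace.basisFun_repr]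
      fun_prop }

/-- Insertion of the vectors `v₁, …, v_k` in the first `k` slots:
`(w₁, …, w_l) ↦ φ(v₁, …, v_k, w₁, …, w_l)`. -/
def insertFirst {d l : ℕ} : (k : ℕ) → (Fin k → Euc d) →
    (Euc d [⋀^Fin (l + k)]→L[ℝ] ℝ) → (Euc d [⋀^Fin l]→L[ℝ] ℝ)
  | 0, _, φ => φ
  | k + 1, v, φ => insertFirst k (Fin.tail v) (ContinuousAlternatingMap.curryLeft φ (v 0))

/-- The Hodge star on `k`-forms on `ℝ^d` with the inner product whose Gram matrix in the standard
basis is `G` and with the standard orientation: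
`(⋆φ)(w) = (1/k!) ∑_{I,J} G^{i₁j₁} ⋯ G^{i_k j_k} φ(e_J) √(det G) det(e_I, w)`.
In particular `⋆(e¹ ∧ ⋯ ∧ e^k) = e^{k+1} ∧ ⋯ ∧ e^d` for the dual basis of a positively oriented
orthonormal basis, that is, `η ∧ ⋆φ = ⟨η, φ⟩ vol`. -/
def hodgeStar {d k l : ℕ} (h : d = l + k) (G : Matrix (Fin d) (Fin d) ℝ)
    (φ : Euc d [⋀^Fin k]→L[ℝ] ℝ) : Euc d [⋀^Fin l]→L[ℝ] ℝ :=
  (((k.factorial : ℝ))⁻¹ * √G.det) • ∑ I : Fin k → Fin d, ∑ J : Fin k → Fin d,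
    ((∏ a, G⁻¹ (I a) (J a)) * φ (fun a => stdVec d (J a))) •
      insertFirst k (fun a => stdVec d (I a)) (detForm h)

/-- The co-derivative `δ = ± ⋆ d ⋆` of a `(q+1)`-form `η` on an open part of `ℝ^d`, for the
Riemannian metric with Gram matrix `G z` at `z`. The sign `(-1)^{dq}` is the one for which `-δ` is
the formal adjoint of `d` (so `δ` is the divergence for `q = 0`). All `(q+1)`-forms vanish
if `d < q + 1`. -/
def coordCodiff {d q : ℕ} (G : Euc d → Matrix (Fin d) (Fin d) ℝ)
    (η : Euc d → Euc d [⋀^Fin (q + 1)]→L[ℝ] ℝ) (y : Euc d) : Euc d [⋀^Fin q]→L[ℝ] ℝ :=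
  if h : q + 1 ≤ d then
    ((-1 : ℝ) ^ (d * q)) •
      hodgeStar (k := (d - (q + 1)) + 1) (l := q) (by omega) (G y)
        (extDeriv (fun z => hodgeStar (k := q + 1) (l := d - (q + 1)) (by omega) (G z) (η z)) y)
  else 0

/-! ### Forms on a manifold -/

section Manifold

variable {d : ℕ} {M : Type*} [TopologicalSpace M] [ChartedSpace (Euc d) M]

variable (d M) in
/-- (Not necessarily continuous) differential `k`-forms on `M`. -/
abbrev Form (k : ℕ) : Type _ := ∀ x : M, TangentSpace (𝓡 d) x [⋀^Fin k]→L[ℝ] ℝ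

variable (d M) in
/-- Fields of linear transformations of `k`-forms. -/
abbrev Coeff (k : ℕ) : Type _ := ∀ x : M, Module.End ℝ (TangentSpace (𝓡 d) x [⋀^Fin k]→L[ℝ] ℝ)

/-- Coordinate expression of a form in a chart `e`: the pullback by `e⁻¹`. -/
def chartForm {k : ℕ} (e : OpenPartialHomeomorph M (Euc d)) (φ : Form d M k) (y : Euc d) :
    Euc d [⋀^Fin k]→L[ℝ] ℝ :=
  (φ (e.symm y)).compContinuousLinearMap
    (mfderiv (𝓡 d) (𝓡 d) e.symm y : Euc d →L[ℝ] TangentSpace (𝓡 d) (e.symm y))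

/-- A form is smooth if all its coordinate expressions are. -/
def Form.Smooth {k : ℕ} (φ : Form d M k) : Prop :=
  ∀ e ∈ atlas (Euc d) M, ContDiffOn ℝ ∞ (chartForm e φ) e.target

/-- The exterior derivative (of a smooth form), computed in the chart at the point. -/
def extD {k : ℕ} (φ : Form d M k) : Form d M (k + 1) := fun x =>
  (extDeriv (chartForm (chartAt (Euc d) x) φ) (chartAt (Euc d) x x)).compContinuousLinearMap
    (mfderiv (𝓡 d) (𝓡 d) (chartAt (Euc d) x) x : TangentSpace (𝓡 d) x →L[ℝ] Euc d)

/-- The support of a form. -/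
def Form.support {k : ℕ} (φ : Form d M k) : Set M := closure {x | φ x ≠ 0}

/-- Measurability (up to null sets) of a form on `Ω`: its coordinate expressions are measurable. -/
def Form.MeasurableOn {k : ℕ} (φ : Form d M k) (Ω : Set M) : Prop :=
  ∀ e ∈ atlas (Euc d) M,
    AEStronglyMeasurable (chartForm e φ) (volume.restrict (e.target ∩ e.symm ⁻¹' Ω))

/-- `φ` is a smooth form with compact support in the open set `Ω`. -/
def IsTestForm {k : ℕ} (Ω : Set M) (φ : Form d M k) : Prop :=
  φ.Smooth ∧ IsCompact φ.support ∧ φ.support ⊆ Ω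

/-- `φ` is a smooth form with compact support bounded away from `S` (for a compact support this
means that it does not meet the closure of `S`). The restrictions of these forms to `Ω` are the
smooth test forms on `Ω` (up to the boundary) with supports bounded away from the boundary
part `S`. -/
def IsTestFormAway {k : ℕ} (S : Set M) (φ : Form d M k) : Prop :=
  φ.Smooth ∧ IsCompact φ.support ∧ Disjoint φ.support (closure S)

/-! ### Domains with Lipschitz boundary -/

variable (d) in
/-- The boundary of `Ω` is Lipschitz: near each of its points there are coordinates, obtained from a
smooth chart of `M` by a bi-Lipschitz homeomorphism, in which `Ω` is a half space. -/
def HasLipschitzBoundary (Ω : Set M) : Prop :=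
  ∀ x ∈ frontier Ω, ∃ e ∈ IsManifold.maximalAtlas (𝓡 d) ∞ M, x ∈ e.source ∧
    ∃ ψ : OpenPartialHomeomorph (Euc d) (Euc d), e x ∈ ψ.source ∧ ψ.source ⊆ e.target ∧
      (∃ K, LipschitzOnWith K ψ ψ.source) ∧ (∃ K, LipschitzOnWith K ψ.symm ψ.target) ∧
      ∃ i : Fin d, ∀ y ∈ ψ.source, (e.symm y ∈ Ω ↔ 0 < ψ y i)

variable (d) in
/-- `Ω` is bounded (has compact closure), or outside of some compact set it is isomorphic to
the exterior `{|y| > 1}` of the unit ball of `ℝ^d`. -/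
def BoundedOrExterior (Ω : Set M) : Prop :=
  IsCompact (closure Ω) ∨ ∃ K : Set M, IsCompact K ∧
    ∃ e ∈ IsManifold.maximalAtlas (𝓡 d) ∞ M,
      e.source = Ω \ K ∧ e.target = {y : Euc d | 1 < ‖y‖}

/-! ### Riemannian metrics -/

variable [IsManifold (𝓡 d) ∞ M]

variable (d M) in
/-- Smooth Riemannian metrics on `M`. -/
abbrev Metric : Type _ :=
  Bundle.ContMDiffRiemannianMetric (𝓡 d) ∞ (Euc d) (fun x : M => TangentSpace (𝓡 d) x)

/-- The Gram matrix of the coordinate vector fields of the chart `e`, in coordinates. -/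
def chartGram (g : Metric d M) (e : OpenPartialHomeomorph M (Euc d)) (y : Euc d) :
    Matrix (Fin d) (Fin d) ℝ :=
  Matrix.of fun i j => g.inner (e.symm y)
    (mfderiv (𝓡 d) (𝓡 d) e.symm y (stdVec d i)) (mfderiv (𝓡 d) (𝓡 d) e.symm y (stdVec d j))

/-- A basis of the tangent space: the standard basis of the model space (in Mathlib, the tangent
space is a copy of the model space). -/
def tangentFrame (x : M) (i : Fin d) : TangentSpace (𝓡 d) x := (stdVec d i : Euc d)

/-- The inner product of two alternating forms on the tangent space at `x`. -/
def ptInner (g : Metric d M) (x : M) {k : ℕ}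
    (φ η : TangentSpace (𝓡 d) x [⋀^Fin k]→L[ℝ] ℝ) : ℝ :=
  altInner (tangentFrame x)
    (Matrix.of fun i j => g.inner x (tangentFrame x i) (tangentFrame x j)) φ η

/-- The co-derivative `δ = ± ⋆ d ⋆` (of a smooth form), computed in the chart at the point. It does
not depend on the orientation used in the chart since the star enters twice. -/
def codiff (g : Metric d M) {q : ℕ} (η : Form d M (q + 1)) : Form d M q := fun x =>
  (coordCodiff (chartGram g (chartAt (Euc d) x)) (chartForm (chartAt (Euc d) x) η)
    (chartAt (Euc d) x x)).compContinuousLinearMap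
    (mfderiv (𝓡 d) (𝓡 d) (chartAt (Euc d) x) x : TangentSpace (𝓡 d) x →L[ℝ] Euc d)

variable [MeasurableSpace M]

/-- The measure `√(det G) dy` of a chart domain, transported to `M`. -/
def chartMeasure (g : Metric d M) (e : OpenPartialHomeomorph M (Euc d)) : Measure M :=
  ((volume.restrict e.target).withDensity
    (fun y => ENNReal.ofReal (√(chartGram g e y).det))).map e.symm

/-- The Riemannian volume measure: the smallest measure that is bounded below by `√(det G) dy` in
every chart (on each chart domain it then coincides with `√(det G) dy`). -/
def riemVolume (g : Metric d M) : Measure M := ⨆ e ∈ atlas (Euc d) M, chartMeasure g e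

/-! ### `L²` spaces and Sobolev spaces of forms on an open set `Ω` -/

/-- The scalar product `∫_Ω φ ∧ ⋆η = ∫_Ω ⟨φ, η⟩ dvol`. -/
def l2Inner (g : Metric d M) (Ω : Set M) {k : ℕ} (φ η : Form d M k) : ℝ :=
  ∫ x in Ω, ptInner g x (φ x) (η x) ∂(riemVolume g)

/-- `φ` is a square integrable form on `Ω`. -/
def MemL2 (g : Metric d M) (Ω : Set M) {k : ℕ} (φ : Form d M k) : Prop :=
  φ.MeasurableOn Ω ∧ IntegrableOn (fun x => ptInner g x (φ x) (φ x)) Ω (riemVolume g)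

/-- The weighted squared norm `‖φ‖²_A = ∫_Ω ⟨A φ, φ⟩ dvol`. -/
def wNormSq (g : Metric d M) (Ω : Set M) {k : ℕ} (A : Coeff d M k) (φ : Form d M k) : ℝ :=
  l2Inner g Ω (fun x => A x (φ x)) φ

/-- The pointwise inverse of a field of transformations. -/
def Coeff.inv {k : ℕ} (A : Coeff d M k) : Coeff d M k := fun x => Ring.inverse (A x)

/-- `A` is a measurable, symmetric, bounded and uniformly positive definite field of linear
transformations of `k`-forms on `Ω`. -/
structure IsAdmissibleCoeff (g : Metric d M) (Ω : Set M) {k : ℕ} (A : Coeff d M k) : Prop where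
  measurable : ∀ φ : Form d M k, φ.MeasurableOn Ω → Form.MeasurableOn (fun x => A x (φ x)) Ω
  symm : ∀ᵐ x ∂((riemVolume g).restrict Ω), ∀ φ η : TangentSpace (𝓡 d) x [⋀^Fin k]→L[ℝ] ℝ,
    ptInner g x (A x φ) η = ptInner g x φ (A x η)
  bounded : ∃ C : ℝ, ∀ᵐ x ∂((riemVolume g).restrict Ω),
    ∀ φ : TangentSpace (𝓡 d) x [⋀^Fin k]→L[ℝ] ℝ,
      ptInner g x (A x φ) (A x φ) ≤ C * ptInner g x φ φ
  posDef : ∃ c : ℝ, 0 < c ∧ ∀ᵐ x ∂((riemVolume g).restrict Ω),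
    ∀ φ : TangentSpace (𝓡 d) x [⋀^Fin k]→L[ℝ] ℝ, c * ptInner g x φ φ ≤ ptInner g x (A x φ) φ

/-- `u ∈ D^q(Ω)`, that is `u ∈ L²` has a weak exterior derivative in `L²`, and `du` is (a
representative of) it. -/
structure MemD (g : Metric d M) (Ω : Set M) {q : ℕ} (u : Form d M q) (du : Form d M (q + 1)) :
    Prop where
  memL2 : MemL2 g Ω u
  memL2_d : MemL2 g Ω du
  weak : ∀ η : Form d M (q + 1), IsTestForm Ω η → l2Inner g Ω du η = -l2Inner g Ω u (codiff g η)

/-- `p ∈ Δ^{q+1}(Ω)`, that is `p ∈ L²` has a weak co-derivative in `L²`, and `δp` is (a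
representative of) it. -/
structure MemDelta (g : Metric d M) (Ω : Set M) {q : ℕ} (p : Form d M (q + 1)) (δp : Form d M q) :
    Prop where
  memL2 : MemL2 g Ω p
  memL2_δ : MemL2 g Ω δp
  weak : ∀ ζ : Form d M q, IsTestForm Ω ζ → l2Inner g Ω δp ζ = -l2Inner g Ω p (extD ζ)

/-- `u ∈ D^q_S(Ω)`, with weak exterior derivative `du`: `u` belongs to the closure in `D^q(Ω)`, for
the graph norm, of the smooth test forms with supports bounded away from `S`. -/
structure MemDBdry (g : Metric d M) (Ω S : Set M) {q : ℕ} (u : Form d M q)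
    (du : Form d M (q + 1)) : Prop where
  memD : MemD g Ω u du
  approx : ∀ ε : ℝ, 0 < ε → ∃ ζ : Form d M q, IsTestFormAway S ζ ∧
    l2Inner g Ω (u - ζ) (u - ζ) + l2Inner g Ω (du - extD ζ) (du - extD ζ) < ε

/-- `p ∈ Δ^{q+1}_S(Ω)`, with weak co-derivative `δp`: `p` belongs to the closure in `Δ^{q+1}(Ω)`,
for the graph norm, of the smooth test forms with supports bounded away from `S`. -/
structure MemDeltaBdry (g : Metric d M) (Ω S : Set M) {q : ℕ} (p : Form d M (q + 1))
    (δp : Form d M q) : Prop where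
  memDelta : MemDelta g Ω p δp
  approx : ∀ ε : ℝ, 0 < ε → ∃ ξ : Form d M (q + 1), IsTestFormAway S ξ ∧
    l2Inner g Ω (p - ξ) (p - ξ) + l2Inner g Ω (δp - codiff g ξ) (δp - codiff g ξ) < ε

/-! ### The boundary value problem -/

/-- `(u, p) ∈ D^q_{ΓD} × Δ^{q+1}_{ΓN}` (with derivatives `du`, `δp`) solves the mixed formulation
`-δp + ρ u = f`, `α du = p` of `-δ α d u + ρ u = f` with mixed boundary conditions. -/
structure IsSolution (g : Metric d M) (Ω ΓD ΓN : Set M) {q : ℕ} (ρ : Coeff d M q)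
    (α : Coeff d M (q + 1)) (f u : Form d M q) (du p : Form d M (q + 1)) (δp : Form d M q) :
    Prop where
  mem_u : MemDBdry g Ω ΓD u du
  mem_p : MemDeltaBdry g Ω ΓN p δp
  balance : ∀ᵐ x ∂((riemVolume g).restrict Ω), -δp x + ρ x (u x) = f x
  flux : ∀ᵐ x ∂((riemVolume g).restrict Ω), α x (du x) = p x

/-- The squared combined norm
`|||(u,p)|||² = ‖u‖²_ρ + ‖du‖²_α + ‖p‖²_{α⁻¹} + ‖δp‖²_{ρ⁻¹}`, as a function of the
fields and their derivatives. -/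
def combinedNormSq (g : Metric d M) (Ω : Set M) {q : ℕ} (ρ : Coeff d M q)
    (α : Coeff d M (q + 1)) (u : Form d M q) (du p : Form d M (q + 1)) (δp : Form d M q) : ℝ :=
  (wNormSq g Ω ρ u + wNormSq g Ω α du) + (wNormSq g Ω α.inv p + wNormSq g Ω ρ.inv δp)

/-- The error functional `‖f - ρ u + δp‖²_{ρ⁻¹} + ‖p - α du‖²_{α⁻¹}`. -/
def majorant (g : Metric d M) (Ω : Set M) {q : ℕ} (ρ : Coeff d M q) (α : Coeff d M (q + 1))
    (f u : Form d M q) (du p : Form d M (q + 1)) (δp : Form d M q) : ℝ :=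
  wNormSq g Ω ρ.inv (fun x => f x - ρ x (u x) + δp x) +
    wNormSq g Ω α.inv (fun x => p x - α x (du x))

end Manifold

end RiemForms

end

/-!
The identity is a Prager–Synge type hypercircle argument. Write `(e, ε) = (u - u', p - p')`. By the
two equations for `(u, p)` the residuals of the approximation are
`f - ρ u' + δp' = ρ e - δε` and `p' - α du' = α de - ε`. Expanding their squares in the norms
weighted with `ρ⁻¹` and `α⁻¹` (`wNormSq_inv_sub`) gives the combined norm of `(e, ε)` up to the
mixed term `-2 (⟨de, ε⟩ + ⟨e, δε⟩)`, which vanishes because `-δ` on `Δ_{ΓN}` and `d` on `D_{ΓD}` are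
formally adjoint (`l2Inner_green`). With `(u', p') = 0` the residuals are `f` and `0`, so the
combined norm of the exact solution is `‖f‖` in the weight `ρ⁻¹`; this gives the second assertion.

The analytic core is `l2Inner_green`. By definition of the two spaces, and since the scalar product
is continuous in mean square, it suffices to take smooth forms `ζ`, `ξ` with compact supports away
from `ΓD` and `ΓN`. As `closure ΓD ∪ closure ΓN` contains the boundary of `Ω`, the common support of
`ζ` and `ξ` in `closure Ω` is a compact subset of `Ω`, and a partition of
unity reduces the formula to a form supported in one chart
(`setIntegral_greenDensity`). There it is an integration by parts in `ℝ^d`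
(`setIntegral_green_coord`): in components, `√(det G) (⟨dφ, η⟩ + ⟨φ, δη⟩)` is the divergence of a
vector field with compact support (`sqrt_det_mul_green_eq_div`). The algebraic input is that
`√(det G) ⟨φ, η⟩` is the coefficient of `φ ∧ ⋆η` (`sqrt_det_mul_altInner`).

The objects are defined through charts, so `d`, `δ` and the inner product have to be compared in
different charts (`chartForm_extD`, `chartForm_codiff`, `ptInner_eq_chart`), and the Riemannian
measure, a supremum of chart measures, has to be identified on chart domains
(`riemVolume_restrict_source`). The inverse coefficients are measurable as pointwise limits of a
Richardson iteration (`tendsto_richardson`).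
-/

noncomputable section

namespace RiemForms

/-! ### Alternating forms in a frame -/

section Algebra

variable {d k l : ℕ} {V : Type*} [AddCommGroup V] [Module ℝ V] [TopologicalSpace V]

/-- The components of an alternating form in a frame. -/
def frameVec (b : Fin d → V) (φ : V [⋀^Fin k]→L[ℝ] ℝ) (I : Fin k → Fin d) : ℝ :=
  φ fun a => b (I a)

/-- The `k`-th tensor power of a matrix, acting on components of `k`-forms. -/
def tensorPow (k : ℕ) (H : Matrix (Fin d) (Fin d) ℝ) :
    Matrix (Fin k → Fin d) (Fin k → Fin d) ℝ :=
  Matrix.of fun I J => ∏ a, H (I a) (J a)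

theorem tensorPow_apply (H : Matrix (Fin d) (Fin d) ℝ) (I J : Fin k → Fin d) :
    tensorPow k H I J = ∏ a, H (I a) (J a) := rfl

theorem tensorPow_mul (A B : Matrix (Fin d) (Fin d) ℝ) :
    tensorPow k (A * B) = tensorPow k A * tensorPow k B := by
  ext I J
  simp only [tensorPow_apply, Matrix.mul_apply, Finset.prod_univ_sum, Fintype.piFinset_univ,
    Finset.prod_mul_distrib]

theorem tensorPow_one : tensorPow k (1 : Matrix (Fin d) (Fin d) ℝ) = 1 := by
  ext I J
  by_cases h : I = J
  · subst h; simp [tensorPow_apply]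
  · obtain ⟨a, ha⟩ := Function.ne_iff.1 h
    rw [Matrix.one_apply_ne h, tensorPow_apply]
    exact Finset.prod_eq_zero (Finset.mem_univ a) (Matrix.one_apply_ne ha)

theorem tensorPow_transpose (A : Matrix (Fin d) (Fin d) ℝ) :
    tensorPow k Aᵀ = (tensorPow k A)ᵀ := rfl

theorem altInner_eq (b : Fin d → V) (G : Matrix (Fin d) (Fin d) ℝ) (φ η : V [⋀^Fin k]→L[ℝ] ℝ) :
    altInner b G φ η =
      ((k.factorial : ℝ))⁻¹ * (frameVec b φ ⬝ᵥ tensorPow k G⁻¹ *ᵥ frameVec b η) := by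
  simp only [altInner, dotProduct, Matrix.mulVec, Finset.mul_sum, tensorPow_apply, frameVec]
  refine Finset.sum_congr rfl fun I _ => Finset.sum_congr rfl fun J _ => ?_
  ring

theorem frameVec_sum (b : Fin d → V) (T : Matrix (Fin d) (Fin d) ℝ) (φ : V [⋀^Fin k]→L[ℝ] ℝ) :
    frameVec (fun i => ∑ j, T j i • b j) φ = (tensorPow k T)ᵀ *ᵥ frameVec b φ := by
  ext I
  have h := φ.toMultilinearMap.map_sum (fun (a : Fin k) (j : Fin d) => T j (I a) • b j)
  simp only [frameVec, Matrix.mulVec, dotProduct, Matrix.transpose_apply, tensorPow_apply]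
  refine Eq.trans h (Finset.sum_congr rfl fun J _ => ?_)
  exact φ.toMultilinearMap.map_smul_univ (fun a => T (J a) (I a)) (fun a => b (J a))

/-- Invariance of the inner product of forms under a change of frame. -/
theorem altInner_frame_change (b : Fin d → V) (G T : Matrix (Fin d) (Fin d) ℝ)
    (hT : IsUnit T.det) (φ η : V [⋀^Fin k]→L[ℝ] ℝ) :
    altInner (fun i => ∑ j, T j i • b j) (Tᵀ * G * T) φ η = altInner b G φ η := by
  have hT' : IsUnit Tᵀ.det := by rwa [Matrix.det_transpose]
  rw [altInner_eq, altInner_eq, frameVec_sum, frameVec_sum]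
  congr 1
  rw [Matrix.mulVec_transpose, ← Matrix.dotProduct_mulVec, Matrix.mulVec_mulVec,
    Matrix.mulVec_mulVec, ← tensorPow_transpose, ← tensorPow_mul, ← tensorPow_mul,
    Matrix.mul_inv_rev, Matrix.mul_inv_rev]
  congr 3
  rw [← Matrix.mul_assoc, Matrix.mul_nonsing_inv _ hT, Matrix.one_mul, Matrix.mul_assoc,
    Matrix.nonsing_inv_mul _ hT', Matrix.mul_one]

theorem frameVec_add (b : Fin d → V) (φ η : V [⋀^Fin k]→L[ℝ] ℝ) :
    frameVec b (φ + η) = frameVec b φ + frameVec b η := rfl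

theorem frameVec_smul (b : Fin d → V) (c : ℝ) (φ : V [⋀^Fin k]→L[ℝ] ℝ) :
    frameVec b (c • φ) = c • frameVec b φ := rfl

/-- The components of a form on a basis determine it. -/
theorem frameVec_std_injective :
    Function.Injective (frameVec (k := k) (stdVec d)) := by
  intro φ η h
  have : φ.toAlternatingMap = η.toAlternatingMap := by
    refine Module.Basis.ext_alternating (EuclideanSpace.basisFun (Fin d) ℝ).toBasis fun v _ => ?_
    have := congrFun h v
    simpa [frameVec, stdVec] using this
  exact ContinuousAlternatingMap.toAlternatingMap_injective this

/-! ### Permuting blocks of arguments -/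

theorem finRotate_pow_val (n m : ℕ) (i : Fin n) :
    (((finRotate n) ^ m) i : ℕ) = (i + m) % n := by
  obtain _ | n := n
  · exact i.elim0
  induction m with
  | zero => simp [Nat.mod_eq_of_lt i.2]
  | succ m ih =>
    rw [pow_succ', Equiv.Perm.mul_apply, finRotate_apply, Fin.val_add, ih]
    rw [Fin.val_one', ← Nat.add_mod, add_assoc]

/-- Interchanging two blocks of `k` and `l` arguments costs the sign `(-1)^{kl}`. -/
theorem map_append_swap {n : ℕ} (h₁ : n = k + l) (h₂ : n = l + k) (ψ : V [⋀^Fin n]→L[ℝ] ℝ)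
    (v : Fin k → V) (w : Fin l → V) :
    ψ (fun i => Fin.append v w (Fin.cast h₁ i)) =
      (-1) ^ (k * l) * ψ (fun i => Fin.append w v (Fin.cast h₂ i)) := by
  subst h₁
  have key : (fun i => Fin.append v w (Fin.cast rfl i)) =
      (fun i => Fin.append w v (Fin.cast h₂ i)) ∘ ((finRotate (k + l)) ^ l) := by
    funext i
    have hval := finRotate_pow_val (k + l) l i
    simp only [Function.comp_apply, Fin.cast_eq_self]
    refine Fin.addCases (fun a => ?_) (fun b => ?_) i
    · have : Fin.cast h₂ (((finRotate (k + l)) ^ l) (Fin.castAdd l a)) = Fin.natAdd l a := by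
        ext
        rw [Fin.val_cast, finRotate_pow_val, Fin.val_castAdd, Fin.val_natAdd, Nat.mod_eq_of_lt]
        · omega
        · omega
      rw [this, Fin.append_left, Fin.append_right]
    · have : Fin.cast h₂ (((finRotate (k + l)) ^ l) (Fin.natAdd k b)) = Fin.castAdd k b := by
        ext
        rw [Fin.val_cast, finRotate_pow_val, Fin.val_natAdd, Fin.val_castAdd]
        rw [show k + (b : ℕ) + l = b + (k + l) by omega, Nat.add_mod_right, Nat.mod_eq_of_lt]
        omega
      rw [this, Fin.append_left, Fin.append_right]
  rw [key]
  have := ψ.toAlternatingMap.map_perm (fun i => Fin.append w v (Fin.cast h₂ i))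
    ((finRotate (k + l)) ^ l)
  refine Eq.trans this ?_
  have hs : ((Equiv.Perm.sign ((finRotate (k + l)) ^ l) : ℤˣ) : ℤ) = (-1) ^ (k * l) := by
    rw [map_pow, sign_finRotate]
    push_cast
    rw [← pow_mul]
    obtain _ | l := l
    · simp
    · rw [show k + (l + 1) - 1 = k + l by omega, show (k + l) * (l + 1) =
        k * (l + 1) + l * (l + 1) by ring, pow_add, (Nat.even_mul_succ_self l).neg_one_pow, mul_one]
  rw [Units.smul_def, hs, zsmul_eq_mul]
  push_cast
  rfl

/-- `insertFirst` evaluates the form on the two blocks of vectors one after the other. -/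
theorem insertFirst_apply (v : Fin k → Euc d) (φ : Euc d [⋀^Fin (l + k)]→L[ℝ] ℝ)
    (w : Fin l → Euc d) :
    insertFirst k v φ w = φ fun i => Fin.append v w (Fin.cast (add_comm l k) i) := by
  induction k with
  | zero =>
    simp only [insertFirst]
    congr 1
    funext i
    rw [Fin.append_left_nil _ _ rfl]
    simp
  | succ k ih =>
    simp only [insertFirst]
    rw [ih, ContinuousAlternatingMap.curryLeft_apply_apply]
    congr 1
    funext i
    refine Fin.cases ?_ (fun j => ?_) i
    · rw [Matrix.cons_val_zero]
      have : Fin.cast (add_comm l (k + 1)) 0 = Fin.castAdd l (0 : Fin (k + 1)) := by ext; simp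
      rw [this, Fin.append_left]
    · rw [Matrix.cons_val_succ]
      have h2 : v = Fin.cons (v 0) (Fin.tail v) := (Fin.cons_self_tail v).symm
      conv_rhs => rw [h2]
      rw [Fin.append_cons]
      simp only [Function.comp_apply]
      have : Fin.cast (Nat.add_right_comm k 1 l) (Fin.cast (add_comm l (k + 1)) j.succ) =
        Fin.succ (Fin.cast (add_comm l k) j) := by ext; simp
      rw [this, Fin.cons_succ]

end Algebra

/-! ### The determinant of two blocks of basis vectors -/

section Algebra

variable {d k l : ℕ}

theorem detForm_apply {m : ℕ} (h : d = m) (u : Fin m → Euc d) :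
    detForm h u = (Matrix.of fun i j => u (Fin.cast h j) i).det := by
  change (EuclideanSpace.basisFun (Fin d) ℝ).toBasis.det (fun i => u (finCongr h i)) = _
  rw [Module.Basis.det_apply]
  congr 1

/-- The matrix `det (e_I, e_L)`, the components of the volume form of `ℝ^d` split into a block of
`k` and a block of `l` arguments. -/
def blockDet (h : d = l + k) : Matrix (Fin k → Fin d) (Fin l → Fin d) ℝ :=
  Matrix.of fun I L =>
    insertFirst k (fun a => stdVec d (I a)) (detForm h) (fun b => stdVec d (L b))

theorem blockDet_eq_detForm (h : d = l + k) (I : Fin k → Fin d) (L : Fin l → Fin d) :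
    blockDet h I L =
      detForm h fun i => stdVec d (Fin.append I L (Fin.cast (add_comm l k) i)) := by
  rw [blockDet, Matrix.of_apply, insertFirst_apply]
  congr 1
  funext i
  generalize Fin.cast (add_comm l k) i = j
  refine Fin.addCases (fun a => ?_) (fun b => ?_) j <;> simp

theorem blockDet_eq_det (h : d = l + k) (I : Fin k → Fin d) (L : Fin l → Fin d) :
    blockDet h I L = ((1 : Matrix (Fin d) (Fin d) ℝ).submatrix id
      fun j => Fin.append I L (Fin.cast (h.trans (add_comm l k)) j)).det := by
  rw [blockDet_eq_detForm, detForm_apply]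
  congr 1
  ext i j
  simp [stdVec, Matrix.one_apply]

theorem blockDet_swap (h : d = l + k) (h' : d = k + l) (I : Fin k → Fin d) (L : Fin l → Fin d) :
    blockDet h I L = (-1) ^ (k * l) * blockDet h' L I := by
  subst h
  rw [blockDet_eq_detForm, blockDet_eq_detForm]
  have hd : ∀ u : Fin (k + l) → Euc (l + k),
      detForm h' u = detForm rfl (fun i => u (Fin.cast h' i)) := fun u => by
    rw [detForm_apply, detForm_apply]; rfl
  have := map_append_swap (add_comm l k) rfl (detForm (d := l + k) rfl)
    (fun a => stdVec _ (I a)) (fun b => stdVec _ (L b))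
  have hap : ∀ {p r : ℕ} (I : Fin p → Fin (l + k)) (L : Fin r → Fin (l + k)) (j),
      Fin.append (fun a => stdVec (l + k) (I a)) (fun b => stdVec (l + k) (L b)) j =
        stdVec (l + k) (Fin.append I L j) := by
    intro p r I L j
    refine Fin.addCases (fun a => ?_) (fun b => ?_) j <;> simp
  simp only [hap] at this
  rw [this, hd]
  rfl

/-- If `det (e_I, e_L) ≠ 0`, then `I` and `L` together enumerate the indices `1, …, d`. -/
theorem blockDet_ne_zero_imp (h : d = l + k) {I : Fin k → Fin d} {L : Fin l → Fin d}
    (hne : blockDet h I L ≠ 0) :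
    Function.Injective I ∧ (∀ a b, I a ≠ L b) ∧ ∀ m, (∃ a, I a = m) ∨ ∃ b, L b = m := by
  have hdk : d = k + l := h.trans (add_comm l k)
  have hinj : Function.Injective fun j => Fin.append I L (Fin.cast hdk j) := by
    intro i j hij
    by_contra hne'
    apply hne
    rw [blockDet_eq_det]
    refine Matrix.det_zero_of_column_eq hne' fun m => ?_
    simp only [Matrix.submatrix_apply]
    exact congrArg _ hij
  have hsurj := Finite.surjective_of_injective hinj
  have e1 : ∀ j : Fin (k + l), Fin.append I L (Fin.cast hdk (Fin.cast hdk.symm j)) =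
    Fin.append I L j := fun j => by simp
  have hinj' : ∀ i j : Fin (k + l), Fin.append I L i = Fin.append I L j → i = j := by
    intro i j hij
    have := @hinj (Fin.cast hdk.symm i) (Fin.cast hdk.symm j) (by simpa using hij)
    simpa using this
  refine ⟨fun a b hab => ?_, fun a b hab => ?_, fun m => ?_⟩
  · have := hinj' (Fin.castAdd l a) (Fin.castAdd l b) (by simpa using hab)
    simpa using this
  · have := hinj' (Fin.castAdd l a) (Fin.natAdd k b) (by simpa using hab)
    have h2 := congrArg Fin.val this
    simp at h2
    omega
  · obtain ⟨j, hj⟩ := hsurj m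
    revert hj
    simp only
    generalize Fin.cast hdk j = i
    refine Fin.addCases (fun a => ?_) (fun b => ?_) i
    · intro hj; exact Or.inl ⟨a, by simpa using hj⟩
    · intro hj; exact Or.inr ⟨b, by simpa using hj⟩

theorem blockDet_perm (h : d = l + k) (I : Fin k → Fin d) (L : Fin l → Fin d)
    (π : Equiv.Perm (Fin k)) :
    blockDet h (I ∘ π) L = ((Equiv.Perm.sign π : ℤ) : ℝ) * blockDet h I L := by
  have h' : d = k + l := h.trans (add_comm l k)
  rw [blockDet_swap h h', blockDet_swap h h']
  have := (insertFirst l (fun b => stdVec d (L b)) (detForm h')).toAlternatingMap.map_perm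
    (fun a => stdVec d (I a)) π
  have h3 : blockDet h' L (I ∘ π) = ((Equiv.Perm.sign π : ℤ) : ℝ) * blockDet h' L I := by
    refine Eq.trans this ?_
    rw [Units.smul_def, zsmul_eq_mul]
    rfl
  rw [h3]; ring

theorem frameVec_perm (φ : Euc d [⋀^Fin k]→L[ℝ] ℝ) (I : Fin k → Fin d) (π : Equiv.Perm (Fin k)) :
    frameVec (stdVec d) φ (I ∘ π) = ((Equiv.Perm.sign π : ℤ) : ℝ) * frameVec (stdVec d) φ I := by
  refine (φ.toAlternatingMap.map_perm (fun a => stdVec d (I a)) π).trans ?_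
  rw [Units.smul_def, zsmul_eq_mul]
  rfl

/-- In the sum over `J` only the permutations of `I` contribute, all of them equally: `I` and `J`
are both complementary to `L`. -/
theorem sum_blockDet_mul_frameVec (h : d = l + k) (φ : Euc d [⋀^Fin k]→L[ℝ] ℝ)
    (I : Fin k → Fin d) (L : Fin l → Fin d) :
    blockDet h I L * ∑ J, blockDet h J L * frameVec (stdVec d) φ J =
      k.factorial * (blockDet h I L * blockDet h I L * frameVec (stdVec d) φ I) := by
  by_cases hI : blockDet h I L = 0
  · simp [hI]
  obtain ⟨hinj, hdisj, hsurj⟩ := blockDet_ne_zero_imp h hI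
  have hsum : ∑ J, blockDet h J L * frameVec (stdVec d) φ J =
      ∑ π : Equiv.Perm (Fin k), blockDet h (I ∘ π) L * frameVec (stdVec d) φ (I ∘ π) := by
    symm
    refine Finset.sum_of_injOn (fun π => I ∘ π) ?_ (by simp) ?_ (by simp)
    · intro π _ π' _ hp
      ext a
      have := congrFun hp a
      exact congrArg _ (hinj this)
    · intro J _ hJ
      by_contra hne
      have hJL : blockDet h J L ≠ 0 := fun h0 => hne (by rw [h0, zero_mul])
      obtain ⟨Jinj, Jdisj, -⟩ := blockDet_ne_zero_imp h hJL
      have : ∀ a, ∃ b, I b = J a := fun a =>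
        (hsurj (J a)).resolve_right fun ⟨b, hb⟩ => Jdisj a b hb.symm
      choose p hp using this
      have pinj : Function.Injective p := fun a b hab => Jinj (by rw [← hp, ← hp, hab])
      refine hJ ⟨Equiv.ofBijective p (Finite.injective_iff_bijective.1 pinj), by simp, ?_⟩
      funext a
      exact hp a
  rw [hsum]
  have : ∀ π : Equiv.Perm (Fin k), blockDet h (I ∘ π) L * frameVec (stdVec d) φ (I ∘ π) =
      blockDet h I L * frameVec (stdVec d) φ I := by
    intro π
    rw [blockDet_perm, frameVec_perm]
    have : ((Equiv.Perm.sign π : ℤ) : ℝ) * ((Equiv.Perm.sign π : ℤ) : ℝ) = 1 := by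
      rw [← Int.cast_mul, Int.units_coe_mul_self, Int.cast_one]
    linear_combination blockDet h I L * frameVec (stdVec d) φ I * this
  rw [Finset.sum_congr rfl fun π _ => this π]
  rw [Finset.sum_const, Finset.card_univ, Fintype.card_perm, Fintype.card_fin, nsmul_eq_mul]
  ring

/-- A complementary multi-index `L` of `I` gives `det (e_I, e_L) = ± 1`. -/
theorem exists_blockDet_mul_self_eq_one (h : d = l + k) {I : Fin k → Fin d}
    (hI : Function.Injective I) : ∃ L, blockDet h I L * blockDet h I L = 1 := by
  have hcard : Fintype.card (Fin l) = Fintype.card {m // m ∉ Set.range I} := by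
    rw [Fintype.card_subtype_compl, Set.card_range_of_injective hI]
    simp only [Fintype.card_fin]
    omega
  let e : Fin l ≃ {m // m ∉ Set.range I} := Fintype.equivOfCardEq hcard
  have hdk : d = k + l := h.trans (add_comm l k)
  let L : Fin l → Fin d := fun b => (e b : Fin d)
  have hinj : Function.Injective fun j => Fin.append I L (Fin.cast hdk j) := by
    have : Function.Injective (Fin.append I L) := by
      rw [Fin.append_injective_iff]
      refine ⟨hI, fun a b hab => e.injective (Subtype.ext hab), ?_⟩
      intro a b hab
      exact (e b).2 ⟨a, hab⟩
    exact this.comp (Fin.cast_injective hdk)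
  refine ⟨L, ?_⟩
  rw [blockDet_eq_det]
  have := Matrix.det_permute' (Equiv.ofBijective _ (Finite.injective_iff_bijective.1 hinj))
    (1 : Matrix (Fin d) (Fin d) ℝ)
  rw [Matrix.det_one, mul_one] at this
  have h2 : ((1 : Matrix (Fin d) (Fin d) ℝ).submatrix id
      fun j => Fin.append I L (Fin.cast hdk j)).det = _ := this
  rw [h2, ← Int.cast_mul, Int.units_coe_mul_self, Int.cast_one]

/-- The multi-indices complementary to `I` are the `l!` orderings of one of them. -/
theorem sum_blockDet_mul_self (h : d = l + k) {I : Fin k → Fin d} (hI : Function.Injective I) :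
    ∑ L, blockDet h I L * blockDet h I L = l.factorial := by
  obtain ⟨L₀, hL₀⟩ := exists_blockDet_mul_self_eq_one h hI
  have h' : d = k + l := h.trans (add_comm l k)
  have key := sum_blockDet_mul_frameVec h' (insertFirst k (fun a => stdVec d (I a)) (detForm h))
    L₀ I
  have hf : ∀ L, frameVec (stdVec d) (insertFirst k (fun a => stdVec d (I a)) (detForm h)) L =
    blockDet h I L := fun _ => rfl
  simp only [hf, blockDet_swap h' h] at key
  have hs : ((-1 : ℝ) ^ (l * k)) * (-1) ^ (l * k) = 1 := by
    rw [← mul_pow]; norm_num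
  have h0 : blockDet h I L₀ ≠ 0 := fun h0 => by simp [h0] at hL₀
  have key2 : blockDet h I L₀ * ∑ L, blockDet h I L * blockDet h I L =
      blockDet h I L₀ * l.factorial := by
    have e1 : ∑ L, (-1 : ℝ) ^ (l * k) * blockDet h I L * blockDet h I L =
        (-1 : ℝ) ^ (l * k) * ∑ L, blockDet h I L * blockDet h I L := by
      rw [Finset.mul_sum]; exact Finset.sum_congr rfl fun _ _ => by ring
    rw [e1] at key
    linear_combination key - (blockDet h I L₀ * ∑ L, blockDet h I L * blockDet h I L) * hs +
      l.factorial * blockDet h I L₀ * blockDet h I L₀ * blockDet h I L₀ * hs +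
      l.factorial * blockDet h I L₀ * hL₀
  exact mul_left_cancel₀ h0 key2

/-- Contraction of two determinants: on the components of alternating forms,
`∑_{L,J} det(e_I,e_L) det(e_J,e_L) φ_J = k! l! φ_I`. -/
theorem blockDet_mul_transpose_mulVec (h : d = l + k) (φ : Euc d [⋀^Fin k]→L[ℝ] ℝ) :
    (blockDet h * (blockDet h)ᵀ) *ᵥ frameVec (stdVec d) φ =
      ((k.factorial : ℝ) * l.factorial) • frameVec (stdVec d) φ := by
  ext I
  rw [← Matrix.mulVec_mulVec]
  have e1 : (blockDet h *ᵥ (blockDet h)ᵀ *ᵥ frameVec (stdVec d) φ) I =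
      ∑ L, blockDet h I L * ∑ J, blockDet h J L * frameVec (stdVec d) φ J := rfl
  rw [e1, Finset.sum_congr rfl fun L _ => sum_blockDet_mul_frameVec h φ I L, ← Finset.mul_sum,
    ← Finset.sum_mul]
  by_cases hI : Function.Injective I
  · rw [sum_blockDet_mul_self h hI, Pi.smul_apply, smul_eq_mul]; ring
  · have : frameVec (stdVec d) φ I = 0 := by
      simp only [Function.Injective, not_forall] at hI
      obtain ⟨a, b, hab, hne⟩ := hI
      exact φ.map_eq_zero_of_eq _ (by rw [hab]) hne
    simp [this]

/-- The block determinant is multiplied by `det T` if `T` acts on all arguments. -/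
theorem tensorPow_transpose_mul_blockDet (h : d = l + k) (T : Matrix (Fin d) (Fin d) ℝ) :
    (tensorPow k T)ᵀ * blockDet h * tensorPow l T = T.det • blockDet h := by
  have hkd : d = k + l := h.trans (add_comm l k)
  ext I L
  have h1 : (T.submatrix id fun j => Fin.append I L (Fin.cast hkd j)).det =
      T.det * blockDet h I L := by
    rw [blockDet_eq_det, ← Matrix.det_mul]
    congr 1
    ext i j
    simp [Matrix.mul_apply, Matrix.one_apply]
  have h2 := congrFun (frameVec_sum (stdVec d) T (detForm (d := d) hkd))
    (fun j => Fin.append I L j)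
  have h3 : frameVec (fun i => ∑ j, T j i • stdVec d j) (detForm hkd)
      (fun j => Fin.append I L j) =
      (T.submatrix id fun j => Fin.append I L (Fin.cast hkd j)).det := by
    rw [frameVec, detForm_apply]
    congr 1
    ext i j
    simp [stdVec, Pi.single_apply]
  rw [Matrix.smul_apply, smul_eq_mul, ← h1, ← h3, h2]
  simp only [Matrix.mulVec, dotProduct, Matrix.transpose_apply, tensorPow_apply, Matrix.mul_apply,
    Finset.sum_mul]
  rw [Finset.sum_comm, ← Fintype.sum_prod_type', ← (Fin.appendEquiv k l).sum_comp]
  refine Finset.sum_congr rfl fun ⟨K, M⟩ _ => ?_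
  have h4 : frameVec (stdVec d) (detForm hkd) ((Fin.appendEquiv k l) (K, M)) = blockDet h K M := by
    rw [blockDet_eq_detForm, detForm_apply, frameVec, detForm_apply]
    congr 1
  rw [h4, Fin.prod_univ_add]
  simp [Fin.appendEquiv]
  ring

end Algebra

/-! ### The Hodge star in components -/

section Algebra

variable {d k l : ℕ}

theorem sum_blockDet_eq (h : d = l + k) (φ : (Fin k → Fin d) → ℝ) (I : Fin l → Fin d) :
    ∑ J, φ J * blockDet h J I = ((blockDet h)ᵀ *ᵥ φ) I := by
  simp only [Matrix.mulVec, dotProduct, Matrix.transpose_apply, mul_comm]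

/-- The Hodge star in components: raise the indices, then contract with the volume form. -/
theorem frameVec_hodgeStar (h : d = l + k) (G : Matrix (Fin d) (Fin d) ℝ)
    (φ : Euc d [⋀^Fin k]→L[ℝ] ℝ) :
    frameVec (stdVec d) (hodgeStar h G φ) = (((k.factorial : ℝ))⁻¹ * √G.det) •
      ((blockDet h)ᵀ *ᵥ (tensorPow k G⁻¹ *ᵥ frameVec (stdVec d) φ)) := by
  ext L
  rw [Pi.smul_apply, ← sum_blockDet_eq]
  simp only [frameVec, hodgeStar, ContinuousAlternatingMap.smul_apply,
    ContinuousAlternatingMap.sum_apply, smul_eq_mul, Matrix.mulVec, dotProduct, Finset.sum_mul]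
  rfl

/-- The matrix of a linear map in the standard basis of `ℝ^d`. -/
def clmMatrix (A : Euc d →L[ℝ] Euc d) : Matrix (Fin d) (Fin d) ℝ :=
  Matrix.of fun j i => A (stdVec d i) j

theorem clmMatrix_sum (A : Euc d →L[ℝ] Euc d) (i : Fin d) :
    ∑ j, clmMatrix A j i • stdVec d j = A (stdVec d i) := by
  ext m
  simp [clmMatrix, stdVec, Pi.single_apply]

theorem det_clmMatrix (A : Euc d →L[ℝ] Euc d) : (clmMatrix A).det = A.det := by
  rw [ContinuousLinearMap.det, ← LinearMap.det_toMatrix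
    (EuclideanSpace.basisFun (Fin d) ℝ).toBasis]
  rfl

theorem frameVec_compContinuousLinearMap (A : Euc d →L[ℝ] Euc d) (φ : Euc d [⋀^Fin k]→L[ℝ] ℝ) :
    frameVec (stdVec d) (φ.compContinuousLinearMap A) =
      (tensorPow k (clmMatrix A))ᵀ *ᵥ frameVec (stdVec d) φ := by
  rw [← frameVec_sum]
  funext I
  simp only [clmMatrix_sum]
  rfl

theorem sqrt_det_conj (G T : Matrix (Fin d) (Fin d) ℝ) :
    √(Tᵀ * G * T).det = |T.det| * √G.det := by
  rw [Matrix.det_mul, Matrix.det_mul, Matrix.det_transpose,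
    show T.det * G.det * T.det = (T.det * T.det) * G.det by ring,
    Real.sqrt_mul (mul_self_nonneg _), Real.sqrt_mul_self_eq_abs]

/-- The Hodge star commutes with the pullback by a linear isomorphism up to the sign of its
determinant. -/
theorem hodgeStar_pullback (h : d = l + k) (G : Matrix (Fin d) (Fin d) ℝ) (A : Euc d →L[ℝ] Euc d)
    (hA : IsUnit (clmMatrix A).det) (φ : Euc d [⋀^Fin k]→L[ℝ] ℝ) :
    hodgeStar h ((clmMatrix A)ᵀ * G * clmMatrix A) (φ.compContinuousLinearMap A) =
      (|(clmMatrix A).det| / (clmMatrix A).det) •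
        (hodgeStar h G φ).compContinuousLinearMap A := by
  apply frameVec_std_injective
  rw [frameVec_smul, frameVec_compContinuousLinearMap, frameVec_hodgeStar, frameVec_hodgeStar,
    frameVec_compContinuousLinearMap, sqrt_det_conj]
  generalize clmMatrix A = T at *
  have hT' : IsUnit Tᵀ.det := by rwa [Matrix.det_transpose]
  have h1 : (Tᵀ * G * T)⁻¹ * Tᵀ = T⁻¹ * G⁻¹ := by
    rw [Matrix.mul_inv_rev, Matrix.mul_inv_rev, Matrix.mul_assoc, Matrix.mul_assoc,
      Matrix.nonsing_inv_mul _ hT', Matrix.mul_one]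
  have h2 : (blockDet h)ᵀ * tensorPow k T⁻¹ =
      (T.det)⁻¹ • ((tensorPow l T)ᵀ * (blockDet h)ᵀ) := by
    have := congrArg Matrix.transpose (tensorPow_transpose_mul_blockDet h T)
    rw [Matrix.transpose_mul, Matrix.transpose_mul, Matrix.transpose_transpose,
      Matrix.transpose_smul, ← Matrix.mul_assoc] at this
    have h3 : (T.det • (blockDet h)ᵀ) * tensorPow k T⁻¹ =
        (tensorPow l T)ᵀ * (blockDet h)ᵀ := by
      rw [← this, Matrix.mul_assoc, ← tensorPow_mul, Matrix.mul_nonsing_inv _ hA, tensorPow_one,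
        Matrix.mul_one]
    rw [← h3, Matrix.smul_mul, smul_smul, inv_mul_cancel₀ hA.ne_zero, one_smul]
  rw [← tensorPow_transpose, Matrix.mulVec_mulVec (frameVec _ _) (tensorPow k _) (tensorPow k _),
    ← tensorPow_mul, h1, tensorPow_mul, Matrix.mulVec_mulVec, ← Matrix.mul_assoc, h2,
    Matrix.mulVec_smul, smul_smul, Matrix.smul_mul, Matrix.smul_mulVec, smul_smul,
    Matrix.mulVec_mulVec, Matrix.mulVec_mulVec]
  congr 1
  field_simp

/-- The coefficient of `α ∧ θ` with respect to `dx¹ ∧ ⋯ ∧ dx^d`, for a `k`-form `α` and an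
`l`-form `θ` with `k + l = d`. -/
def wedgeCoeff (h : d = l + k) (α : Euc d [⋀^Fin k]→L[ℝ] ℝ) (θ : Euc d [⋀^Fin l]→L[ℝ] ℝ) : ℝ :=
  ((k.factorial : ℝ) * l.factorial)⁻¹ *
    (frameVec (stdVec d) α ⬝ᵥ blockDet h *ᵥ frameVec (stdVec d) θ)

/-- The defining property `α ∧ ⋆η = ⟨α, η⟩ vol` of the Hodge star. -/
theorem sqrt_det_mul_altInner (h : d = l + k) (G : Matrix (Fin d) (Fin d) ℝ)
    (α η : Euc d [⋀^Fin k]→L[ℝ] ℝ) :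
    √G.det * altInner (stdVec d) G α η = wedgeCoeff h α (hodgeStar h G η) := by
  have hsymm : (blockDet h * (blockDet h)ᵀ)ᵀ = blockDet h * (blockDet h)ᵀ := by
    rw [Matrix.transpose_mul, Matrix.transpose_transpose]
  rw [altInner_eq, wedgeCoeff, frameVec_hodgeStar, Matrix.mulVec_smul, dotProduct_smul,
    Matrix.mulVec_mulVec, Matrix.dotProduct_mulVec _ (blockDet h * (blockDet h)ᵀ),
    ← Matrix.mulVec_transpose, hsymm, blockDet_mul_transpose_mulVec, smul_dotProduct, smul_eq_mul,
    smul_eq_mul]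
  have h1 : (k.factorial : ℝ) ≠ 0 := by exact_mod_cast k.factorial_ne_zero
  have h2 : (l.factorial : ℝ) ≠ 0 := by exact_mod_cast l.factorial_ne_zero
  field_simp

/-- Since `⋆⋆ = ±1`, also `⟨φ, ⋆η⟩ vol = η ∧ φ`. -/
theorem sqrt_det_mul_altInner_hodgeStar (h : d = l + k) (G : Matrix (Fin d) (Fin d) ℝ)
    (hG : Gᵀ = G) (hpos : 0 < G.det) (φ : Euc d [⋀^Fin l]→L[ℝ] ℝ) (η : Euc d [⋀^Fin k]→L[ℝ] ℝ) :
    √G.det * altInner (stdVec d) G φ (hodgeStar h G η) = wedgeCoeff h η φ := by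
  have hGi : (G⁻¹)ᵀ = G⁻¹ := by rw [Matrix.transpose_nonsing_inv, hG]
  have key := congrArg Matrix.transpose (tensorPow_transpose_mul_blockDet h G⁻¹)
  rw [Matrix.det_nonsing_inv, Ring.inverse_eq_inv', Matrix.transpose_mul, Matrix.transpose_mul,
    Matrix.transpose_transpose, Matrix.transpose_smul, ← tensorPow_transpose, hGi] at key
  rw [altInner_eq, wedgeCoeff, frameVec_hodgeStar, Matrix.mulVec_smul, dotProduct_smul,
    Matrix.mulVec_mulVec, Matrix.mulVec_mulVec, Matrix.mul_assoc, key, Matrix.smul_mulVec,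
    dotProduct_smul, Matrix.mulVec_transpose, dotProduct_comm _ (_ ᵥ* _), ← Matrix.dotProduct_mulVec,
    smul_eq_mul, smul_eq_mul]
  have h1 : (k.factorial : ℝ) ≠ 0 := by exact_mod_cast k.factorial_ne_zero
  have h2 : (l.factorial : ℝ) ≠ 0 := by exact_mod_cast l.factorial_ne_zero
  have h3 : √G.det * √G.det = G.det := Real.mul_self_sqrt hpos.le
  generalize frameVec (stdVec d) η ⬝ᵥ blockDet h *ᵥ frameVec (stdVec d) φ = x
  field_simp
  linear_combination x * h3

end Algebra

/-! ### The product rule for `d` and `⋆ d ⋆` in coordinates -/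

section Coordinates

variable {d k l q : ℕ}

theorem blockDet_insertNth (h : d = l + (k + 1)) (i : Fin (k + 1)) (j : Fin d)
    (J : Fin k → Fin d) (L : Fin l → Fin d) :
    blockDet h (i.insertNth j J) L = (-1) ^ (i : ℕ) * blockDet h (Fin.cons j J) L := by
  have h' : d = (k + 1) + l := h.trans (add_comm l (k + 1))
  rw [blockDet_swap h h', blockDet_swap h h']
  have key := (insertFirst l (fun b => stdVec d (L b)) (detForm h')).toAlternatingMap.map_insertNth
    i (stdVec d j) (fun a => stdVec d (J a))
  have e1 : (fun a => stdVec d ((i.insertNth j J : Fin (k + 1) → Fin d) a)) =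
      i.insertNth (stdVec d j) (fun a => stdVec d (J a)) := by
    funext a
    refine Fin.succAboveCases i ?_ (fun b => ?_) a <;> simp
  have e2 : (fun a => stdVec d ((Fin.cons j J : Fin (k + 1) → Fin d) a)) =
      Matrix.vecCons (stdVec d j) (fun a => stdVec d (J a)) := by
    funext a
    refine Fin.cases ?_ (fun b => ?_) a <;> simp
  have e3 : blockDet h' L (i.insertNth j J) =
      (-1) ^ (i : ℕ) * blockDet h' L (Fin.cons j J) := by
    rw [blockDet, Matrix.of_apply, Matrix.of_apply, e1, e2]
    refine key.trans ?_
    rw [zsmul_eq_mul]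
    push_cast
    rfl
  rw [e3]; ring

/-- Moving the index `j` from one block to the front of the other; this produces the sign in the
product rule for `d (φ ∧ ⋆η)`. -/
theorem blockDet_cons_swap (h : d = l + (k + 1)) (h' : d = k + (l + 1)) (j : Fin d)
    (J : Fin k → Fin d) (L : Fin l → Fin d) :
    blockDet h' (Fin.cons j L) J = (-1) ^ (k * l) * blockDet h (Fin.cons j J) L := by
  subst h
  have hap : ∀ {p r : ℕ} (I : Fin p → Fin (l + (k + 1))) (L : Fin r → Fin (l + (k + 1))) (j),
      Fin.append (fun a => stdVec (l + (k + 1)) (I a)) (fun b => stdVec (l + (k + 1)) (L b)) j =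
        stdVec (l + (k + 1)) (Fin.append I L j) := by
    intro p r I L j
    refine Fin.addCases (fun a => ?_) (fun b => ?_) j <;> simp
  have e1 : blockDet (d := l + (k + 1)) rfl (Fin.cons j J) L =
      ContinuousAlternatingMap.curryLeft (detForm (d := l + (k + 1)) (m := (l + k) + 1) rfl)
        (stdVec _ j) (fun i => Fin.append (fun a => stdVec _ (J a)) (fun b => stdVec _ (L b))
          (Fin.cast (add_comm l k) i)) := by
    rw [← insertFirst_apply]; rfl
  have e2 : blockDet h' (Fin.cons j L) J =
      ContinuousAlternatingMap.curryLeft (detForm (d := l + (k + 1)) (m := (k + l) + 1) h')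
        (stdVec _ j) (fun i => Fin.append (fun b => stdVec _ (L b)) (fun a => stdVec _ (J a))
          (Fin.cast (add_comm k l) i)) := by
    rw [← insertFirst_apply]; rfl
  have e3 : ∀ u : Fin (k + l) → Euc (l + (k + 1)),
      ContinuousAlternatingMap.curryLeft (detForm (d := l + (k + 1)) (m := (k + l) + 1) h')
        (stdVec _ j) u =
      ContinuousAlternatingMap.curryLeft (detForm (d := l + (k + 1)) (m := (l + k) + 1) rfl)
        (stdVec _ j) (fun i => u (Fin.cast (add_comm l k) i)) := by
    intro u
    rw [ContinuousAlternatingMap.curryLeft_apply_apply,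
      ContinuousAlternatingMap.curryLeft_apply_apply, detForm_apply, detForm_apply]
    refine congrArg Matrix.det (Matrix.ext fun a b => ?_)
    simp only [Matrix.of_apply]
    refine congrArg (fun x : Euc (l + (k + 1)) => x a) ?_
    refine Fin.cases ?_ (fun c => ?_) b
    · rfl
    · have : Fin.cast h' c.succ = Fin.succ (Fin.cast (add_comm l k) c) := by ext; simp
      rw [this, Matrix.cons_val_succ]
      have : (Fin.cast rfl c.succ : Fin (l + k + 1)) = Fin.succ c := rfl
      rw [this, Matrix.cons_val_succ]
  rw [e1, e2, e3, map_append_swap (add_comm l k) rfl, ← mul_assoc, ← mul_pow]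
  norm_num

/-- The coefficient of `dη ∧ θ`. The alternation in `dη` is absorbed by the determinant, so that
only the plain partial derivatives `∂_j η_J` remain. -/
theorem wedgeCoeff_extDeriv (h : d = l + (k + 1)) {η : Euc d → Euc d [⋀^Fin k]→L[ℝ] ℝ} {y : Euc d}
    (hη : DifferentiableAt ℝ η y) (θ : Euc d [⋀^Fin l]→L[ℝ] ℝ) :
    wedgeCoeff h (extDeriv η y) θ = ((k.factorial : ℝ) * l.factorial)⁻¹ *
      ∑ j, ∑ J : Fin k → Fin d, ∑ L : Fin l → Fin d, blockDet h (Fin.cons j J) L *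
        (fderiv ℝ (fun z => frameVec (stdVec d) (η z) J) y (stdVec d j) *
          frameVec (stdVec d) θ L) := by
  set F : Fin d → (Fin k → Fin d) → ℝ := fun j J =>
    fderiv ℝ (fun z => frameVec (stdVec d) (η z) J) y (stdVec d j) with hF
  have h1 : ∀ I : Fin (k + 1) → Fin d, frameVec (stdVec d) (extDeriv η y) I =
      ∑ i : Fin (k + 1), (-1) ^ (i : ℕ) * F (I i) (i.removeNth I) := by
    intro I
    rw [frameVec, extDeriv_apply hη]
    refine Finset.sum_congr rfl fun i _ => ?_
    rw [zsmul_eq_mul]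
    push_cast
    rfl
  have h2 : ∀ L : Fin l → Fin d,
      ∑ I, frameVec (stdVec d) (extDeriv η y) I * blockDet h I L =
        (k + 1) * ∑ j, ∑ J : Fin k → Fin d, blockDet h (Fin.cons j J) L * F j J := by
    intro L
    simp only [h1, Finset.sum_mul]
    rw [Finset.sum_comm]
    have : ∀ i : Fin (k + 1), ∑ I : Fin (k + 1) → Fin d,
        (-1) ^ (i : ℕ) * F (I i) (i.removeNth I) * blockDet h I L =
        ∑ j, ∑ J : Fin k → Fin d, blockDet h (Fin.cons j J) L * F j J := by
      intro i
      rw [← (Fin.insertNthEquiv (fun _ => Fin d) i).sum_comp, Fintype.sum_prod_type]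
      refine Finset.sum_congr rfl fun j _ => Finset.sum_congr rfl fun J _ => ?_
      change (-1) ^ (i : ℕ) * F ((i.insertNth j J : Fin (k + 1) → Fin d) i)
        (i.removeNth (i.insertNth j J : Fin (k + 1) → Fin d)) *
          blockDet h (i.insertNth j J : Fin (k + 1) → Fin d) L = _
      rw [blockDet_insertNth, Fin.insertNth_apply_same, Fin.removeNth_insertNth]
      have : ((-1 : ℝ) ^ (i : ℕ)) * (-1) ^ (i : ℕ) = 1 := by rw [← mul_pow]; norm_num
      linear_combination blockDet h (Fin.cons j J) L * F j J * this
    rw [Finset.sum_congr rfl fun i _ => this i, Finset.sum_const, Finset.card_univ,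
      Fintype.card_fin, nsmul_eq_mul]
    push_cast
    ring
  have h3 : frameVec (stdVec d) (extDeriv η y) ⬝ᵥ blockDet h *ᵥ frameVec (stdVec d) θ =
      ∑ L, (∑ I, frameVec (stdVec d) (extDeriv η y) I * blockDet h I L) *
        frameVec (stdVec d) θ L := by
    rw [Matrix.dotProduct_mulVec]
    rfl
  have h4 : ∑ L, (∑ I, frameVec (stdVec d) (extDeriv η y) I * blockDet h I L) *
        frameVec (stdVec d) θ L = (k + 1) * ∑ j, ∑ J : Fin k → Fin d, ∑ L : Fin l → Fin d,
        blockDet h (Fin.cons j J) L * (F j J * frameVec (stdVec d) θ L) := by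
    simp only [h2, Finset.sum_mul, Finset.mul_sum]
    rw [Finset.sum_comm]
    refine Finset.sum_congr rfl fun j _ => ?_
    rw [Finset.sum_comm]
    exact Finset.sum_congr rfl fun J _ => Finset.sum_congr rfl fun L _ => by ring
  rw [wedgeCoeff, h3, h4, Nat.factorial_succ, ← mul_assoc]
  congr 1
  have h1 : (k.factorial : ℝ) ≠ 0 := by exact_mod_cast k.factorial_ne_zero
  have h2 : (l.factorial : ℝ) ≠ 0 := by exact_mod_cast l.factorial_ne_zero
  have h5 : (k : ℝ) + 1 ≠ 0 := by positivity
  push_cast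
  field_simp

/-- A form of degree larger than the dimension vanishes. -/
theorem form_eq_zero_of_lt (h : d < k) (φ : Euc d [⋀^Fin k]→L[ℝ] ℝ) : φ = 0 := by
  apply frameVec_std_injective
  funext I
  obtain ⟨a, b, hne, hab⟩ := Fintype.exists_ne_map_eq_of_card_lt I (by simpa using h)
  exact φ.map_eq_zero_of_eq _ (by rw [hab]) hne

theorem altInner_zero_left {V : Type*} [AddCommGroup V] [Module ℝ V] [TopologicalSpace V]
    (b : Fin d → V) (G : Matrix (Fin d) (Fin d) ℝ) (φ : V [⋀^Fin k]→L[ℝ] ℝ) :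
    altInner b G 0 φ = 0 := by simp [altInner]

theorem altInner_zero_right {V : Type*} [AddCommGroup V] [Module ℝ V] [TopologicalSpace V]
    (b : Fin d → V) (G : Matrix (Fin d) (Fin d) ℝ) (φ : V [⋀^Fin k]→L[ℝ] ℝ) :
    altInner b G φ 0 = 0 := by simp [altInner]

theorem altInner_smul_right {V : Type*} [AddCommGroup V] [Module ℝ V] [TopologicalSpace V]
    (b : Fin d → V) (G : Matrix (Fin d) (Fin d) ℝ) (c : ℝ) (φ η : V [⋀^Fin k]→L[ℝ] ℝ) :
    altInner b G φ (c • η) = c * altInner b G φ η := by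
  rw [altInner_eq, altInner_eq, frameVec_smul, Matrix.mulVec_smul, dotProduct_smul, smul_eq_mul]
  ring

theorem differentiableAt_frameVec {η : Euc d → Euc d [⋀^Fin k]→L[ℝ] ℝ} {y : Euc d}
    (hη : DifferentiableAt ℝ η y) (J : Fin k → Fin d) :
    DifferentiableAt ℝ (fun z => frameVec (stdVec d) (η z) J) y :=
  ((ContinuousAlternatingMap.apply ℝ (Euc d) ℝ fun a => stdVec d (J a)).differentiableAt).comp y hη

/-- The density `√(det G) (⟨dφ, η⟩ + ⟨φ, δη⟩)` is the divergence of the field with components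
`(1/(q! l!)) ∑ det(e_j, e_J, e_L) φ_J (⋆η)_L`. -/
theorem sqrt_det_mul_green_eq_div {h : d = (d - (q + 1)) + (q + 1)}
    {G : Euc d → Matrix (Fin d) (Fin d) ℝ}
    {φ : Euc d → Euc d [⋀^Fin q]→L[ℝ] ℝ} {η : Euc d → Euc d [⋀^Fin (q + 1)]→L[ℝ] ℝ} {y : Euc d}
    (hG : (G y)ᵀ = G y) (hpos : 0 < (G y).det) (hφ : DifferentiableAt ℝ φ y)
    (hη : DifferentiableAt ℝ (fun z => hodgeStar h (G z) (η z)) y) :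
    √(G y).det * (altInner (stdVec d) (G y) (extDeriv φ y) (η y) +
        altInner (stdVec d) (G y) (φ y) (coordCodiff G η y)) =
      ((q.factorial : ℝ) * (d - (q + 1)).factorial)⁻¹ *
      ∑ j, ∑ J : Fin q → Fin d, ∑ L : Fin (d - (q + 1)) → Fin d, blockDet h (Fin.cons j J) L *
        fderiv ℝ (fun z => frameVec (stdVec d) (φ z) J *
          frameVec (stdVec d) (hodgeStar h (G z) (η z)) L) y (stdVec d j) := by
  have hq : q + 1 ≤ d := by omega
  have h' : d = q + ((d - (q + 1)) + 1) := by omega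
  have hc : coordCodiff G η y = ((-1 : ℝ) ^ (d * q)) • hodgeStar h' (G y)
      (extDeriv (fun z => hodgeStar h (G z) (η z)) y) := by
    rw [coordCodiff, dif_pos hq]
  rw [mul_add, hc, altInner_smul_right, sqrt_det_mul_altInner h, mul_left_comm,
    sqrt_det_mul_altInner_hodgeStar h' (G y) hG hpos, wedgeCoeff_extDeriv h hφ,
    wedgeCoeff_extDeriv h' hη]
  -- with `m = d - (q + 1)` the exponent is `d q + q m = 2 m q + q (q + 1)`, which is even
  have hsign : ((-1 : ℝ) ^ (d * q)) * (-1) ^ (q * (d - (q + 1))) = 1 := by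
    rw [← pow_add]
    apply Even.neg_one_pow
    obtain ⟨m, hm⟩ : ∃ m, d = m + (q + 1) := ⟨_, h⟩
    have : d - (q + 1) = m := by omega
    rw [this, hm, show (m + (q + 1)) * q + q * m = 2 * (m * q) + q * (q + 1) by ring]
    exact (even_two_mul _).add (Nat.even_mul_succ_self q)
  have e1 : ∑ j, ∑ L : Fin (d - (q + 1)) → Fin d, ∑ J : Fin q → Fin d,
      blockDet h' (Fin.cons j L) J *
        (fderiv ℝ (fun z => frameVec (stdVec d) (hodgeStar h (G z) (η z)) L) y (stdVec d j) *
          frameVec (stdVec d) (φ y) J) =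
      (-1) ^ (q * (d - (q + 1))) *
        ∑ j, ∑ J : Fin q → Fin d, ∑ L : Fin (d - (q + 1)) → Fin d, blockDet h (Fin.cons j J) L *
        (fderiv ℝ (fun z => frameVec (stdVec d) (hodgeStar h (G z) (η z)) L) y (stdVec d j) *
          frameVec (stdVec d) (φ y) J) := by
    rw [Finset.mul_sum]
    refine Finset.sum_congr rfl fun j _ => ?_
    rw [Finset.sum_comm, Finset.mul_sum]
    refine Finset.sum_congr rfl fun J _ => ?_
    rw [Finset.mul_sum]
    refine Finset.sum_congr rfl fun L _ => ?_
    rw [blockDet_cons_swap h h']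
    ring
  have e2 : ∀ (j : Fin d) (J : Fin q → Fin d) (L : Fin (d - (q + 1)) → Fin d),
      fderiv ℝ (fun z => frameVec (stdVec d) (φ z) J *
          frameVec (stdVec d) (hodgeStar h (G z) (η z)) L) y (stdVec d j) =
      fderiv ℝ (fun z => frameVec (stdVec d) (φ z) J) y (stdVec d j) *
          frameVec (stdVec d) (hodgeStar h (G y) (η y)) L +
        fderiv ℝ (fun z => frameVec (stdVec d) (hodgeStar h (G z) (η z)) L) y (stdVec d j) *
          frameVec (stdVec d) (φ y) J := by
    intro j J L
    rw [fderiv_fun_mul (differentiableAt_frameVec hφ J) (differentiableAt_frameVec hη L)]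
    simp only [add_apply, smul_apply, smul_eq_mul]
    ring
  simp only [e2, mul_add, Finset.sum_add_distrib]
  rw [e1]
  congr 1
  rw [mul_comm ((d - (q + 1)).factorial : ℝ) (q.factorial : ℝ)]
  linear_combination (((q.factorial : ℝ) * (d - (q + 1)).factorial)⁻¹ *
    ∑ j, ∑ J : Fin q → Fin d, ∑ L : Fin (d - (q + 1)) → Fin d, blockDet h (Fin.cons j J) L *
        (fderiv ℝ (fun z => frameVec (stdVec d) (hodgeStar h (G z) (η z)) L) y (stdVec d j) *
          frameVec (stdVec d) (φ y) J)) * hsign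

/-! ### Smoothness of the coordinate expressions -/

theorem contDiffOn_frameVec {n : WithTop ℕ∞} {s : Set (Euc d)}
    {η : Euc d → Euc d [⋀^Fin k]→L[ℝ] ℝ} (hη : ContDiffOn ℝ n η s) (J : Fin k → Fin d) :
    ContDiffOn ℝ n (fun z => frameVec (stdVec d) (η z) J) s :=
  (ContinuousAlternatingMap.apply ℝ (Euc d) ℝ fun a => stdVec d (J a)).contDiff.comp_contDiffOn hη

theorem contDiffOn_det {n : WithTop ℕ∞} {s : Set (Euc d)} {G : Euc d → Matrix (Fin d) (Fin d) ℝ}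
    (hG : ∀ i j, ContDiffOn ℝ n (fun z => G z i j) s) : ContDiffOn ℝ n (fun z => (G z).det) s := by
  simp only [Matrix.det_apply]
  exact ContDiffOn.sum fun σ _ => (contDiffOn_prod fun i _ => hG _ _).const_smul _

theorem contDiffOn_inv_apply {n : WithTop ℕ∞} {s : Set (Euc d)}
    {G : Euc d → Matrix (Fin d) (Fin d) ℝ} (hG : ∀ i j, ContDiffOn ℝ n (fun z => G z i j) s)
    (hdet : ∀ z ∈ s, (G z).det ≠ 0) (i j : Fin d) : ContDiffOn ℝ n (fun z => (G z)⁻¹ i j) s := by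
  simp only [Matrix.inv_def, Matrix.smul_apply, Ring.inverse_eq_inv', smul_eq_mul,
    Matrix.adjugate_apply]
  refine ((contDiffOn_det hG).inv hdet).mul (contDiffOn_det fun a b => ?_)
  simp only [Matrix.updateRow_apply]
  split_ifs
  · exact contDiffOn_const
  · exact hG a b

theorem contDiffOn_hodgeStar {n : WithTop ℕ∞} {s : Set (Euc d)} (h : d = l + k)
    {G : Euc d → Matrix (Fin d) (Fin d) ℝ} (hG : ∀ i j, ContDiffOn ℝ n (fun z => G z i j) s)
    (hdet : ∀ z ∈ s, (G z).det ≠ 0) {η : Euc d → Euc d [⋀^Fin k]→L[ℝ] ℝ}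
    (hη : ContDiffOn ℝ n η s) : ContDiffOn ℝ n (fun z => hodgeStar h (G z) (η z)) s := by
  simp only [hodgeStar]
  refine (contDiffOn_const.mul ((contDiffOn_det hG).sqrt hdet)).smul ?_
  refine ContDiffOn.sum fun I _ => ContDiffOn.sum fun J _ => ?_
  refine (ContDiffOn.mul (contDiffOn_prod fun a _ => contDiffOn_inv_apply hG hdet _ _) ?_).smul
    contDiffOn_const
  exact contDiffOn_frameVec hη J

theorem contDiffOn_altInner {n : WithTop ℕ∞} {s : Set (Euc d)}
    {G : Euc d → Matrix (Fin d) (Fin d) ℝ} (hG : ∀ i j, ContDiffOn ℝ n (fun z => G z i j) s)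
    (hdet : ∀ z ∈ s, (G z).det ≠ 0) {φ η : Euc d → Euc d [⋀^Fin k]→L[ℝ] ℝ}
    (hφ : ContDiffOn ℝ n φ s) (hη : ContDiffOn ℝ n η s) :
    ContDiffOn ℝ n (fun z => altInner (stdVec d) (G z) (φ z) (η z)) s := by
  simp only [altInner]
  refine contDiffOn_const.mul (ContDiffOn.sum fun I _ => ContDiffOn.sum fun J _ => ?_)
  exact (contDiffOn_prod fun a _ => contDiffOn_inv_apply hG hdet _ _).mul
    ((contDiffOn_frameVec hφ I).mul (contDiffOn_frameVec hη J))

theorem contDiffOn_extDeriv {s : Set (Euc d)} (hs : IsOpen s)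
    {η : Euc d → Euc d [⋀^Fin k]→L[ℝ] ℝ} (hη : ContDiffOn ℝ ∞ η s) :
    ContDiffOn ℝ ∞ (extDeriv η) s :=
  (ContinuousAlternatingMap.alternatizeUncurryFinCLM ℝ (Euc d) ℝ).contDiff.comp_contDiffOn
    (hη.fderiv_of_isOpen hs (by simp))

theorem contDiffOn_coordCodiff {s : Set (Euc d)} (hs : IsOpen s)
    {G : Euc d → Matrix (Fin d) (Fin d) ℝ} (hG : ∀ i j, ContDiffOn ℝ ∞ (fun z => G z i j) s)
    (hdet : ∀ z ∈ s, (G z).det ≠ 0) {η : Euc d → Euc d [⋀^Fin (q + 1)]→L[ℝ] ℝ}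
    (hη : ContDiffOn ℝ ∞ η s) : ContDiffOn ℝ ∞ (coordCodiff G η) s := by
  by_cases h : q + 1 ≤ d
  · have : coordCodiff G η = fun y => ((-1 : ℝ) ^ (d * q)) •
      hodgeStar (k := (d - (q + 1)) + 1) (l := q) (by omega) (G y)
        (extDeriv (fun z => hodgeStar (k := q + 1) (l := d - (q + 1)) (by omega) (G z) (η z)) y) := by
      funext y
      rw [coordCodiff, dif_pos h]
    rw [this]
    exact (contDiffOn_hodgeStar _ hG hdet
      (contDiffOn_extDeriv hs (contDiffOn_hodgeStar _ hG hdet hη))).const_smul _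
  · have : coordCodiff G η = fun y => 0 := by
      funext y
      rw [coordCodiff, dif_neg h]
    rw [this]
    exact contDiffOn_const

/-! ### Green's formula in coordinates -/

theorem integral_fderiv_eq_zero {P : Euc d → ℝ} (hP : ContDiff ℝ 1 P) (hc : HasCompactSupport P)
    (v : Euc d) : ∫ y, fderiv ℝ P y v = 0 := by
  have hi : Integrable fun y => fderiv ℝ P y v := by
    refine Continuous.integrable_of_hasCompactSupport ?_ (hc.fderiv_apply ℝ v)
    exact (hP.continuous_fderiv one_ne_zero).clm_apply continuous_const
  have := integral_mul_fderiv_eq_neg_fderiv_mul_of_integrable (μ := volume) (𝕜 := ℝ)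
    (f := fun _ : Euc d => (1 : ℝ)) (g := P) (v := v) (by simp) (by simpa using hi)
    (by simpa using hP.continuous.integrable_of_hasCompactSupport hc)
    (fun _ _ => differentiableAt_const _) (fun y _ => hP.differentiable one_ne_zero y)
  simpa using this

/-- The divergence theorem for a function on `U` that vanishes off a compact subset of `U`. -/
theorem setIntegral_fderiv_eq_zero {U K : Set (Euc d)} (hU : IsOpen U) (hK : IsCompact K)
    (hKU : K ⊆ U) {P : Euc d → ℝ} (hP : ContDiffOn ℝ 1 P U) (h0 : ∀ y ∈ U \ K, P y = 0)
    (v : Euc d) :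
    IntegrableOn (fun y => fderiv ℝ P y v) U ∧ ∫ y in U, fderiv ℝ P y v = 0 := by
  set Q : Euc d → ℝ := U.indicator P with hQ
  have hzero : ∀ y ∉ K, Q =ᶠ[nhds y] fun _ => 0 := by
    intro y hy
    filter_upwards [hK.isClosed.isOpen_compl.mem_nhds hy] with z hz
    by_cases hzU : z ∈ U
    · rw [hQ, indicator_of_mem hzU, h0 z ⟨hzU, hz⟩]
    · rw [hQ, indicator_of_notMem hzU]
  have hone : ∀ y ∈ U, Q =ᶠ[nhds y] P := by
    intro y hy
    filter_upwards [hU.mem_nhds hy] with z hz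
    rw [hQ, indicator_of_mem hz]
  have hQd : ContDiff ℝ 1 Q := by
    rw [contDiff_iff_contDiffAt]
    intro y
    by_cases hy : y ∈ U
    · exact ((hP y hy).contDiffAt (hU.mem_nhds hy)).congr_of_eventuallyEq (hone y hy)
    · exact contDiffAt_const.congr_of_eventuallyEq (hzero y fun h => hy (hKU h))
  have hQc : HasCompactSupport Q :=
    HasCompactSupport.intro hK fun y hy => (hzero y hy).self_of_nhds
  have hfd : ∀ y ∈ U, fderiv ℝ Q y v = fderiv ℝ P y v := fun y hy => by
    rw [(hone y hy).fderiv_eq]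
  have hfd0 : ∀ y ∉ U, fderiv ℝ Q y v = 0 := fun y hy => by
    rw [(hzero y fun h => hy (hKU h)).fderiv_eq]; simp
  have hi : Integrable fun y => fderiv ℝ Q y v := by
    refine Continuous.integrable_of_hasCompactSupport ?_ (hQc.fderiv_apply ℝ v)
    exact (hQd.continuous_fderiv one_ne_zero).clm_apply continuous_const
  refine ⟨hi.integrableOn.congr_fun hfd hU.measurableSet, ?_⟩
  rw [← setIntegral_congr_fun hU.measurableSet hfd, setIntegral_eq_integral_of_forall_compl_eq_zero
    hfd0, integral_fderiv_eq_zero hQd hQc v]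

/-- Green's formula for forms on an open subset of `ℝ^d`, one of them with compact support. -/
theorem setIntegral_green_coord {U K : Set (Euc d)} (hU : IsOpen U) (hK : IsCompact K)
    (hKU : K ⊆ U) {G : Euc d → Matrix (Fin d) (Fin d) ℝ}
    (hG : ∀ i j, ContDiffOn ℝ ∞ (fun z => G z i j) U) (hsymm : ∀ y ∈ U, (G y)ᵀ = G y)
    (hpos : ∀ y ∈ U, 0 < (G y).det)
    {φ : Euc d → Euc d [⋀^Fin q]→L[ℝ] ℝ} {η : Euc d → Euc d [⋀^Fin (q + 1)]→L[ℝ] ℝ}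
    (hφ : ContDiffOn ℝ ∞ φ U) (hη : ContDiffOn ℝ ∞ η U) (h0 : ∀ y ∈ U \ K, φ y = 0) :
    ∫ y in U, √(G y).det * (altInner (stdVec d) (G y) (extDeriv φ y) (η y) +
        altInner (stdVec d) (G y) (φ y) (coordCodiff G η y)) = 0 := by
  by_cases hq : q + 1 ≤ d
  · have h : d = (d - (q + 1)) + (q + 1) := by omega
    have hθ := contDiffOn_hodgeStar h hG (fun y hy => (hpos y hy).ne') hη
    rw [setIntegral_congr_fun hU.measurableSet fun y hy =>
      sqrt_det_mul_green_eq_div (h := h) (hsymm y hy) (hpos y hy)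
        (((hφ y hy).contDiffAt (hU.mem_nhds hy)).differentiableAt (by simp))
        (((hθ y hy).contDiffAt (hU.mem_nhds hy)).differentiableAt (by simp))]
    have key : ∀ (j : Fin d) (J : Fin q → Fin d) (L : Fin (d - (q + 1)) → Fin d), _ :=
      fun j J L => setIntegral_fderiv_eq_zero hU hK hKU
        (P := fun z => frameVec (stdVec d) (φ z) J *
          frameVec (stdVec d) (hodgeStar h (G z) (η z)) L)
        (((contDiffOn_frameVec hφ J).mul (contDiffOn_frameVec hθ L)).of_le (by simp))
        (fun y hy => by simp [h0 y hy, frameVec]) (stdVec d j)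
    rw [integral_const_mul, integral_finsetSum _ fun j _ => ?_]
    · rw [Finset.sum_eq_zero, mul_zero]
      intro j _
      rw [integral_finsetSum _ fun J _ => integrable_finsetSum _ fun L _ =>
        (key j J L).1.const_mul _]
      refine Finset.sum_eq_zero fun J _ => ?_
      rw [integral_finsetSum _ fun L _ => (key j J L).1.const_mul _]
      refine Finset.sum_eq_zero fun L _ => ?_
      rw [integral_const_mul, (key j J L).2, mul_zero]
    · exact integrable_finsetSum _ fun J _ => integrable_finsetSum _ fun L _ =>
        (key j J L).1.const_mul _
  · have : ∀ y, √(G y).det * (altInner (stdVec d) (G y) (extDeriv φ y) (η y) +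
        altInner (stdVec d) (G y) (φ y) (coordCodiff G η y)) = 0 := fun y => by
      rw [coordCodiff, dif_neg hq, form_eq_zero_of_lt (by omega) (η y), altInner_zero_right,
        altInner_zero_right, add_zero, mul_zero]
    simp [this]

end Coordinates

/-! ### Naturality under pullback -/

section Pullback

variable {d k l q : ℕ}

theorem clmMatrix_comp (A B : Euc d →L[ℝ] Euc d) :
    clmMatrix (A.comp B) = clmMatrix A * clmMatrix B := by
  ext i j
  have := clmMatrix_sum B j
  rw [clmMatrix, Matrix.of_apply, ContinuousLinearMap.comp_apply, ← this]
  simp [Matrix.mul_apply, clmMatrix, mul_comm]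

theorem clmMatrix_id : clmMatrix (ContinuousLinearMap.id ℝ (Euc d)) = 1 := by
  ext i j
  simp [clmMatrix, stdVec, Matrix.one_apply]

/-- The inner product of forms is invariant under pullback by a linear isomorphism. -/
theorem altInner_pullback (A : Euc d →L[ℝ] Euc d) (hA : IsUnit (clmMatrix A).det)
    (G : Matrix (Fin d) (Fin d) ℝ) (φ η : Euc d [⋀^Fin k]→L[ℝ] ℝ) :
    altInner (stdVec d) ((clmMatrix A)ᵀ * G * clmMatrix A) (φ.compContinuousLinearMap A)
      (η.compContinuousLinearMap A) = altInner (stdVec d) G φ η := by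
  rw [← altInner_frame_change (stdVec d) G _ hA]
  simp only [clmMatrix_sum]
  rfl

theorem minSmoothness_two_le : minSmoothness ℝ 2 ≤ (∞ : WithTop ℕ∞) := by
  rw [minSmoothness_of_isRCLikeNormedField]
  exact ENat.LEInfty.out

/-- The sign of a continuous function is locally constant where the function does not vanish. -/
theorem eventually_abs_div_eq {f : Euc d → ℝ} {y : Euc d} (hf : ContinuousAt f y) (h : f y ≠ 0) :
    ∀ᶠ z in nhds y, |f z| / f z = |f y| / f y := by
  rcases lt_or_gt_of_ne h with h | h
  · filter_upwards [hf.eventually (gt_mem_nhds h)] with z hz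
    rw [abs_of_neg hz, abs_of_neg h, neg_div, neg_div, div_self hz.ne, div_self h.ne]
  · filter_upwards [hf.eventually (lt_mem_nhds h)] with z hz
    rw [abs_of_pos hz, abs_of_pos h, div_self hz.ne', div_self h.ne']

/-- The co-derivative commutes with pullback by local diffeomorphisms: the star enters twice, and
the two signs of the Jacobian determinant cancel. -/
theorem coordCodiff_pullback {G G' : Euc d → Matrix (Fin d) (Fin d) ℝ}
    {η η' : Euc d → Euc d [⋀^Fin (q + 1)]→L[ℝ] ℝ} {τ : Euc d → Euc d} {y : Euc d}
    (hτ : ContDiffAt ℝ ∞ τ y) (hdet : (clmMatrix (fderiv ℝ τ y)).det ≠ 0)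
    (hG : ∀ᶠ z in nhds y,
      G z = (clmMatrix (fderiv ℝ τ z))ᵀ * G' (τ z) * clmMatrix (fderiv ℝ τ z))
    (hη : ∀ᶠ z in nhds y, η z = (η' (τ z)).compContinuousLinearMap (fderiv ℝ τ z))
    (hd : ∀ h : d = (d - (q + 1)) + (q + 1),
      DifferentiableAt ℝ (fun z => hodgeStar h (G' z) (η' z)) (τ y)) :
    coordCodiff G η y = (coordCodiff G' η' (τ y)).compContinuousLinearMap (fderiv ℝ τ y) := by
  by_cases hq : q + 1 ≤ d
  · have h : d = (d - (q + 1)) + (q + 1) := by omega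
    have h' : d = q + ((d - (q + 1)) + 1) := by omega
    have hc : ∀ (G : Euc d → Matrix (Fin d) (Fin d) ℝ)
        (η : Euc d → Euc d [⋀^Fin (q + 1)]→L[ℝ] ℝ) (y : Euc d),
        coordCodiff G η y = ((-1 : ℝ) ^ (d * q)) • hodgeStar h' (G y)
          (extDeriv (fun z => hodgeStar h (G z) (η z)) y) := fun G η y => by
      rw [coordCodiff, dif_pos hq]
    set f : Euc d → ℝ := fun z => (clmMatrix (fderiv ℝ τ z)).det with hf
    have hfc : ContinuousAt f y := by
      have : ContinuousAt (fderiv ℝ τ) y := (hτ.fderiv_right (m := 0) (by simp)).continuousAt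
      have h2 : f = fun z => (fderiv ℝ τ z).det := by
        funext z; exact det_clmMatrix _
      rw [h2]
      exact ContinuousLinearMap.continuous_det.continuousAt.comp this
    -- the locally constant sign of the Jacobian determinant, picked up by each of the two stars
    set s : ℝ := |f y| / f y with hs
    have hss : s * s = 1 := by
      rw [hs, div_mul_div_comm, abs_mul_abs_self, div_self (mul_ne_zero hdet hdet)]
    have hev : (fun z => hodgeStar h (G z) (η z)) =ᶠ[nhds y]
        s • fun z => (hodgeStar h (G' (τ z)) (η' (τ z))).compContinuousLinearMap
          (fderiv ℝ τ z) := by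
      filter_upwards [hG, hη, eventually_abs_div_eq hfc hdet, hfc.eventually_ne hdet]
        with z hz1 hz2 hz3 hz4
      rw [hz1, hz2, hodgeStar_pullback h _ _ hz4.isUnit]
      change (|f z| / f z) • _ = _
      rw [hz3]
      rfl
    rw [hc, hc, hev.extDeriv_eq, extDeriv_smul,
      extDeriv_pullback (f := τ) (hd h) hτ minSmoothness_two_le,
      hG.self_of_nhds]
    have hlin : ∀ (c : ℝ) (M : Matrix (Fin d) (Fin d) ℝ)
        (φ : Euc d [⋀^Fin ((d - (q + 1)) + 1)]→L[ℝ] ℝ),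
        hodgeStar h' M (c • φ) = c • hodgeStar h' M φ := by
      intro c M φ
      apply frameVec_std_injective
      rw [frameVec_smul, frameVec_hodgeStar, frameVec_hodgeStar, frameVec_smul,
        Matrix.mulVec_smul, Matrix.mulVec_smul, smul_comm]
    rw [hlin, hodgeStar_pullback h' _ _ hdet.isUnit]
    change _ • s • s • _ = _
    rw [smul_smul s s, hss, one_smul]
    rfl
  · rw [coordCodiff, coordCodiff, dif_neg hq, dif_neg hq]
    rfl

theorem eventually_mem_transition {M : Type*} [TopologicalSpace M]
    {e e' : OpenPartialHomeomorph M (Euc d)} {y : Euc d}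
    (hy : y ∈ e.target) (hy' : e.symm y ∈ e'.source) :
    ∀ᶠ z in nhds y, z ∈ e.target ∧ e.symm z ∈ e'.source :=
  (e.open_target.mem_nhds hy |> Filter.eventually_of_mem <| fun _ h => h).and
    ((e.continuousAt_symm hy).eventually (e'.open_source.mem_nhds hy'))

end Pullback

/-! ### Charts -/

section Charts

variable {d k q : ℕ} {M : Type*} [TopologicalSpace M] [ChartedSpace (Euc d) M]

/-- The derivative of the inverse of a chart, as a linear map on the model space. -/
def chartDeriv (e : OpenPartialHomeomorph M (Euc d)) (y : Euc d) : Euc d →L[ℝ] Euc d :=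
  mfderiv (𝓡 d) (𝓡 d) e.symm y

theorem chartForm_eq (e : OpenPartialHomeomorph M (Euc d)) (φ : Form d M k) (y : Euc d) :
    chartForm e φ y = ContinuousAlternatingMap.compContinuousLinearMap
      (φ (e.symm y) : Euc d [⋀^Fin k]→L[ℝ] ℝ) (chartDeriv e y) := rfl

theorem Form.Smooth.contDiffAt {φ : Form d M k} (hφ : φ.Smooth)
    {e : OpenPartialHomeomorph M (Euc d)} (he : e ∈ atlas (Euc d) M) {y : Euc d}
    (hy : y ∈ e.target) : ContDiffAt ℝ ∞ (chartForm e φ) y :=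
  (hφ e he).contDiffAt (e.open_target.mem_nhds hy)

variable [IsManifold (𝓡 d) ∞ M]

/-- The Gram matrix of the metric in the standard frame of the tangent space at `x`. -/
def pointGram (g : Metric d M) (x : M) : Matrix (Fin d) (Fin d) ℝ :=
  Matrix.of fun i j => g.inner x (tangentFrame x i) (tangentFrame x j)

theorem chartGram_eq (g : Metric d M) (e : OpenPartialHomeomorph M (Euc d)) (y : Euc d) :
    chartGram g e y =
      (clmMatrix (chartDeriv e y))ᵀ * pointGram g (e.symm y) * clmMatrix (chartDeriv e y) := by
  ext i j
  have h : ∀ i, (mfderiv (𝓡 d) (𝓡 d) e.symm y (stdVec d i) : TangentSpace (𝓡 d) (e.symm y)) =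
      ∑ a, clmMatrix (chartDeriv e y) a i • tangentFrame (e.symm y) a := fun i =>
    (clmMatrix_sum (chartDeriv e y) i).symm
  rw [chartGram, Matrix.of_apply, h, h]
  simp only [map_sum, map_smul, sum_apply, smul_apply, smul_eq_mul, Matrix.mul_apply,
    Matrix.transpose_apply, pointGram, Matrix.of_apply, Finset.mul_sum, Finset.sum_mul]
  refine Finset.sum_congr rfl fun a _ => Finset.sum_congr rfl fun b _ => ?_
  ring

theorem isUnit_det_chartDeriv {e : OpenPartialHomeomorph M (Euc d)} (he : e ∈ atlas (Euc d) M)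
    {y : Euc d} (hy : y ∈ e.target) : IsUnit (clmMatrix (chartDeriv e y)).det := by
  have he' : e.MDifferentiable (𝓡 d) (𝓡 d) := mdifferentiable_of_mem_atlas he
  have h := he'.comp_symm_deriv hy
  set A : Euc d →L[ℝ] Euc d := mfderiv (𝓡 d) (𝓡 d) e (e.symm y)
  have h2 : A.comp (chartDeriv e y) = ContinuousLinearMap.id ℝ (Euc d) := h
  have h3 := congrArg (fun B : Euc d →L[ℝ] Euc d => (clmMatrix B).det) h2
  simp only [clmMatrix_comp, clmMatrix_id, Matrix.det_mul, Matrix.det_one] at h3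
  exact IsUnit.of_mul_eq_one_right _ h3

theorem ptInner_eq_chart (g : Metric d M) {e : OpenPartialHomeomorph M (Euc d)}
    (he : e ∈ atlas (Euc d) M) {y : Euc d} (hy : y ∈ e.target) (φ η : Form d M k) :
    ptInner g (e.symm y) (φ (e.symm y)) (η (e.symm y)) =
      altInner (stdVec d) (chartGram g e y) (chartForm e φ y) (chartForm e η y) := by
  rw [chartGram_eq]
  exact (altInner_pullback (chartDeriv e y) (isUnit_det_chartDeriv he hy)
    (pointGram g (e.symm y)) _ _).symm

theorem chartDeriv_transition {e e' : OpenPartialHomeomorph M (Euc d)} (he : e ∈ atlas (Euc d) M)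
    (he' : e' ∈ atlas (Euc d) M) {y : Euc d} (hy : y ∈ e.target) (hy' : e.symm y ∈ e'.source) :
    chartDeriv e y =
      (chartDeriv e' (e' (e.symm y))).comp (fderiv ℝ (fun z => e' (e.symm z)) y) ∧
    fderiv ℝ (fun z => e' (e.symm z)) y =
      (mfderiv (𝓡 d) (𝓡 d) e' (e.symm y) : Euc d →L[ℝ] Euc d).comp (chartDeriv e y) := by
  have h1 : e.MDifferentiable (𝓡 d) (𝓡 d) := mdifferentiable_of_mem_atlas he
  have h2 : e'.MDifferentiable (𝓡 d) (𝓡 d) := mdifferentiable_of_mem_atlas he'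
  have h3 : fderiv ℝ (fun z => e' (e.symm z)) y =
      (mfderiv (𝓡 d) (𝓡 d) e' (e.symm y) : Euc d →L[ℝ] Euc d).comp (chartDeriv e y) := by
    rw [← mfderiv_eq_fderiv]
    exact mfderiv_comp y (h2.mdifferentiableAt hy') (h1.mdifferentiableAt_symm hy)
  refine ⟨?_, h3⟩
  have h4 : (chartDeriv e' (e' (e.symm y))).comp
      (mfderiv (𝓡 d) (𝓡 d) e' (e.symm y) : Euc d →L[ℝ] Euc d) = ContinuousLinearMap.id ℝ (Euc d) :=
    h2.symm_comp_deriv hy'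
  have h5 : ∀ A B C : Euc d →L[ℝ] Euc d, A.comp B = ContinuousLinearMap.id ℝ (Euc d) →
      C = A.comp (B.comp C) := fun A B C h => by
    rw [← ContinuousLinearMap.comp_assoc, h, ContinuousLinearMap.id_comp]
  rw [h3]
  exact h5 _ _ _ h4

theorem chartForm_transition {e e' : OpenPartialHomeomorph M (Euc d)} (he : e ∈ atlas (Euc d) M)
    (he' : e' ∈ atlas (Euc d) M) {y : Euc d} (hy : y ∈ e.target) (hy' : e.symm y ∈ e'.source)
    (φ : Form d M k) :
    chartForm e φ y = (chartForm e' φ (e' (e.symm y))).compContinuousLinearMap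
      (fderiv ℝ (fun z => e' (e.symm z)) y) := by
  have h : ∀ x, x = e.symm y → chartForm e φ y = ContinuousAlternatingMap.compContinuousLinearMap
      (φ x : Euc d [⋀^Fin k]→L[ℝ] ℝ) (chartDeriv e y) := by
    rintro x rfl; rfl
  rw [h (e'.symm (e' (e.symm y))) (e'.left_inv hy'), (chartDeriv_transition he he' hy hy').1]
  rfl

theorem chartGram_transition (g : Metric d M) {e e' : OpenPartialHomeomorph M (Euc d)}
    (he : e ∈ atlas (Euc d) M) (he' : e' ∈ atlas (Euc d) M) {y : Euc d} (hy : y ∈ e.target)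
    (hy' : e.symm y ∈ e'.source) :
    chartGram g e y = (clmMatrix (fderiv ℝ (fun z => e' (e.symm z)) y))ᵀ *
      chartGram g e' (e' (e.symm y)) * clmMatrix (fderiv ℝ (fun z => e' (e.symm z)) y) := by
  rw [chartGram_eq, chartGram_eq, e'.left_inv hy', (chartDeriv_transition he he' hy hy').1,
    clmMatrix_comp, Matrix.transpose_mul]
  simp only [Matrix.mul_assoc]

theorem contDiffAt_transition {e e' : OpenPartialHomeomorph M (Euc d)} (he : e ∈ atlas (Euc d) M)
    (he' : e' ∈ atlas (Euc d) M) {y : Euc d} (hy : y ∈ e.target) (hy' : e.symm y ∈ e'.source) :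
    ContDiffAt ℝ ∞ (fun z => e' (e.symm z)) y := by
  have h1 : ContMDiffAt (𝓡 d) (𝓡 d) ∞ e.symm y :=
    (contMDiffOn_symm_of_mem_maximalAtlas (IsManifold.subset_maximalAtlas he)).contMDiffAt
      (e.open_target.mem_nhds hy)
  have h2 : ContMDiffAt (𝓡 d) (𝓡 d) ∞ e' (e.symm y) :=
    (contMDiffOn_of_mem_maximalAtlas (IsManifold.subset_maximalAtlas he')).contMDiffAt
      (e'.open_source.mem_nhds hy')
  exact (h2.comp y h1).contDiffAt

theorem isUnit_det_transition {e e' : OpenPartialHomeomorph M (Euc d)}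
    (he : e ∈ atlas (Euc d) M) (he' : e' ∈ atlas (Euc d) M) {y : Euc d} (hy : y ∈ e.target)
    (hy' : e.symm y ∈ e'.source) :
    IsUnit (clmMatrix (fderiv ℝ (fun z => e' (e.symm z)) y)).det := by
  have h1 := isUnit_det_chartDeriv he hy
  rw [(chartDeriv_transition he he' hy hy').1, clmMatrix_comp, Matrix.det_mul] at h1
  exact isUnit_of_mul_isUnit_right h1

/-- The exterior derivative of a smooth form may be computed in any chart of the atlas. -/
theorem chartForm_extD {φ : Form d M k} (hφ : φ.Smooth) {e : OpenPartialHomeomorph M (Euc d)}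
    (he : e ∈ atlas (Euc d) M) {y : Euc d} (hy : y ∈ e.target) :
    chartForm e (extD φ) y = extDeriv (chartForm e φ) y := by
  set c := chartAt (Euc d) (e.symm y) with hc
  have hca : c ∈ atlas (Euc d) M := chart_mem_atlas _ _
  have hy' : e.symm y ∈ c.source := mem_chart_source _ _
  have hev : chartForm e φ =ᶠ[nhds y] fun z =>
      (chartForm c φ (c (e.symm z))).compContinuousLinearMap
      (fderiv ℝ (fun z => c (e.symm z)) z) := by
    filter_upwards [eventually_mem_transition hy hy'] with z hz
    exact chartForm_transition he hca hz.1 hz.2 φ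
  rw [hev.extDeriv_eq, extDeriv_pullback (f := fun z => c (e.symm z))
    ((hφ.contDiffAt hca (c.map_source hy')).differentiableAt (by simp))
    (contDiffAt_transition he hca hy hy') minSmoothness_two_le,
    (chartDeriv_transition he hca hy hy').2]
  rfl

theorem contMDiffOn_mfderiv_symm_const {e : OpenPartialHomeomorph M (Euc d)}
    (he : e ∈ atlas (Euc d) M) (v : Euc d) :
    ContMDiffOn (𝓡 d) ((𝓡 d).prod 𝓘(ℝ, Euc d)) ∞ (fun y : Euc d =>
      Bundle.TotalSpace.mk' (Euc d) (E := fun x : M => TangentSpace (𝓡 d) x) (e.symm y)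
        (mfderiv (𝓡 d) (𝓡 d) e.symm y v)) e.target := by
  have h1 : ContMDiffOn (𝓡 d) (𝓡 d) ∞ e.symm e.target :=
    contMDiffOn_symm_of_mem_maximalAtlas (IsManifold.subset_maximalAtlas he)
  have h2 := h1.contMDiffOn_tangentMapWithin (m := ∞) (by simp) e.open_target.uniqueMDiffOn
  have h3 : ContMDiff (𝓡 d) ((𝓡 d).prod 𝓘(ℝ, Euc d)) ∞ (fun y : Euc d =>
      (⟨y, v⟩ : TangentBundle (𝓡 d) (Euc d))) :=
    contMDiff_vectorSpace_iff_contDiff.2 contDiff_const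
  have h4 := h2.comp (h3.contMDiffOn (s := e.target)) (fun y hy => hy)
  refine h4.congr fun y hy => ?_
  simp only [Function.comp_apply, tangentMapWithin]
  rw [mfderivWithin_of_isOpen e.open_target hy]

/-- The components of the metric in a chart are smooth. -/
theorem contDiffOn_chartGram (g : Metric d M) {e : OpenPartialHomeomorph M (Euc d)}
    (he : e ∈ atlas (Euc d) M) (i j : Fin d) :
    ContDiffOn ℝ ∞ (fun y => chartGram g e y i j) e.target := by
  rw [← contMDiffOn_iff_contDiffOn]
  intro y hy
  have h1 : ContMDiffOn (𝓡 d) (𝓡 d) ∞ e.symm e.target :=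
    contMDiffOn_symm_of_mem_maximalAtlas (IsManifold.subset_maximalAtlas he)
  have : ContMDiffWithinAt (𝓡 d) ((𝓡 d).prod 𝓘(ℝ)) ∞
      (fun y ↦ Bundle.TotalSpace.mk' ℝ (E := Bundle.Trivial M ℝ) (e.symm y)
        (g.inner (e.symm y) (mfderiv (𝓡 d) (𝓡 d) e.symm y (stdVec d i))
          (mfderiv (𝓡 d) (𝓡 d) e.symm y (stdVec d j)))) e.target y := by
    apply ContMDiffWithinAt.clm_bundle_apply₂ (F₁ := Euc d) (F₂ := Euc d)
    · exact ContMDiffAt.comp_contMDiffWithinAt y g.contMDiff.contMDiffAt (h1 y hy)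
    · exact contMDiffOn_mfderiv_symm_const he _ y hy
    · exact contMDiffOn_mfderiv_symm_const he _ y hy
  simp only [Bundle.contMDiffWithinAt_totalSpace] at this
  exact this.2

theorem pointGram_posDef (g : Metric d M) (x : M) : (pointGram g x).PosDef := by
  refine Matrix.PosDef.of_dotProduct_mulVec_pos ?_ fun v hv => ?_
  · ext i j
    simp [pointGram, Matrix.conjTranspose_apply, g.symm x (tangentFrame x i)]
  · have h : star v ⬝ᵥ pointGram g x *ᵥ v =
        g.inner x (∑ i, v i • tangentFrame x i) (∑ i, v i • tangentFrame x i) := by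
      simp only [map_sum, map_smul, sum_apply, smul_apply, smul_eq_mul, dotProduct, Matrix.mulVec,
        pointGram, Matrix.of_apply, Pi.star_apply, star_trivial, Finset.mul_sum]
      refine Finset.sum_congr rfl fun a _ => Finset.sum_congr rfl fun b _ => ?_
      rw [g.symm x (tangentFrame x b)]
      ring
    rw [h]
    refine g.pos x _ fun h0 => hv ?_
    funext m
    have h1 : (∑ i, v i • stdVec d i : Euc d) = 0 := h0
    have h2 := congrArg (fun w : Euc d => w m) h1
    simpa [stdVec, Pi.single_apply] using h2

theorem chartGram_det_pos (g : Metric d M) {e : OpenPartialHomeomorph M (Euc d)}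
    (he : e ∈ atlas (Euc d) M) {y : Euc d} (hy : y ∈ e.target) : 0 < (chartGram g e y).det := by
  rw [chartGram_eq, Matrix.det_mul, Matrix.det_mul, Matrix.det_transpose, mul_right_comm]
  exact mul_pos (mul_self_pos.2 (isUnit_det_chartDeriv he hy).ne_zero)
    (pointGram_posDef g _).det_pos

theorem chartGram_transpose (g : Metric d M) (e : OpenPartialHomeomorph M (Euc d)) (y : Euc d) :
    (chartGram g e y)ᵀ = chartGram g e y := by
  ext i j
  simp only [chartGram, Matrix.transpose_apply, Matrix.of_apply]
  exact g.symm _ _ _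

/-- The co-derivative of a smooth form may be computed in any chart of the atlas. -/
theorem chartForm_codiff (g : Metric d M) {η : Form d M (q + 1)} (hη : η.Smooth)
    {e : OpenPartialHomeomorph M (Euc d)} (he : e ∈ atlas (Euc d) M) {y : Euc d}
    (hy : y ∈ e.target) :
    chartForm e (codiff g η) y = coordCodiff (chartGram g e) (chartForm e η) y := by
  set c := chartAt (Euc d) (e.symm y) with hc
  have hca : c ∈ atlas (Euc d) M := chart_mem_atlas _ _
  have hy' : e.symm y ∈ c.source := mem_chart_source _ _
  rw [coordCodiff_pullback (G' := chartGram g c) (η' := chartForm c η)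
    (contDiffAt_transition he hca hy hy') (isUnit_det_transition he hca hy hy').ne_zero ?_ ?_ ?_,
    (chartDeriv_transition he hca hy hy').2]
  · rfl
  · filter_upwards [eventually_mem_transition hy hy'] with z hz
    exact chartGram_transition g he hca hz.1 hz.2
  · filter_upwards [eventually_mem_transition hy hy'] with z hz
    exact chartForm_transition he hca hz.1 hz.2 η
  · intro h
    exact ((contDiffOn_hodgeStar h (contDiffOn_chartGram g hca)
      (fun z hz => (chartGram_det_pos g hca hz).ne') (hη c hca)).contDiffAt
        (c.open_target.mem_nhds (c.map_source hy'))).differentiableAt (by simp)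

theorem Form.Smooth.extD {φ : Form d M k} (hφ : φ.Smooth) : (extD φ).Smooth := fun e he =>
  (contDiffOn_extDeriv e.open_target (hφ e he)).congr fun _ hy => chartForm_extD hφ he hy

theorem Form.Smooth.codiff (g : Metric d M) {η : Form d M (q + 1)} (hη : η.Smooth) :
    (codiff g η).Smooth := fun e he =>
  (contDiffOn_coordCodiff e.open_target (contDiffOn_chartGram g he)
    (fun _ hz => (chartGram_det_pos g he hz).ne') (hη e he)).congr
      fun _ hy => chartForm_codiff g hη he hy

end Charts

/-! ### The Riemannian volume in charts -/

section Volume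

variable {d k q : ℕ} {M : Type*} [TopologicalSpace M]

theorem measurableSet_target_inter_preimage [MeasurableSpace M] [BorelSpace M]
    (e : OpenPartialHomeomorph M (Euc d)) {s : Set M}
    (hs : MeasurableSet s) : MeasurableSet (e.target ∩ e.symm ⁻¹' s) := by
  have h1 : Measurable (e.target.domRestrict e.symm) := e.continuousOn_symm.domRestrict.measurable
  have h2 := e.open_target.measurableSet.subtype_image (h1 hs)
  convert h2 using 1
  ext y
  simp [and_comm]

theorem measurableSet_source_inter_preimage [MeasurableSpace M] [BorelSpace M]
    (e : OpenPartialHomeomorph M (Euc d)) {s : Set (Euc d)}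
    (hs : MeasurableSet s) : MeasurableSet (e.source ∩ e ⁻¹' s) := by
  have h1 : Measurable (e.source.domRestrict e) := e.continuousOn.domRestrict.measurable
  have h2 := e.open_source.measurableSet.subtype_image (h1 hs)
  convert h2 using 1
  ext y
  simp [and_comm]

theorem aemeasurable_symm [MeasurableSpace M] [BorelSpace M]
    (e : OpenPartialHomeomorph M (Euc d)) (w : Euc d → ENNReal) :
    AEMeasurable e.symm ((volume.restrict e.target).withDensity w) :=
  (e.continuousOn_symm.aemeasurable e.open_target.measurableSet).mono_ac
    (withDensity_absolutelyContinuous _ _)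

variable [ChartedSpace (Euc d) M]

theorem exists_countable_chart_cover [SecondCountableTopology M] :
    ∃ s : Set M, s.Countable ∧ ⋃ x ∈ s, (chartAt (Euc d) x).source = univ :=
  TopologicalSpace.countable_cover_nhds fun x => chart_source_mem_nhds (Euc d) x

variable [IsManifold (𝓡 d) ∞ M]

/-- The density `√(det G)` of the Riemannian volume in a chart. -/
def chartDensity (g : Metric d M) (e : OpenPartialHomeomorph M (Euc d)) (y : Euc d) : ℝ :=
  √(chartGram g e y).det

theorem continuousOn_chartDensity (g : Metric d M) {e : OpenPartialHomeomorph M (Euc d)}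
    (he : e ∈ atlas (Euc d) M) : ContinuousOn (chartDensity g e) e.target :=
  (contDiffOn_det (contDiffOn_chartGram g he)).continuousOn.sqrt

theorem chartDensity_pos (g : Metric d M) {e : OpenPartialHomeomorph M (Euc d)}
    (he : e ∈ atlas (Euc d) M) {y : Euc d} (hy : y ∈ e.target) : 0 < chartDensity g e y :=
  Real.sqrt_pos.2 (chartGram_det_pos g he hy)

theorem chartMeasure_le_riemVolume [MeasurableSpace M] (g : Metric d M)
    {e : OpenPartialHomeomorph M (Euc d)} (he : e ∈ atlas (Euc d) M) :
    chartMeasure g e ≤ riemVolume g :=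
  le_iSup₂ (f := fun e (_ : e ∈ atlas (Euc d) M) => chartMeasure g e) e he

variable [MeasurableSpace M] [BorelSpace M]

theorem chartMeasure_apply (g : Metric d M) (e : OpenPartialHomeomorph M (Euc d)) {s : Set M}
    (hs : MeasurableSet s) : chartMeasure g e s =
      ∫⁻ y in e.target ∩ e.symm ⁻¹' s, ENNReal.ofReal (chartDensity g e y) := by
  rw [chartMeasure, Measure.map_apply_of_aemeasurable (aemeasurable_symm e _) hs,
    withDensity_apply', Measure.restrict_restrict' e.open_target.measurableSet, inter_comm]
  rfl

/-- On the domain of a chart `e`, the measure of any other chart is at most that of `e`. -/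
theorem chartMeasure_le (g : Metric d M) {e e' : OpenPartialHomeomorph M (Euc d)}
    (he : e ∈ atlas (Euc d) M) (he' : e' ∈ atlas (Euc d) M) {s : Set M} (hs : MeasurableSet s)
    (hse : s ⊆ e.source) : chartMeasure g e' s ≤ chartMeasure g e s := by
  rw [chartMeasure_apply g e hs, chartMeasure_apply g e' hs]
  set A := e.target ∩ e.symm ⁻¹' (s ∩ e'.source) with hA
  have hAm : MeasurableSet A :=
    measurableSet_target_inter_preimage e (hs.inter e'.open_source.measurableSet)
  set τ : Euc d → Euc d := fun z => e' (e.symm z) with hτ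
  -- only the part of `s` in the domain of `e'` counts; there, change variables by the transition
  have himg : e'.target ∩ e'.symm ⁻¹' s = τ '' A := by
    ext y
    constructor
    · rintro ⟨hy, hys⟩
      refine ⟨e (e'.symm y), ⟨e.map_source (hse hys), ?_⟩, ?_⟩
      · rw [mem_preimage, e.left_inv (hse hys)]
        exact ⟨hys, e'.map_target hy⟩
      · simp only [hτ]
        rw [e.left_inv (hse hys), e'.right_inv hy]
    · rintro ⟨z, ⟨hz, hzs, hz'⟩, rfl⟩
      refine ⟨e'.map_source hz', ?_⟩
      rw [mem_preimage, e'.left_inv hz']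
      exact hzs
  have hder : ∀ z ∈ A, HasFDerivWithinAt τ (fderiv ℝ τ z) A z := fun z hz =>
    ((contDiffAt_transition he he' hz.1 hz.2.2).differentiableAt
      (by simp)).hasFDerivAt.hasFDerivWithinAt
  have hinj : InjOn τ A := by
    intro z hz w hw hzw
    exact e.symm.injOn hz.1 hw.1 (e'.injOn hz.2.2 hw.2.2 hzw)
  rw [himg, lintegral_image_eq_lintegral_abs_det_fderiv_mul volume hAm hder hinj]
  have : ∀ z ∈ A, ENNReal.ofReal |(fderiv ℝ τ z).det| * ENNReal.ofReal (chartDensity g e' (τ z)) =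
      ENNReal.ofReal (chartDensity g e z) := by
    intro z hz
    rw [← ENNReal.ofReal_mul (abs_nonneg _), chartDensity, chartDensity,
      chartGram_transition g he he' hz.1 hz.2.2, sqrt_det_conj, det_clmMatrix]
  rw [setLIntegral_congr_fun hAm this]
  exact lintegral_mono_set (inter_subset_inter_right _ (preimage_mono inter_subset_left))

/-- On a chart domain, the Riemannian volume is `√(det G) dy`. -/
theorem riemVolume_restrict_source (g : Metric d M) {e : OpenPartialHomeomorph M (Euc d)}
    (he : e ∈ atlas (Euc d) M) : (riemVolume g).restrict e.source = chartMeasure g e := by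
  have hsrc := e.open_source.measurableSet
  -- the right-hand side bounds every chart measure, hence also their supremum
  have hle : riemVolume g ≤ chartMeasure g e + (riemVolume g).restrict e.sourceᶜ := by
    refine iSup₂_le fun e' he' => Measure.le_iff.2 fun s hs => ?_
    rw [← measure_inter_add_sdiff s hsrc, Measure.add_apply, Measure.restrict_apply hs]
    refine add_le_add ?_ (chartMeasure_le_riemVolume g he' _)
    exact (chartMeasure_le g he he' (hs.inter hsrc) inter_subset_right).trans
      (measure_mono inter_subset_left)
  ext s hs
  rw [Measure.restrict_apply hs]
  refine le_antisymm ((hle _).trans ?_) ?_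
  · rw [Measure.add_apply, Measure.restrict_apply (hs.inter hsrc), inter_assoc, inter_compl_self,
      inter_empty, measure_empty, add_zero]
    exact measure_mono inter_subset_left
  · have : chartMeasure g e s = chartMeasure g e (s ∩ e.source) := by
      rw [chartMeasure_apply g e hs, chartMeasure_apply g e (hs.inter hsrc)]
      congr 2
      ext y
      constructor
      · rintro ⟨hy, hys⟩; exact ⟨hy, hys, e.map_target hy⟩
      · rintro ⟨hy, hys⟩; exact ⟨hy, hys.1⟩
    rw [this]
    exact chartMeasure_le_riemVolume g he _

theorem riemVolume_apply_of_subset (g : Metric d M) {e : OpenPartialHomeomorph M (Euc d)}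
    (he : e ∈ atlas (Euc d) M) {s : Set M} (hs : MeasurableSet s) (hse : s ⊆ e.source) :
    riemVolume g s = ∫⁻ y in e.target ∩ e.symm ⁻¹' s, ENNReal.ofReal (chartDensity g e y) := by
  rw [← chartMeasure_apply g e hs, ← riemVolume_restrict_source g he, Measure.restrict_apply hs,
    inter_eq_left.2 hse]

theorem setIntegral_source_riemVolume (g : Metric d M) {e : OpenPartialHomeomorph M (Euc d)}
    (he : e ∈ atlas (Euc d) M) {h : M → ℝ}
    (hh : AEStronglyMeasurable h ((riemVolume g).restrict e.source)) :
    ∫ x in e.source, h x ∂(riemVolume g) =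
      ∫ y in e.target, chartDensity g e y * h (e.symm y) := by
  rw [riemVolume_restrict_source g he] at hh ⊢
  have hae : AEMeasurable (fun y => ENNReal.ofReal (chartDensity g e y))
      (volume.restrict e.target) :=
    ((continuousOn_chartDensity g he).aemeasurable e.open_target.measurableSet).ennreal_ofReal
  rw [chartMeasure, integral_map (aemeasurable_symm e _) hh]
  change ∫ y, h (e.symm y) ∂((volume.restrict e.target).withDensity
    fun y => ENNReal.ofReal (chartDensity g e y)) = _
  rw [integral_withDensity_eq_integral_toReal_smul₀ hae (by simp)]
  refine integral_congr_ae (Filter.Eventually.of_forall fun y => ?_)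
  simp only [smul_eq_mul]
  rw [ENNReal.toReal_ofReal (show 0 ≤ chartDensity g e y from Real.sqrt_nonneg _)]

/-- A null set of the Riemannian volume is a null set in every chart. -/
theorem ae_chart_of_ae (g : Metric d M) {Ω : Set M} (hΩ : MeasurableSet Ω) {P : M → Prop}
    (h : ∀ᵐ x ∂((riemVolume g).restrict Ω), P x) {e : OpenPartialHomeomorph M (Euc d)}
    (he : e ∈ atlas (Euc d) M) :
    ∀ᵐ y ∂(volume.restrict (e.target ∩ e.symm ⁻¹' Ω)), P (e.symm y) := by
  rw [ae_restrict_iff' hΩ] at h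
  obtain ⟨N, hN, hNm, hN0⟩ := exists_measurable_superset_of_null (ae_iff.1 h)
  have hm := measurableSet_target_inter_preimage e (hNm.inter e.open_source.measurableSet)
  have h0 : riemVolume g (N ∩ e.source) = 0 := measure_mono_null inter_subset_left hN0
  rw [riemVolume_apply_of_subset g he (hNm.inter e.open_source.measurableSet) inter_subset_right]
    at h0
  have hae : AEMeasurable (fun y => ENNReal.ofReal (chartDensity g e y))
      (volume.restrict (e.target ∩ e.symm ⁻¹' (N ∩ e.source))) :=
    (((continuousOn_chartDensity g he).mono inter_subset_left).aemeasurable hm).ennreal_ofReal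
  rw [lintegral_eq_zero_iff' hae] at h0
  rw [Filter.EventuallyEq, ae_restrict_iff' hm] at h0
  rw [ae_restrict_iff' (measurableSet_target_inter_preimage e hΩ)]
  filter_upwards [h0] with y hy hyΩ
  by_contra hP
  have hyN : e.symm y ∈ N := hN fun hc => hP (hc hyΩ.2)
  have := hy ⟨hyΩ.1, hyN, e.map_target hyΩ.1⟩
  simp only [Pi.zero_apply, ENNReal.ofReal_eq_zero] at this
  exact absurd this (not_le.2 (chartDensity_pos g he hyΩ.1))

/-- Measurability with respect to the Riemannian volume may be checked in charts. -/
theorem aestronglyMeasurable_of_chart [SecondCountableTopology M] (g : Metric d M) {Ω : Set M}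
    (hΩ : MeasurableSet Ω) {h : M → ℝ}
    (H : ∀ e ∈ atlas (Euc d) M,
      AEStronglyMeasurable (fun y => h (e.symm y)) (volume.restrict (e.target ∩ e.symm ⁻¹' Ω))) :
    AEStronglyMeasurable h ((riemVolume g).restrict Ω) := by
  obtain ⟨s, hs, hcov⟩ := exists_countable_chart_cover (d := d) (M := M)
  have hΩeq : Ω = ⋃ x ∈ s, ((chartAt (Euc d) x).source ∩ Ω) := by
    rw [← iUnion₂_inter, hcov, univ_inter]
  have : Countable s := hs.to_subtype
  rw [hΩeq, biUnion_eq_iUnion, aestronglyMeasurable_iUnion_iff]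
  rintro ⟨x, -⟩
  simp only
  set e := chartAt (Euc d) x
  have he : e ∈ atlas (Euc d) M := chart_mem_atlas _ _
  have hsm := e.open_source.measurableSet.inter hΩ
  have hem : AEMeasurable e ((riemVolume g).restrict (e.source ∩ Ω)) :=
    (e.continuousOn.mono inter_subset_left).aemeasurable hsm
  have hac : ((riemVolume g).restrict (e.source ∩ Ω)).map e ≪
      volume.restrict (e.target ∩ e.symm ⁻¹' Ω) := by
    refine Measure.AbsolutelyContinuous.mk fun t ht h0 => ?_
    rw [Measure.restrict_apply ht] at h0
    rw [Measure.map_apply_of_aemeasurable hem ht, Measure.restrict_apply' hsm]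
    have hsub : e ⁻¹' t ∩ (e.source ∩ Ω) = (e.source ∩ e ⁻¹' t) ∩ Ω := by
      ext; simp only [mem_inter_iff, mem_preimage]; tauto
    rw [hsub, riemVolume_apply_of_subset g he
      ((measurableSet_source_inter_preimage e ht).inter hΩ) (fun y hy => hy.1.1)]
    refine setLIntegral_measure_zero _ _ (measure_mono_null ?_ h0)
    rintro y ⟨hy, ⟨-, hyt⟩, hyΩ⟩
    rw [mem_preimage, e.right_inv hy] at hyt
    exact ⟨hyt, hy, hyΩ⟩
  have := ((H e he).mono_ac hac).comp_aemeasurable hem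
  refine this.congr ?_
  rw [Filter.EventuallyEq, ae_restrict_iff' hsm]
  refine Filter.Eventually.of_forall fun y hy => ?_
  simp only [Function.comp_apply]
  rw [e.left_inv hy.1]

/-- The density `√(det G)` is locally bounded, hence the Riemannian volume is locally finite. -/
theorem isLocallyFiniteMeasure_riemVolume (g : Metric d M) :
    IsLocallyFiniteMeasure (riemVolume g) := by
  refine ⟨fun x => ?_⟩
  set e := chartAt (Euc d) x
  have he : e ∈ atlas (Euc d) M := chart_mem_atlas _ _
  have hx : x ∈ e.source := mem_chart_source _ _
  have hc : ContinuousAt (chartDensity g e) (e x) :=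
    (continuousOn_chartDensity g he).continuousAt (e.open_target.mem_nhds (e.map_source hx))
  have hev := hc.eventually (gt_mem_nhds (lt_add_one (chartDensity g e (e x))))
  obtain ⟨r, hr, hball⟩ := Metric.eventually_nhds_iff_ball.1 hev
  set B := Metric.ball (e x) r
  have hm : MeasurableSet (e.source ∩ e ⁻¹' B) :=
    measurableSet_source_inter_preimage e Metric.isOpen_ball.measurableSet
  refine ⟨e.source ∩ e ⁻¹' B, (e.isOpen_inter_preimage Metric.isOpen_ball).mem_nhds
    ⟨hx, Metric.mem_ball_self hr⟩, ?_⟩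
  rw [riemVolume_apply_of_subset g he hm inter_subset_left]
  have hsub : e.target ∩ e.symm ⁻¹' (e.source ∩ e ⁻¹' B) ⊆ B := by
    rintro y ⟨hy, -, hyB⟩
    rwa [mem_preimage, e.right_inv hy] at hyB
  calc ∫⁻ y in e.target ∩ e.symm ⁻¹' (e.source ∩ e ⁻¹' B), ENNReal.ofReal (chartDensity g e y)
      ≤ ∫⁻ y in B, ENNReal.ofReal (chartDensity g e y) := lintegral_mono_set hsub
    _ ≤ ∫⁻ y in B, ENNReal.ofReal (chartDensity g e (e x) + 1) :=
        setLIntegral_mono measurable_const fun y hy =>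
          ENNReal.ofReal_le_ofReal (hball y hy).le
    _ < ⊤ := by
        rw [setLIntegral_const]
        exact ENNReal.mul_lt_top ENNReal.ofReal_lt_top measure_ball_lt_top

end Volume

/-! ### The inner product of forms at a point -/

section Pointwise

variable {d k : ℕ}

section Bilinear

variable {V : Type*} [AddCommGroup V] [Module ℝ V] [TopologicalSpace V]

theorem altInner_add_left (b : Fin d → V) (G : Matrix (Fin d) (Fin d) ℝ)
    (φ φ' η : V [⋀^Fin k]→L[ℝ] ℝ) :
    altInner b G (φ + φ') η = altInner b G φ η + altInner b G φ' η := by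
  simp only [altInner_eq, frameVec_add, add_dotProduct, mul_add]

theorem altInner_smul_left (b : Fin d → V) (G : Matrix (Fin d) (Fin d) ℝ) (c : ℝ)
    (φ η : V [⋀^Fin k]→L[ℝ] ℝ) : altInner b G (c • φ) η = c * altInner b G φ η := by
  rw [altInner_eq, altInner_eq, frameVec_smul, smul_dotProduct, smul_eq_mul]
  ring

theorem altInner_comm (b : Fin d → V) {G : Matrix (Fin d) (Fin d) ℝ} (hG : Gᵀ = G)
    (φ η : V [⋀^Fin k]→L[ℝ] ℝ) : altInner b G φ η = altInner b G η φ := by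
  have hGi : (G⁻¹)ᵀ = G⁻¹ := by rw [Matrix.transpose_nonsing_inv, hG]
  rw [altInner_eq, altInner_eq, dotProduct_comm, Matrix.dotProduct_mulVec,
    ← Matrix.mulVec_transpose, ← tensorPow_transpose, hGi, dotProduct_comm]

end Bilinear

open scoped MatrixOrder in
/-- In suitable coordinates the inner product of forms is a multiple of the Euclidean one. -/
theorem exists_altInner_self_eq {G : Matrix (Fin d) (Fin d) ℝ} (hG : G.PosDef) :
    ∃ S : Matrix (Fin d) (Fin d) ℝ, IsUnit S.det ∧ ∀ φ : Euc d [⋀^Fin k]→L[ℝ] ℝ,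
      altInner (stdVec d) G φ φ = ((k.factorial : ℝ))⁻¹ *
        ∑ I, (tensorPow k S *ᵥ frameVec (stdVec d) φ) I ^ 2 := by
  obtain ⟨S, hS⟩ := CStarAlgebra.nonneg_iff_eq_star_mul_self.mp hG.inv.posSemidef.nonneg
  have hS' : G⁻¹ = Sᵀ * S := by
    rw [hS, Matrix.star_eq_conjTranspose, Matrix.conjTranspose_eq_transpose_of_trivial]
  refine ⟨S, ?_, fun φ => ?_⟩
  · have h := hG.inv.det_pos
    rw [hS', Matrix.det_mul, Matrix.det_transpose] at h
    exact (left_ne_zero_of_mul h.ne').isUnit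
  · rw [altInner_eq, hS', tensorPow_mul, ← Matrix.mulVec_mulVec, tensorPow_transpose,
      Matrix.dotProduct_mulVec, Matrix.vecMul_transpose]
    simp only [dotProduct, sq]

theorem altInner_self_nonneg {G : Matrix (Fin d) (Fin d) ℝ} (hG : G.PosDef)
    (φ : Euc d [⋀^Fin k]→L[ℝ] ℝ) : 0 ≤ altInner (stdVec d) G φ φ := by
  obtain ⟨S, -, hS⟩ := exists_altInner_self_eq (k := k) hG
  rw [hS]
  exact mul_nonneg (by positivity) (Finset.sum_nonneg fun I _ => sq_nonneg _)

theorem frameVec_eq_tensorPow_inv {S : Matrix (Fin d) (Fin d) ℝ} (hS : IsUnit S.det)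
    (φ : Euc d [⋀^Fin k]→L[ℝ] ℝ) : frameVec (stdVec d) φ =
      tensorPow k S⁻¹ *ᵥ (tensorPow k S *ᵥ frameVec (stdVec d) φ) := by
  rw [Matrix.mulVec_mulVec, ← tensorPow_mul, Matrix.nonsing_inv_mul _ hS, tensorPow_one,
    Matrix.one_mulVec]

theorem altInner_self_pos {G : Matrix (Fin d) (Fin d) ℝ} (hG : G.PosDef)
    {φ : Euc d [⋀^Fin k]→L[ℝ] ℝ} (hφ : φ ≠ 0) : 0 < altInner (stdVec d) G φ φ := by
  refine (altInner_self_nonneg hG φ).lt_of_ne fun h => hφ ?_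
  obtain ⟨S, hSu, hS⟩ := exists_altInner_self_eq (k := k) hG
  rw [hS, eq_comm, mul_eq_zero, Finset.sum_eq_zero_iff_of_nonneg fun I _ => sq_nonneg _] at h
  have h1 := h.resolve_left (by positivity)
  have h2 : tensorPow k S *ᵥ frameVec (stdVec d) φ = 0 := by
    funext I
    simpa using h1 I (Finset.mem_univ I)
  apply frameVec_std_injective
  rw [frameVec_eq_tensorPow_inv hSu, h2, Matrix.mulVec_zero]
  rfl

/-- The components in the standard basis as a linear map. -/
def componentMap (d k : ℕ) : (Euc d [⋀^Fin k]→L[ℝ] ℝ) →ₗ[ℝ] ((Fin k → Fin d) → ℝ) where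
  toFun := frameVec (stdVec d)
  map_add' := frameVec_add _
  map_smul' := frameVec_smul _

theorem componentMap_ker : LinearMap.ker (componentMap d k) = ⊥ :=
  LinearMap.ker_eq_bot.2 frameVec_std_injective

instance finiteDimensional_forms : FiniteDimensional ℝ (Euc d [⋀^Fin k]→L[ℝ] ℝ) :=
  Module.Finite.of_injective (componentMap d k) frameVec_std_injective

/-- Convergence in the inner product norm implies convergence. -/
theorem tendsto_of_altInner_sub {G : Matrix (Fin d) (Fin d) ℝ} (hG : G.PosDef)
    {X : ℕ → Euc d [⋀^Fin k]→L[ℝ] ℝ} {ξ : Euc d [⋀^Fin k]→L[ℝ] ℝ}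
    (h : Filter.Tendsto (fun n => altInner (stdVec d) G (X n - ξ) (X n - ξ))
      Filter.atTop (nhds 0)) :
    Filter.Tendsto X Filter.atTop (nhds ξ) := by
  obtain ⟨S, hSu, hS⟩ := exists_altInner_self_eq (k := k) hG
  set w : ℕ → (Fin k → Fin d) → ℝ := fun n => tensorPow k S *ᵥ frameVec (stdVec d) (X n - ξ)
    with hw
  have hfac : (0 : ℝ) < k.factorial := by exact_mod_cast k.factorial_pos
  have h1 : Filter.Tendsto w Filter.atTop (nhds 0) := by
    rw [tendsto_pi_nhds]
    intro I
    have h2 : Filter.Tendsto (fun n => (w n I) ^ 2) Filter.atTop (nhds 0) := by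
      refine squeeze_zero (fun n => sq_nonneg _) (fun n => ?_)
        (by simpa using h.const_mul (k.factorial : ℝ))
      rw [hS, ← mul_assoc, mul_inv_cancel₀ hfac.ne', one_mul]
      exact Finset.single_le_sum (f := fun I => (w n I) ^ 2) (fun J _ => sq_nonneg _)
        (Finset.mem_univ I)
    have h3 := (Real.continuous_sqrt.tendsto 0).comp h2
    rw [Real.sqrt_zero] at h3
    rw [Pi.zero_apply, tendsto_zero_iff_abs_tendsto_zero]
    exact h3.congr fun n => Real.sqrt_sq_eq_abs _
  have h4 : Filter.Tendsto (fun n => frameVec (stdVec d) (X n - ξ)) Filter.atTop (nhds 0) := by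
    have hc : Continuous fun v : (Fin k → Fin d) → ℝ => tensorPow k S⁻¹ *ᵥ v :=
      continuous_const.matrix_mulVec continuous_id
    have := (hc.tendsto 0).comp h1
    rw [Matrix.mulVec_zero] at this
    refine this.congr fun n => ?_
    exact (frameVec_eq_tensorPow_inv hSu _).symm
  have hemb := LinearMap.isClosedEmbedding_of_injective (componentMap_ker (d := d) (k := k))
  rw [hemb.isInducing.tendsto_nhds_iff]
  have h5 : ∀ n, componentMap d k (X n) = frameVec (stdVec d) (X n - ξ) + componentMap d k ξ := by
    intro n
    have : frameVec (stdVec d) (X n - ξ) = componentMap d k (X n - ξ) := rfl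
    rw [this, map_sub, sub_add_cancel]
  have h6 := h4.add_const (componentMap d k ξ)
  rw [zero_add] at h6
  exact h6.congr fun n => (h5 n).symm

/-- The Richardson iteration for the equation `A ξ = ψ`. -/
def richardson {E : Type*} [AddCommGroup E] [Module ℝ E] (A : Module.End ℝ E) (τ : ℝ) (ψ : E) :
    ℕ → E
  | 0 => 0
  | n + 1 => richardson A τ ψ n + τ • (ψ - A (richardson A τ ψ n))

theorem richardson_succ_sub {E : Type*} [AddCommGroup E] [Module ℝ E] {A : Module.End ℝ E} {τ : ℝ}
    {ψ ξ : E} (h : A ξ = ψ) (n : ℕ) : richardson A τ ψ (n + 1) - ξ =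
      (richardson A τ ψ n - ξ) - τ • A (richardson A τ ψ n - ξ) := by
  rw [richardson, map_sub, h]
  module

theorem apply_ringInverse_apply {E : Type*} [AddCommGroup E] [Module ℝ E] {A : Module.End ℝ E}
    (hA : IsUnit A) (ψ : E) : A (Ring.inverse A ψ) = ψ :=
  congrArg (fun B : Module.End ℝ E => B ψ) (Ring.mul_inverse_cancel A hA)

/-- A coercive transformation is injective, hence invertible since forms are finite-dimensional. -/
theorem isUnit_of_coercive {G : Matrix (Fin d) (Fin d) ℝ} (hG : G.PosDef)
    {A : Module.End ℝ (Euc d [⋀^Fin k]→L[ℝ] ℝ)} {c : ℝ} (hc : 0 < c)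
    (hpos : ∀ φ, c * altInner (stdVec d) G φ φ ≤ altInner (stdVec d) G (A φ) φ) : IsUnit A := by
  rw [LinearMap.isUnit_iff_ker_eq_bot, LinearMap.ker_eq_bot']
  intro φ hφ
  by_contra hne
  have h1 := hpos φ
  rw [hφ, altInner_zero_left] at h1
  have h2 := mul_pos hc (altInner_self_pos hG hne)
  linarith

theorem altInner_sub_smul_self {G : Matrix (Fin d) (Fin d) ℝ} (hG : G.PosDef) (t : ℝ)
    (φ η : Euc d [⋀^Fin k]→L[ℝ] ℝ) :
    altInner (stdVec d) G (φ - t • η) (φ - t • η) = altInner (stdVec d) G φ φ -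
      2 * t * altInner (stdVec d) G η φ + t ^ 2 * altInner (stdVec d) G η η := by
  have hGt : Gᵀ = G := by
    have := hG.isHermitian.eq
    rwa [Matrix.conjTranspose_eq_transpose_of_trivial] at this
  have h : φ - t • η = φ + (-t) • η := by module
  rw [h, altInner_add_left, altInner_comm _ hGt φ, altInner_comm _ hGt (_ • η),
    altInner_add_left, altInner_add_left, altInner_smul_left, altInner_smul_left,
    altInner_smul_right, altInner_smul_right, altInner_comm _ hGt φ η]
  ring

/-- For a bounded and coercive `A` and a suitable step size, the Richardson iteration is a
contraction with fixed point `A⁻¹ ψ`. -/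
theorem tendsto_richardson {G : Matrix (Fin d) (Fin d) ℝ} (hG : G.PosDef)
    {A : Module.End ℝ (Euc d [⋀^Fin k]→L[ℝ] ℝ)} {c C : ℝ} (hc : 0 < c) (hcC : c ^ 2 ≤ C)
    (hbdd : ∀ φ, altInner (stdVec d) G (A φ) (A φ) ≤ C * altInner (stdVec d) G φ φ)
    (hpos : ∀ φ, c * altInner (stdVec d) G φ φ ≤ altInner (stdVec d) G (A φ) φ)
    (ψ : Euc d [⋀^Fin k]→L[ℝ] ℝ) :
    Filter.Tendsto (richardson A (c / C) ψ) Filter.atTop (nhds (Ring.inverse A ψ)) := by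
  set ξ := Ring.inverse A ψ with hξ
  have hA : A ξ = ψ := apply_ringInverse_apply (isUnit_of_coercive hG hc hpos) ψ
  have hC : 0 < C := (pow_pos hc 2).trans_le hcC
  -- the step size `c / C` minimizes the bound `1 - 2 τ c + τ² C` for the contraction factor
  set θ := 1 - c ^ 2 / C with hθ
  have hθ0 : 0 ≤ θ := by
    rw [hθ, sub_nonneg, div_le_one hC]; exact hcC
  have hθ1 : θ < 1 := by
    have : 0 < c ^ 2 / C := by positivity
    rw [hθ]; linarith
  have hstep : ∀ n, altInner (stdVec d) G (richardson A (c / C) ψ n - ξ)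
      (richardson A (c / C) ψ n - ξ) ≤ θ ^ n * altInner (stdVec d) G (0 - ξ) (0 - ξ) := by
    intro n
    induction n with
    | zero => simp [richardson]
    | succ n ih =>
      set e := richardson A (c / C) ψ n - ξ with he
      rw [richardson_succ_sub hA, ← he, altInner_sub_smul_self hG]
      have h2 := hbdd e
      have h3 := hpos e
      have hτ : 0 < c / C := div_pos hc hC
      calc altInner (stdVec d) G e e - 2 * (c / C) * altInner (stdVec d) G (A e) e +
            (c / C) ^ 2 * altInner (stdVec d) G (A e) (A e)
          ≤ altInner (stdVec d) G e e - 2 * (c / C) * (c * altInner (stdVec d) G e e) +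
            (c / C) ^ 2 * (C * altInner (stdVec d) G e e) := by
              gcongr
        _ = θ * altInner (stdVec d) G e e := by
              rw [hθ]; field_simp; ring
        _ ≤ θ * (θ ^ n * altInner (stdVec d) G (0 - ξ) (0 - ξ)) := by gcongr
        _ = _ := by ring
  have hlim := (tendsto_pow_atTop_nhds_zero_of_lt_one hθ0 hθ1).mul_const
    (altInner (stdVec d) G (0 - ξ) (0 - ξ))
  rw [zero_mul] at hlim
  exact tendsto_of_altInner_sub hG
    (squeeze_zero (fun n => altInner_self_nonneg hG _) hstep hlim)

end Pointwise

section PtInner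

variable {d k : ℕ} {M : Type*} [TopologicalSpace M] [ChartedSpace (Euc d) M]
  [IsManifold (𝓡 d) ∞ M] (g : Metric d M) (x : M)
  (φ φ' η η' : TangentSpace (𝓡 d) x [⋀^Fin k]→L[ℝ] ℝ)

theorem ptInner_comm : ptInner g x φ η = ptInner g x η φ :=
  altInner_comm _ (by
    have := (pointGram_posDef g x).isHermitian.eq
    rwa [Matrix.conjTranspose_eq_transpose_of_trivial] at this) _ _

theorem ptInner_add_left : ptInner g x (φ + φ') η = ptInner g x φ η + ptInner g x φ' η :=
  altInner_add_left _ _ _ _ _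

theorem ptInner_smul_left (c : ℝ) : ptInner g x (c • φ) η = c * ptInner g x φ η :=
  altInner_smul_left _ _ _ _ _

theorem ptInner_add_right : ptInner g x φ (η + η') = ptInner g x φ η + ptInner g x φ η' := by
  rw [ptInner_comm, ptInner_add_left, ptInner_comm g x η, ptInner_comm g x η']

theorem ptInner_smul_right (c : ℝ) : ptInner g x φ (c • η) = c * ptInner g x φ η := by
  rw [ptInner_comm, ptInner_smul_left, ptInner_comm]

theorem ptInner_neg_left : ptInner g x (-φ) η = -ptInner g x φ η := by
  rw [← neg_one_smul ℝ φ, ptInner_smul_left, neg_one_mul]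

theorem ptInner_neg_right : ptInner g x φ (-η) = -ptInner g x φ η := by
  rw [ptInner_comm, ptInner_neg_left, ptInner_comm]

theorem ptInner_sub_left : ptInner g x (φ - φ') η = ptInner g x φ η - ptInner g x φ' η := by
  rw [sub_eq_add_neg, ptInner_add_left, ptInner_neg_left, ← sub_eq_add_neg]

theorem ptInner_sub_right : ptInner g x φ (η - η') = ptInner g x φ η - ptInner g x φ η' := by
  rw [sub_eq_add_neg, ptInner_add_right, ptInner_neg_right, ← sub_eq_add_neg]

theorem ptInner_self_nonneg : 0 ≤ ptInner g x φ φ :=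
  altInner_self_nonneg (pointGram_posDef g x) _

theorem ptInner_self_pos (h : φ ≠ 0) : 0 < ptInner g x φ φ :=
  altInner_self_pos (pointGram_posDef g x) h

theorem ptInner_zero_left : ptInner g x 0 η = 0 := altInner_zero_left _ _ _

theorem ptInner_zero_right : ptInner g x φ 0 = 0 := altInner_zero_right _ _ _

end PtInner

/-! ### Square integrable forms -/

section MeasurableForms

variable {d k : ℕ} {M : Type*} [TopologicalSpace M] [ChartedSpace (Euc d) M]

theorem Form.MeasurableOn.add [MeasurableSpace M] {Ω : Set M} {φ η : Form d M k}
    (hφ : φ.MeasurableOn Ω) (hη : η.MeasurableOn Ω) : (φ + η).MeasurableOn Ω :=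
  fun e he => (hφ e he).add (hη e he)

theorem Form.MeasurableOn.const_smul [MeasurableSpace M] {Ω : Set M} {φ : Form d M k}
    (hφ : φ.MeasurableOn Ω) (c : ℝ) : (c • φ).MeasurableOn Ω :=
  fun e he => (hφ e he).const_smul c

variable [IsManifold (𝓡 d) ∞ M] [MeasurableSpace M] [BorelSpace M]

/-- The inner product of two measurable forms is measurable, by its expression in charts. -/
theorem aestronglyMeasurable_ptInner [SecondCountableTopology M] (g : Metric d M) {Ω : Set M}
    (hΩ : MeasurableSet Ω) {φ η : Form d M k} (hφ : φ.MeasurableOn Ω) (hη : η.MeasurableOn Ω) :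
    AEStronglyMeasurable (fun x => ptInner g x (φ x) (η x)) ((riemVolume g).restrict Ω) := by
  refine aestronglyMeasurable_of_chart g hΩ fun e he => ?_
  have hm := measurableSet_target_inter_preimage e hΩ
  have heq : ∀ᵐ y ∂(volume.restrict (e.target ∩ e.symm ⁻¹' Ω)),
      altInner (stdVec d) (chartGram g e y) (chartForm e φ y) (chartForm e η y) =
        ptInner g (e.symm y) (φ (e.symm y)) (η (e.symm y)) := by
    filter_upwards [ae_restrict_mem hm] with y hy
    exact (ptInner_eq_chart g he hy.1 φ η).symm
  refine AEStronglyMeasurable.congr ?_ heq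
  have hGi : ∀ i j, AEStronglyMeasurable (fun y => (chartGram g e y)⁻¹ i j)
      (volume.restrict (e.target ∩ e.symm ⁻¹' Ω)) := fun i j =>
    ((contDiffOn_inv_apply (contDiffOn_chartGram g he)
      (fun z hz => (chartGram_det_pos g he hz).ne') i j).continuousOn.mono
        inter_subset_left).aestronglyMeasurable hm
  have hev : ∀ {θ : Form d M k} (v : Fin k → Euc d), θ.MeasurableOn Ω →
      AEStronglyMeasurable (fun y => chartForm e θ y v)
        (volume.restrict (e.target ∩ e.symm ⁻¹' Ω)) := fun v hθ =>
    (ContinuousAlternatingMap.apply ℝ (Euc d) ℝ v).continuous.comp_aestronglyMeasurable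
      (hθ e he)
  unfold altInner
  refine AEStronglyMeasurable.const_mul (Finset.aestronglyMeasurable_fun_sum _ fun I _ =>
    Finset.aestronglyMeasurable_fun_sum _ fun J _ => ?_) _
  exact (Finset.aestronglyMeasurable_fun_prod _ fun a _ => hGi _ _).mul
    ((hev _ hφ).mul (hev _ hη))

end MeasurableForms

section SquareIntegrable

variable {d k : ℕ} {M : Type*} [TopologicalSpace M] [ChartedSpace (Euc d) M]
  [IsManifold (𝓡 d) ∞ M]

theorem abs_ptInner_le (g : Metric d M) (x : M) (φ η : TangentSpace (𝓡 d) x [⋀^Fin k]→L[ℝ] ℝ) :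
    |ptInner g x φ η| ≤ ptInner g x φ φ + ptInner g x η η := by
  have h1 := ptInner_self_nonneg g x (φ + η)
  have h2 := ptInner_self_nonneg g x (φ - η)
  have h3 := ptInner_self_nonneg g x φ
  have h4 := ptInner_self_nonneg g x η
  rw [ptInner_add_left, ptInner_add_right, ptInner_add_right, ptInner_comm g x η φ] at h1
  rw [ptInner_sub_left, ptInner_sub_right, ptInner_sub_right, ptInner_comm g x η φ] at h2
  rw [abs_le]
  constructor <;> linarith

variable [MeasurableSpace M] {g : Metric d M} {Ω : Set M}

theorem l2Inner_comm (φ η : Form d M k) : l2Inner g Ω φ η = l2Inner g Ω η φ := by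
  unfold l2Inner
  simp_rw [ptInner_comm g _ (φ _) (η _)]

theorem l2Inner_self_nonneg (φ : Form d M k) : 0 ≤ l2Inner g Ω φ φ :=
  integral_nonneg fun x => ptInner_self_nonneg g x (φ x)

theorem l2Inner_smul_left (c : ℝ) (φ η : Form d M k) :
    l2Inner g Ω (c • φ) η = c * l2Inner g Ω φ η := by
  unfold l2Inner
  rw [← integral_const_mul]
  exact integral_congr_ae (ae_of_all _ fun x => ptInner_smul_left g x (φ x) (η x) c)

theorem MemL2.const_smul {φ : Form d M k} (hφ : MemL2 g Ω φ) (c : ℝ) : MemL2 g Ω (c • φ) := by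
  refine ⟨hφ.1.const_smul c, ?_⟩
  refine (hφ.2.const_mul (c * c)).congr (ae_of_all _ fun x => ?_)
  change _ = ptInner g x (c • φ x) (c • φ x)
  rw [ptInner_smul_left, ptInner_smul_right, ← mul_assoc]

variable [SecondCountableTopology M] [BorelSpace M]

theorem MemL2.integrable_ptInner (hΩ : MeasurableSet Ω) {φ η : Form d M k} (hφ : MemL2 g Ω φ)
    (hη : MemL2 g Ω η) :
    Integrable (fun x => ptInner g x (φ x) (η x)) ((riemVolume g).restrict Ω) :=
  (hφ.2.add hη.2).mono' (aestronglyMeasurable_ptInner g hΩ hφ.1 hη.1)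
    (ae_of_all _ fun x => abs_ptInner_le g x (φ x) (η x))

theorem MemL2.add (hΩ : MeasurableSet Ω) {φ η : Form d M k} (hφ : MemL2 g Ω φ)
    (hη : MemL2 g Ω η) : MemL2 g Ω (φ + η) := by
  refine ⟨hφ.1.add hη.1, ?_⟩
  refine ((hφ.2.add ((hφ.integrable_ptInner hΩ hη).const_mul 2)).add hη.2).congr
    (ae_of_all _ fun x => ?_)
  change ptInner g x (φ x) (φ x) + 2 * ptInner g x (φ x) (η x) + ptInner g x (η x) (η x) =
    ptInner g x (φ x + η x) (φ x + η x)
  rw [ptInner_add_left, ptInner_add_right, ptInner_add_right, ptInner_comm g x (η x) (φ x)]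
  ring

theorem MemL2.sub (hΩ : MeasurableSet Ω) {φ η : Form d M k} (hφ : MemL2 g Ω φ)
    (hη : MemL2 g Ω η) : MemL2 g Ω (φ - η) := by
  have h0 : ∀ a b : Euc d [⋀^Fin k]→L[ℝ] ℝ, a - b = a + (-1 : ℝ) • b := fun a b => by module
  have h : φ - η = φ + (-1 : ℝ) • η := funext fun x => h0 (φ x) (η x)
  rw [h]
  exact hφ.add hΩ (hη.const_smul _)

theorem l2Inner_add_left (hΩ : MeasurableSet Ω) {φ φ' η : Form d M k} (hφ : MemL2 g Ω φ)
    (hφ' : MemL2 g Ω φ') (hη : MemL2 g Ω η) :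
    l2Inner g Ω (φ + φ') η = l2Inner g Ω φ η + l2Inner g Ω φ' η := by
  unfold l2Inner
  rw [← integral_add (hφ.integrable_ptInner hΩ hη) (hφ'.integrable_ptInner hΩ hη)]
  exact integral_congr_ae (ae_of_all _ fun x => ptInner_add_left g x (φ x) (φ' x) (η x))

theorem l2Inner_sub_left (hΩ : MeasurableSet Ω) {φ φ' η : Form d M k} (hφ : MemL2 g Ω φ)
    (hφ' : MemL2 g Ω φ') (hη : MemL2 g Ω η) :
    l2Inner g Ω (φ - φ') η = l2Inner g Ω φ η - l2Inner g Ω φ' η := by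
  unfold l2Inner
  rw [← integral_sub (hφ.integrable_ptInner hΩ hη) (hφ'.integrable_ptInner hΩ hη)]
  exact integral_congr_ae (ae_of_all _ fun x => ptInner_sub_left g x (φ x) (φ' x) (η x))

theorem l2Inner_sub_right (hΩ : MeasurableSet Ω) {φ η η' : Form d M k} (hφ : MemL2 g Ω φ)
    (hη : MemL2 g Ω η) (hη' : MemL2 g Ω η') :
    l2Inner g Ω φ (η - η') = l2Inner g Ω φ η - l2Inner g Ω φ η' := by
  rw [l2Inner_comm, l2Inner_sub_left hΩ hη hη' hφ, l2Inner_comm η, l2Inner_comm η']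

/-- The Cauchy–Schwarz inequality. -/
theorem abs_l2Inner_le (hΩ : MeasurableSet Ω) {φ η : Form d M k} (hφ : MemL2 g Ω φ)
    (hη : MemL2 g Ω η) :
    |l2Inner g Ω φ η| ≤ √(l2Inner g Ω φ φ) * √(l2Inner g Ω η η) := by
  have h : ∀ t : ℝ, 0 ≤ l2Inner g Ω φ φ * (t * t) + 2 * l2Inner g Ω φ η * t +
      l2Inner g Ω η η := by
    intro t
    have h0 := l2Inner_self_nonneg (g := g) (Ω := Ω) (t • φ + η)
    have hs := (hφ.const_smul t).add hΩ hη
    rw [l2Inner_add_left hΩ (hφ.const_smul t) hη hs, l2Inner_comm (t • φ), l2Inner_comm η,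
      l2Inner_add_left hΩ (hφ.const_smul t) hη (hφ.const_smul t),
      l2Inner_add_left hΩ (hφ.const_smul t) hη hη, l2Inner_smul_left, l2Inner_comm φ (t • φ),
      l2Inner_comm η (t • φ), l2Inner_smul_left, l2Inner_smul_left] at h0
    linarith
  have h1 := discrim_le_zero h
  rw [discrim] at h1
  rw [← Real.sqrt_mul (l2Inner_self_nonneg φ)]
  apply Real.abs_le_sqrt
  linarith

/-- The scalar product is continuous with respect to convergence in mean square. -/
theorem tendsto_l2Inner (hΩ : MeasurableSet Ω) {φ η : Form d M k} {X Y : ℕ → Form d M k}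
    (hφ : MemL2 g Ω φ) (hη : MemL2 g Ω η) (hX : ∀ n, MemL2 g Ω (X n)) (hY : ∀ n, MemL2 g Ω (Y n))
    (hXφ : Filter.Tendsto (fun n => l2Inner g Ω (φ - X n) (φ - X n)) Filter.atTop (nhds 0))
    (hYη : Filter.Tendsto (fun n => l2Inner g Ω (η - Y n) (η - Y n)) Filter.atTop (nhds 0)) :
    Filter.Tendsto (fun n => l2Inner g Ω (X n) (Y n)) Filter.atTop (nhds (l2Inner g Ω φ η)) := by
  have key : ∀ n, l2Inner g Ω (X n) (Y n) = l2Inner g Ω φ η - l2Inner g Ω (φ - X n) η -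
      l2Inner g Ω φ (η - Y n) + l2Inner g Ω (φ - X n) (η - Y n) := by
    intro n
    rw [l2Inner_sub_left hΩ hφ (hX n) hη, l2Inner_sub_right hΩ hφ hη (hY n),
      l2Inner_sub_left hΩ hφ (hX n) (hη.sub hΩ (hY n)), l2Inner_sub_right hΩ hφ hη (hY n),
      l2Inner_sub_right hΩ (hX n) hη (hY n)]
    ring
  have hsX := (Real.continuous_sqrt.tendsto 0).comp hXφ
  have hsY := (Real.continuous_sqrt.tendsto 0).comp hYη
  rw [Real.sqrt_zero] at hsX hsY
  have t1 : Filter.Tendsto (fun n => l2Inner g Ω (φ - X n) η) Filter.atTop (nhds 0) :=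
    squeeze_zero_norm (fun n => abs_l2Inner_le hΩ (hφ.sub hΩ (hX n)) hη)
      (by simpa using hsX.mul_const (√(l2Inner g Ω η η)))
  have t2 : Filter.Tendsto (fun n => l2Inner g Ω φ (η - Y n)) Filter.atTop (nhds 0) :=
    squeeze_zero_norm (fun n => abs_l2Inner_le hΩ hφ (hη.sub hΩ (hY n)))
      (by simpa using hsY.const_mul (√(l2Inner g Ω φ φ)))
  have t3 : Filter.Tendsto (fun n => l2Inner g Ω (φ - X n) (η - Y n)) Filter.atTop (nhds 0) :=
    squeeze_zero_norm (fun n => abs_l2Inner_le hΩ (hφ.sub hΩ (hX n)) (hη.sub hΩ (hY n)))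
      (by simpa using hsX.mul hsY)
  simp_rw [key]
  simpa using ((tendsto_const_nhds.sub t1).sub t2).add t3

end SquareIntegrable

/-! ### Admissible coefficients -/

section Coefficients

variable {d k : ℕ} {M : Type*} [TopologicalSpace M] [ChartedSpace (Euc d) M]
  [IsManifold (𝓡 d) ∞ M] [MeasurableSpace M] {g : Metric d M} {Ω : Set M} {A : Coeff d M k}

theorem IsAdmissibleCoeff.ae_isUnit (hA : IsAdmissibleCoeff g Ω A) :
    ∀ᵐ x ∂((riemVolume g).restrict Ω), IsUnit (A x) := by
  obtain ⟨c, hc, h⟩ := hA.posDef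
  filter_upwards [h] with x hx
  exact isUnit_of_coercive (pointGram_posDef g x) hc hx

/-- Simultaneous bounds, with an upper bound `C ≥ c²` as needed for the Richardson iteration. -/
theorem IsAdmissibleCoeff.exists_bounds (hA : IsAdmissibleCoeff g Ω A) :
    ∃ c C : ℝ, 0 < c ∧ c ^ 2 ≤ C ∧ ∀ᵐ x ∂((riemVolume g).restrict Ω),
      (∀ φ : TangentSpace (𝓡 d) x [⋀^Fin k]→L[ℝ] ℝ,
        ptInner g x (A x φ) (A x φ) ≤ C * ptInner g x φ φ) ∧
      ∀ φ : TangentSpace (𝓡 d) x [⋀^Fin k]→L[ℝ] ℝ, c * ptInner g x φ φ ≤ ptInner g x (A x φ) φ := by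
  obtain ⟨C, hC⟩ := hA.bounded
  obtain ⟨c, hc, hc'⟩ := hA.posDef
  refine ⟨c, max C (c ^ 2), hc, le_max_right _ _, ?_⟩
  filter_upwards [hC, hc'] with x hx hx'
  exact ⟨fun φ => (hx φ).trans
    (mul_le_mul_of_nonneg_right (le_max_left _ _) (ptInner_self_nonneg g x φ)), hx'⟩

theorem wNormSq_nonneg (hA : IsAdmissibleCoeff g Ω A) (φ : Form d M k) :
    0 ≤ wNormSq g Ω A φ := by
  obtain ⟨c, hc, h⟩ := hA.posDef
  refine integral_nonneg_of_ae ?_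
  filter_upwards [h] with x hx
  exact (mul_nonneg hc.le (ptInner_self_nonneg g x _)).trans (hx _)

theorem IsAdmissibleCoeff.measurableOn_richardson (hA : IsAdmissibleCoeff g Ω A) (τ : ℝ)
    {ψ : Form d M k} (hψ : ψ.MeasurableOn Ω) (n : ℕ) :
    Form.MeasurableOn (fun x => richardson (A x) τ (ψ x) n) Ω := by
  induction n with
  | zero => exact fun e he => aestronglyMeasurable_zero
  | succ n ih =>
    have h := ih.add ((hψ.add ((hA.measurable _ ih).const_smul (-1))).const_smul τ)
    refine fun e he => (h e he).congr (ae_of_all _ fun y => ?_)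
    refine congrArg (fun η : Euc d [⋀^Fin k]→L[ℝ] ℝ =>
      η.compContinuousLinearMap (chartDeriv e y)) ?_
    have h0 : ∀ (B : Module.End ℝ (Euc d [⋀^Fin k]→L[ℝ] ℝ)) (a : Euc d [⋀^Fin k]→L[ℝ] ℝ),
        richardson B τ a n + τ • (a + (-1 : ℝ) • B (richardson B τ a n)) =
          richardson B τ a (n + 1) := fun B a => by
      rw [richardson]
      module
    exact h0 (A (e.symm y)) (ψ (e.symm y))

variable [BorelSpace M]

/-- The pointwise inverse is measurable, as the limit of the Richardson iteration. -/
theorem IsAdmissibleCoeff.measurableOn_inv (hΩ : MeasurableSet Ω) (hA : IsAdmissibleCoeff g Ω A)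
    {ψ : Form d M k} (hψ : ψ.MeasurableOn Ω) :
    Form.MeasurableOn (fun x => A.inv x (ψ x)) Ω := by
  obtain ⟨c, C, hc, hcC, h⟩ := hA.exists_bounds
  intro e he
  refine aestronglyMeasurable_of_tendsto_ae Filter.atTop
    (f := fun n => chartForm e (fun x => richardson (A x) (c / C) (ψ x) n))
    (fun n => hA.measurableOn_richardson (c / C) hψ n e he) ?_
  filter_upwards [ae_chart_of_ae g hΩ h he] with y hy
  have hlim := tendsto_richardson (pointGram_posDef g (e.symm y)) hc hcC hy.1 hy.2 (ψ (e.symm y))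
  exact ((ContinuousAlternatingMap.compContinuousLinearMapCLM (F := ℝ) (ι := Fin k)
    (chartDeriv e y)).continuous.tendsto _).comp hlim

/-- The inverse of an admissible coefficient is admissible. -/
theorem IsAdmissibleCoeff.inv (hΩ : MeasurableSet Ω) (hA : IsAdmissibleCoeff g Ω A) :
    IsAdmissibleCoeff g Ω A.inv := by
  obtain ⟨c, C, hc, hcC, h⟩ := hA.exists_bounds
  have hC : 0 < C := (pow_pos hc 2).trans_le hcC
  refine ⟨fun φ hφ => hA.measurableOn_inv hΩ hφ, ?_, ⟨(c ^ 2)⁻¹, ?_⟩, ⟨c / C, div_pos hc hC, ?_⟩⟩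
  · filter_upwards [hA.ae_isUnit, hA.symm] with x hu hs φ η
    have h1 := hs (A.inv x φ) (A.inv x η)
    have h2 : A x (A.inv x φ) = φ := apply_ringInverse_apply hu φ
    have h3 : A x (A.inv x η) = η := apply_ringInverse_apply hu η
    rw [h2, h3] at h1
    exact h1.symm
  · filter_upwards [hA.ae_isUnit, h] with x hu hb φ
    have h2 : A x (A.inv x φ) = φ := apply_ringInverse_apply hu φ
    set ξ := A.inv x φ
    have h4 := hb.2 ξ
    rw [h2] at h4
    -- `0 ≤ ‖φ - c ξ‖² ≤ ‖φ‖² - c² ‖ξ‖²`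
    have h5 := ptInner_self_nonneg g x (φ - c • ξ)
    rw [ptInner_sub_left, ptInner_sub_right, ptInner_sub_right, ptInner_smul_left,
      ptInner_smul_left, ptInner_smul_right, ptInner_smul_right, ptInner_comm g x ξ φ] at h5
    have h6 := mul_le_mul_of_nonneg_left h4 hc.le
    rw [inv_mul_eq_div, le_div_iff₀ (pow_pos hc 2)]
    linarith
  · filter_upwards [hA.ae_isUnit, h] with x hu hb φ
    have h2 : A x (A.inv x φ) = φ := apply_ringInverse_apply hu φ
    set ξ := A.inv x φ
    have h4 := hb.2 ξ
    have h5 := hb.1 ξ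
    rw [h2] at h4 h5
    rw [ptInner_comm g x ξ φ]
    refine le_trans ?_ h4
    rw [div_mul_eq_mul_div, div_le_iff₀ hC, mul_assoc]
    exact mul_le_mul_of_nonneg_left (by rwa [mul_comm]) hc.le

variable [SecondCountableTopology M]

theorem IsAdmissibleCoeff.memL2 (hΩ : MeasurableSet Ω) (hA : IsAdmissibleCoeff g Ω A)
    {φ : Form d M k} (hφ : MemL2 g Ω φ) : MemL2 g Ω (fun x => A x (φ x)) := by
  have hm := hA.measurable φ hφ.1
  obtain ⟨C, hC⟩ := hA.bounded
  refine ⟨hm, (hφ.2.const_mul C).mono' (aestronglyMeasurable_ptInner g hΩ hm hm) ?_⟩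
  filter_upwards [hC] with x hx
  rw [Real.norm_eq_abs, abs_of_nonneg (ptInner_self_nonneg g x _)]
  exact hx _

/-- Expansion of the square `‖A a - b‖²` in the norm weighted with `A⁻¹`. -/
theorem wNormSq_inv_sub (hΩ : MeasurableSet Ω) (hA : IsAdmissibleCoeff g Ω A) {a b : Form d M k}
    (ha : MemL2 g Ω a) (hb : MemL2 g Ω b) :
    wNormSq g Ω A.inv (fun x => A x (a x) - b x) =
      wNormSq g Ω A a + wNormSq g Ω A.inv b - 2 * l2Inner g Ω a b := by
  have h1 := (hA.memL2 hΩ ha).integrable_ptInner hΩ ha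
  have h2 := ((hA.inv hΩ).memL2 hΩ hb).integrable_ptInner hΩ hb
  have h3 := ha.integrable_ptInner hΩ hb
  unfold wNormSq l2Inner
  rw [← integral_const_mul, ← integral_add h1 h2,
    ← integral_sub (by exact h1.add h2) (h3.const_mul 2)]
  refine integral_congr_ae ?_
  filter_upwards [hA.ae_isUnit, hA.symm] with x hu hs
  have e1 : A x (A.inv x (b x)) = b x := apply_ringInverse_apply hu _
  have e2 : A.inv x (A x (a x)) = a x :=
    congrArg (fun B : Module.End ℝ _ => B (a x)) (Ring.inverse_mul_cancel (A x) hu)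
  have e3 := hs (A.inv x (b x)) (a x)
  rw [e1] at e3
  rw [map_sub, e2, ptInner_sub_left, ptInner_sub_right, ptInner_sub_right, ← e3,
    ptInner_comm g x (b x) (a x), ptInner_comm g x (a x) (A x (a x))]
  ring

theorem wNormSq_pos (hΩ : MeasurableSet Ω) (hA : IsAdmissibleCoeff g Ω A) {φ : Form d M k}
    (hφ : MemL2 g Ω φ) (hne : ¬ ∀ᵐ x ∂((riemVolume g).restrict Ω), φ x = 0) :
    0 < wNormSq g Ω A φ := by
  refine (wNormSq_nonneg hA φ).lt_of_ne fun h0 => hne ?_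
  obtain ⟨c, hc, h⟩ := hA.posDef
  have hnn : 0 ≤ᵐ[(riemVolume g).restrict Ω] fun x => ptInner g x (A x (φ x)) (φ x) := by
    filter_upwards [h] with x hx
    exact (mul_nonneg hc.le (ptInner_self_nonneg g x _)).trans (hx _)
  have hz := (integral_eq_zero_iff_of_nonneg_ae hnn
    ((hA.memL2 hΩ hφ).integrable_ptInner hΩ hφ)).1 h0.symm
  filter_upwards [h, hz] with x hx hzx
  by_contra hne'
  have h1 := hx (φ x)
  have h2 := mul_pos hc (ptInner_self_pos g x _ hne')
  have h3 : ptInner g x (A x (φ x)) (φ x) = 0 := hzx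
  linarith

end Coefficients

/-! ### Locality of the derivatives of forms -/

section Locality

variable {d k q : ℕ}

theorem extDeriv_eq_zero_of_eventually {φ : Euc d → Euc d [⋀^Fin k]→L[ℝ] ℝ} {y : Euc d}
    (h : ∀ᶠ z in nhds y, φ z = 0) : extDeriv φ y = 0 := by
  have h1 : φ =ᶠ[nhds y] ((0 : ℝ) • φ) := by
    filter_upwards [h] with z hz
    rw [hz, Pi.smul_apply, zero_smul]
  rw [h1.extDeriv_eq, extDeriv_smul, zero_smul]

theorem hodgeStar_zero {l : ℕ} (h : d = l + k) (G : Matrix (Fin d) (Fin d) ℝ) :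
    hodgeStar h G 0 = 0 := by
  simp [hodgeStar]

theorem coordCodiff_eq_zero_of_eventually {G : Euc d → Matrix (Fin d) (Fin d) ℝ}
    {η : Euc d → Euc d [⋀^Fin (q + 1)]→L[ℝ] ℝ} {y : Euc d} (h : ∀ᶠ z in nhds y, η z = 0) :
    coordCodiff G η y = 0 := by
  by_cases hq : q + 1 ≤ d
  · rw [coordCodiff, dif_pos hq, extDeriv_eq_zero_of_eventually, hodgeStar_zero, smul_zero]
    filter_upwards [h] with z hz
    rw [hz, hodgeStar_zero]
  · rw [coordCodiff, dif_neg hq]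

variable {M : Type*} [TopologicalSpace M] [ChartedSpace (Euc d) M]

theorem eventually_chartForm_eq_zero {φ : Form d M k} {e : OpenPartialHomeomorph M (Euc d)}
    {x : M} (hx : x ∈ e.source) (h : ∀ᶠ x' in nhds x, φ x' = 0) :
    ∀ᶠ z in nhds (e x), chartForm e φ z = 0 := by
  have hc : Filter.Tendsto e.symm (nhds (e x)) (nhds x) := e.tendsto_symm hx
  filter_upwards [hc.eventually h] with z hz
  rw [chartForm_eq, hz]
  rfl

theorem extD_eq_zero_of_eventually {φ : Form d M k} {x : M} (h : ∀ᶠ x' in nhds x, φ x' = 0) :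
    extD φ x = 0 := by
  rw [extD, extDeriv_eq_zero_of_eventually
    (eventually_chartForm_eq_zero (mem_chart_source (Euc d) x) h)]
  rfl

theorem codiff_eq_zero_of_eventually [IsManifold (𝓡 d) ∞ M] (g : Metric d M)
    {η : Form d M (q + 1)} {x : M} (h : ∀ᶠ x' in nhds x, η x' = 0) : codiff g η x = 0 := by
  rw [codiff, coordCodiff_eq_zero_of_eventually
    (eventually_chartForm_eq_zero (mem_chart_source (Euc d) x) h)]
  rfl

theorem eventually_eq_zero_of_notMem_support {φ : Form d M k} {x : M} (hx : x ∉ φ.support) :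
    ∀ᶠ x' in nhds x, φ x' = 0 := by
  filter_upwards [isClosed_closure.isOpen_compl.mem_nhds hx] with x' hx'
  by_contra hne
  exact hx' (subset_closure hne)

theorem eq_zero_of_notMem_support {φ : Form d M k} {x : M} (hx : x ∉ φ.support) : φ x = 0 :=
  (eventually_eq_zero_of_notMem_support hx).self_of_nhds

theorem support_extD_subset (φ : Form d M k) : (extD φ).support ⊆ φ.support :=
  closure_minimal (fun _ hx => by_contra fun hn =>
    hx (extD_eq_zero_of_eventually (eventually_eq_zero_of_notMem_support hn))) isClosed_closure

theorem support_codiff_subset [IsManifold (𝓡 d) ∞ M] (g : Metric d M) (η : Form d M (q + 1)) :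
    (codiff g η).support ⊆ η.support :=
  closure_minimal (fun _ hx => by_contra fun hn =>
    hx (codiff_eq_zero_of_eventually g (eventually_eq_zero_of_notMem_support hn)))
    isClosed_closure

end Locality

/-! ### Smooth forms -/

section SmoothForms

variable {d k q : ℕ} {M : Type*} [TopologicalSpace M] [ChartedSpace (Euc d) M]

theorem Form.smooth_zero : (0 : Form d M k).Smooth := fun _ _ =>
  (contDiffOn_const (c := (0 : Euc d [⋀^Fin k]→L[ℝ] ℝ))).congr fun _ _ => rfl

theorem Form.Smooth.add {φ η : Form d M k} (hφ : φ.Smooth) (hη : η.Smooth) : (φ + η).Smooth :=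
  fun e he => (hφ e he).add (hη e he)

theorem Form.Smooth.sum {ι : Type*} (s : Finset ι) {φ : ι → Form d M k}
    (h : ∀ i, (φ i).Smooth) : (∑ i ∈ s, φ i).Smooth :=
  Finset.sum_induction φ Form.Smooth (fun _ _ => Form.Smooth.add) Form.smooth_zero
    fun i _ => h i

theorem extD_add {φ η : Form d M k} (hφ : φ.Smooth) (hη : η.Smooth) (x : M) :
    extD (φ + η) x = extD φ x + extD η x := by
  have hmem : chartAt (Euc d) x x ∈ (chartAt (Euc d) x).target :=
    (chartAt (Euc d) x).map_source (mem_chart_source _ x)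
  have h := extDeriv_add
    ((hφ.contDiffAt (chart_mem_atlas (Euc d) x) hmem).differentiableAt (by simp))
    ((hη.contDiffAt (chart_mem_atlas (Euc d) x) hmem).differentiableAt (by simp))
  exact congrArg (fun θ : Euc d [⋀^Fin (k + 1)]→L[ℝ] ℝ => θ.compContinuousLinearMap
    (mfderiv (𝓡 d) (𝓡 d) (chartAt (Euc d) x) x : Euc d →L[ℝ] Euc d)) h

theorem Form.Smooth.measurableOn {φ : Form d M k} [MeasurableSpace M] [BorelSpace M]
    (hφ : φ.Smooth) {Ω : Set M}
    (hΩ : MeasurableSet Ω) : φ.MeasurableOn Ω := fun e he =>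
  ((hφ e he).continuousOn.mono inter_subset_left).aestronglyMeasurable
    (measurableSet_target_inter_preimage e hΩ)

variable [IsManifold (𝓡 d) ∞ M]

theorem Form.Smooth.smul {φ : Form d M k} (hφ : φ.Smooth) {f : M → ℝ}
    (hf : ContMDiff (𝓡 d) 𝓘(ℝ, ℝ) ∞ f) : Form.Smooth (fun x => f x • φ x) := fun e he => by
  have h1 := contMDiffOn_symm_of_mem_maximalAtlas (I := 𝓡 d) (n := ∞)
    (IsManifold.subset_maximalAtlas he)
  exact (contMDiffOn_iff_contDiffOn.1 (hf.comp_contMDiffOn h1)).smul (hφ e he)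

theorem continuous_ptInner (g : Metric d M) {φ η : Form d M k} (hφ : φ.Smooth) (hη : η.Smooth) :
    Continuous fun x => ptInner g x (φ x) (η x) := by
  rw [continuous_iff_continuousAt]
  intro x
  set e := chartAt (Euc d) x with he
  have hea : e ∈ atlas (Euc d) M := chart_mem_atlas _ _
  have h1 := (contDiffOn_altInner (contDiffOn_chartGram g hea)
    (fun z hz => (chartGram_det_pos g hea hz).ne') (hφ e hea) (hη e hea)).continuousOn
  have h2 := h1.comp e.continuousOn e.mapsTo
  refine (h2.congr fun x' hx' => ?_).continuousAt (e.open_source.mem_nhds (mem_chart_source _ x))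
  have h3 := ptInner_eq_chart g hea (e.map_source hx') φ η
  rw [e.left_inv hx'] at h3
  exact h3

variable [MeasurableSpace M] [BorelSpace M]

theorem Form.Smooth.memL2 [SecondCountableTopology M] (g : Metric d M) {φ : Form d M k}
    (hφ : φ.Smooth) (hc : IsCompact φ.support) {Ω : Set M} (hΩ : MeasurableSet Ω) :
    MemL2 g Ω φ := by
  have := isLocallyFiniteMeasure_riemVolume g
  refine ⟨hφ.measurableOn hΩ, ((continuous_ptInner g hφ hφ).integrable_of_hasCompactSupport
    ?_).integrableOn⟩
  refine hc.of_isClosed_subset (isClosed_tsupport _) (closure_mono fun x hx h0 => hx ?_)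
  change ptInner g x (φ x) (φ x) = 0
  rw [h0, ptInner_zero_left]

end SmoothForms

/-! ### Green's formula -/

section Green

variable {d q : ℕ} {M : Type*} [TopologicalSpace M] [ChartedSpace (Euc d) M]
  [IsManifold (𝓡 d) ∞ M]

/-- The integrand `⟨dζ, ξ⟩ + ⟨ζ, δξ⟩` of Green's formula. -/
def greenDensity (g : Metric d M) (ζ : Form d M q) (ξ : Form d M (q + 1)) (x : M) : ℝ :=
  ptInner g x (extD ζ x) (ξ x) + ptInner g x (ζ x) (codiff g ξ x)

theorem continuous_greenDensity (g : Metric d M) {ζ : Form d M q} {ξ : Form d M (q + 1)}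
    (hζ : ζ.Smooth) (hξ : ξ.Smooth) : Continuous (greenDensity g ζ ξ) :=
  (continuous_ptInner g hζ.extD hξ).add (continuous_ptInner g hζ (hξ.codiff g))

theorem greenDensity_eq_zero_left (g : Metric d M) {ζ : Form d M q} (ξ : Form d M (q + 1))
    {x : M} (h : ∀ᶠ x' in nhds x, ζ x' = 0) : greenDensity g ζ ξ x = 0 := by
  rw [greenDensity, extD_eq_zero_of_eventually h, h.self_of_nhds, ptInner_zero_left,
    ptInner_zero_left, add_zero]

theorem greenDensity_eq_zero_right (g : Metric d M) (ζ : Form d M q) {ξ : Form d M (q + 1)}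
    {x : M} (h : ∀ᶠ x' in nhds x, ξ x' = 0) : greenDensity g ζ ξ x = 0 := by
  rw [greenDensity, codiff_eq_zero_of_eventually g h, h.self_of_nhds, ptInner_zero_right,
    ptInner_zero_right, add_zero]

theorem greenDensity_sum (g : Metric d M) {ι : Type*} (s : Finset ι) {ζ : ι → Form d M q}
    (ξ : Form d M (q + 1)) (h : ∀ i, (ζ i).Smooth) (x : M) :
    greenDensity g (∑ i ∈ s, ζ i) ξ x = ∑ i ∈ s, greenDensity g (ζ i) ξ x := by
  classical
  induction s using Finset.induction_on with
  | empty =>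
    rw [Finset.sum_empty, Finset.sum_empty]
    exact greenDensity_eq_zero_left g ξ (Filter.Eventually.of_forall fun _ => rfl)
  | insert i s hi ih =>
    rw [Finset.sum_insert hi, Finset.sum_insert hi, ← ih, greenDensity,
      extD_add (h i) (Form.Smooth.sum s h), Pi.add_apply, ptInner_add_left, ptInner_add_left,
      greenDensity, greenDensity]
    ring

theorem hasCompactSupport_greenDensity (g : Metric d M) {ζ : Form d M q} (ξ : Form d M (q + 1))
    (hc : IsCompact ζ.support) : HasCompactSupport (greenDensity g ζ ξ) :=
  hc.of_isClosed_subset (isClosed_tsupport _) (closure_minimal (fun _ hx => by_contra fun hn =>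
    hx (greenDensity_eq_zero_left g ξ (eventually_eq_zero_of_notMem_support hn)))
    isClosed_closure)

variable [MeasurableSpace M] [BorelSpace M]

/-- Green's formula for a form supported in the domain of a chart. -/
theorem setIntegral_greenDensity_chart (g : Metric d M) {Ω : Set M}
    {e : OpenPartialHomeomorph M (Euc d)} (he : e ∈ atlas (Euc d) M) {ζ : Form d M q}
    {ξ : Form d M (q + 1)} (hζ : ζ.Smooth) (hξ : ξ.Smooth) (hc : IsCompact ζ.support)
    (hsub : ζ.support ⊆ e.source ∩ Ω) : ∫ x in Ω, greenDensity g ζ ξ x ∂(riemVolume g) = 0 := by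
  have h0 : ∀ x ∉ ζ.support, greenDensity g ζ ξ x = 0 := fun x hx =>
    greenDensity_eq_zero_left g ξ (eventually_eq_zero_of_notMem_support hx)
  rw [setIntegral_eq_integral_of_forall_compl_eq_zero fun x hx => h0 x fun h => hx (hsub h).2,
    ← setIntegral_eq_integral_of_forall_compl_eq_zero (s := e.source)
      fun x hx => h0 x fun h => hx (hsub h).1,
    setIntegral_source_riemVolume g he
      ((continuous_greenDensity g hζ hξ).aestronglyMeasurable.restrict)]
  have hgreen := setIntegral_green_coord e.open_target
    (hc.image_of_continuousOn (e.continuousOn.mono fun x hx => (hsub hx).1))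
    (image_subset_iff.2 fun x hx => e.map_source (hsub hx).1)
    (contDiffOn_chartGram g he) (fun y _ => chartGram_transpose g e y)
    (fun y hy => chartGram_det_pos g he hy) (hζ e he) (hξ e he) (fun y hy => by
      have hn : e.symm y ∉ ζ.support := fun h => hy.2 ⟨e.symm y, h, e.right_inv hy.1⟩
      rw [chartForm_eq, eq_zero_of_notMem_support hn]
      rfl)
  rw [← hgreen]
  refine setIntegral_congr_fun e.open_target.measurableSet fun y hy => ?_
  rw [greenDensity, ptInner_eq_chart g he hy, ptInner_eq_chart g he hy, chartForm_extD hζ he hy,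
    chartForm_codiff g hξ he hy]
  rfl

/-- Green's formula for two smooth forms whose supports have no common point on the boundary. -/
theorem setIntegral_greenDensity [T2Space M] [SecondCountableTopology M] (g : Metric d M)
    {Ω : Set M} (hΩ : IsOpen Ω) {ζ : Form d M q} {ξ : Form d M (q + 1)} (hζ : ζ.Smooth)
    (hξ : ξ.Smooth) (hζc : IsCompact ζ.support)
    (hdisj : ζ.support ∩ ξ.support ∩ frontier Ω = ∅) :
    ∫ x in Ω, greenDensity g ζ ξ x ∂(riemVolume g) = 0 := by
  have := isLocallyFiniteMeasure_riemVolume g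
  have : LocallyCompactSpace M := ChartedSpace.locallyCompactSpace (Euc d) M
  -- cover `K` by finitely many charts inside `Ω`; on the remaining member `Kᶜ` of the cover the
  -- integrand vanishes in `Ω`, since there one of the two forms is locally zero
  set K := ζ.support ∩ ξ.support ∩ closure Ω with hK
  have hKc : IsCompact K := (hζc.inter_right isClosed_closure).inter_right isClosed_closure
  have hKΩ : K ⊆ Ω := by
    intro x hx
    by_contra hn
    have : x ∈ ζ.support ∩ ξ.support ∩ frontier Ω := ⟨hx.1, hx.2, by rwa [hΩ.interior_eq]⟩
    rw [hdisj] at this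
    exact this
  obtain ⟨t, ht⟩ := hKc.elim_finite_subcover
    (fun c : M => (chartAt (Euc d) c).source ∩ Ω)
    (fun c => (chartAt (Euc d) c).open_source.inter hΩ)
    (fun x hx => mem_iUnion.2 ⟨x, mem_chart_source _ x, hKΩ hx⟩)
  let U : Option t → Set M := fun i => i.elim Kᶜ fun c => (chartAt (Euc d) (c : M)).source ∩ Ω
  obtain ⟨ρ, hρ⟩ := SmoothPartitionOfUnity.exists_isSubordinate (𝓡 d) isClosed_univ U
    (by
      rintro (_ | c)
      · exact hKc.isClosed.isOpen_compl
      · exact (chartAt (Euc d) (c : M)).open_source.inter hΩ)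
    (by
      intro x _
      by_cases hx : x ∈ K
      · obtain ⟨c, hc, hxc⟩ := mem_iUnion₂.1 (ht hx)
        exact mem_iUnion.2 ⟨some ⟨c, hc⟩, hxc⟩
      · exact mem_iUnion.2 ⟨none, hx⟩)
  let ζi : Option t → Form d M q := fun i x => ρ i x • ζ x
  have hsm : ∀ i, (ζi i).Smooth := fun i => hζ.smul (ρ i).contMDiff
  have hsub : ∀ i, (ζi i).support ⊆ tsupport (ρ i) ∩ ζ.support := fun i =>
    subset_inter
      (closure_mono fun x hx h0 => hx (by simp only [ζi]; rw [h0, zero_smul]))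
      (closure_mono fun x hx h0 => hx (by simp only [ζi]; rw [h0, smul_zero]))
  have hcpt : ∀ i, IsCompact (ζi i).support := fun i =>
    hζc.of_isClosed_subset isClosed_closure ((hsub i).trans inter_subset_right)
  have hsum : ζ = ∑ i, ζi i := by
    funext x
    have h1 := ρ.sum_eq_one (mem_univ x)
    rw [finsum_eq_sum_of_fintype] at h1
    rw [Finset.sum_apply]
    simp only [ζi]
    rw [← Finset.sum_smul, h1, one_smul]
  have hdens : ∀ x, greenDensity g ζ ξ x = ∑ i, greenDensity g (ζi i) ξ x := fun x => by
    conv_lhs => rw [hsum]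
    exact greenDensity_sum g _ ξ hsm x
  simp_rw [hdens]
  rw [integral_finsetSum _ fun i _ => ((continuous_greenDensity g (hsm i)
    hξ).integrable_of_hasCompactSupport (hasCompactSupport_greenDensity g ξ (hcpt i))).integrableOn]
  refine Finset.sum_eq_zero fun i _ => ?_
  rcases i with _ | c
  · refine setIntegral_eq_zero_of_forall_eq_zero fun x hx => ?_
    by_cases hxζ : x ∈ (ζi none).support
    · refine greenDensity_eq_zero_right g _ (eventually_eq_zero_of_notMem_support fun hxξ => ?_)
      exact hρ none (hsub none hxζ).1 ⟨⟨(hsub none hxζ).2, hxξ⟩, subset_closure hx⟩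
    · exact greenDensity_eq_zero_left g ξ (eventually_eq_zero_of_notMem_support hxζ)
  · exact setIntegral_greenDensity_chart g (chart_mem_atlas (Euc d) (c : M)) (hsm _) hξ (hcpt _)
      ((hsub _).trans (inter_subset_left.trans (hρ (some c))))

end Green

/-! ### Mixed boundary conditions and the error identity -/

section MixedBoundary

variable {d q : ℕ} {M : Type*} [TopologicalSpace M] [SecondCountableTopology M]
  [ChartedSpace (Euc d) M] [IsManifold (𝓡 d) ∞ M] [MeasurableSpace M] [BorelSpace M]
  {g : Metric d M} {Ω ΓD ΓN : Set M}

/-- `d` on `D^q_{ΓD}` and `-δ` on `Δ^{q+1}_{ΓN}` are adjoint to each other: there is no boundary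
term, since smooth approximations of the two forms have supports without common boundary points. -/
theorem l2Inner_green [T2Space M] (hΩ : IsOpen Ω)
    (hcover : frontier Ω ⊆ closure ΓD ∪ closure ΓN) {u : Form d M q}
    {du p : Form d M (q + 1)} {δp : Form d M q} (hu : MemDBdry g Ω ΓD u du)
    (hp : MemDeltaBdry g Ω ΓN p δp) : l2Inner g Ω du p + l2Inner g Ω u δp = 0 := by
  have hm := hΩ.measurableSet
  have hε : ∀ n : ℕ, (0 : ℝ) < 1 / ((n : ℝ) + 1) := fun n => by positivity
  choose ζ hζ hζε using fun n => hu.approx _ (hε n)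
  choose ξ hξ hξε using fun n => hp.approx _ (hε n)
  have hζm : ∀ n, MemL2 g Ω (ζ n) := fun n => (hζ n).1.memL2 g (hζ n).2.1 hm
  have hξm : ∀ n, MemL2 g Ω (ξ n) := fun n => (hξ n).1.memL2 g (hξ n).2.1 hm
  have hdζm : ∀ n, MemL2 g Ω (extD (ζ n)) := fun n => (hζ n).1.extD.memL2 g
    ((hζ n).2.1.of_isClosed_subset isClosed_closure (support_extD_subset _)) hm
  have hδξm : ∀ n, MemL2 g Ω (codiff g (ξ n)) := fun n => ((hξ n).1.codiff g).memL2 g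
    ((hξ n).2.1.of_isClosed_subset isClosed_closure (support_codiff_subset g _)) hm
  have hlim := tendsto_one_div_add_atTop_nhds_zero_nat (𝕜 := ℝ)
  have t1 : Filter.Tendsto (fun n => l2Inner g Ω (u - ζ n) (u - ζ n)) Filter.atTop (nhds 0) :=
    squeeze_zero (fun n => l2Inner_self_nonneg _) (fun n =>
      (le_add_of_nonneg_right (l2Inner_self_nonneg _)).trans (hζε n).le) hlim
  have t2 : Filter.Tendsto (fun n => l2Inner g Ω (du - extD (ζ n)) (du - extD (ζ n)))
      Filter.atTop (nhds 0) :=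
    squeeze_zero (fun n => l2Inner_self_nonneg _) (fun n =>
      (le_add_of_nonneg_left (l2Inner_self_nonneg _)).trans (hζε n).le) hlim
  have t3 : Filter.Tendsto (fun n => l2Inner g Ω (p - ξ n) (p - ξ n)) Filter.atTop (nhds 0) :=
    squeeze_zero (fun n => l2Inner_self_nonneg _) (fun n =>
      (le_add_of_nonneg_right (l2Inner_self_nonneg _)).trans (hξε n).le) hlim
  have t4 : Filter.Tendsto (fun n => l2Inner g Ω (δp - codiff g (ξ n)) (δp - codiff g (ξ n)))
      Filter.atTop (nhds 0) :=
    squeeze_zero (fun n => l2Inner_self_nonneg _) (fun n =>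
      (le_add_of_nonneg_left (l2Inner_self_nonneg _)).trans (hξε n).le) hlim
  have t5 := (tendsto_l2Inner hm hu.memD.memL2_d hp.memDelta.memL2 hdζm hξm t2 t3).add
    (tendsto_l2Inner hm hu.memD.memL2 hp.memDelta.memL2_δ hζm hδξm t1 t4)
  refine tendsto_nhds_unique t5 (tendsto_const_nhds.congr fun n => ?_)
  have hdisj : (ζ n).support ∩ (ξ n).support ∩ frontier Ω = ∅ := by
    refine eq_empty_of_forall_notMem fun x hx => ?_
    rcases hcover hx.2 with h | h
    · exact disjoint_left.1 (hζ n).2.2 hx.1.1 h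
    · exact disjoint_left.1 (hξ n).2.2 hx.1.2 h
  have h := setIntegral_greenDensity g hΩ (hζ n).1 (hξ n).1 (hζ n).2.1 hdisj
  rw [← h]
  unfold l2Inner greenDensity
  exact integral_add ((hdζm n).integrable_ptInner hm (hξm n))
    ((hζm n).integrable_ptInner hm (hδξm n))

variable {ρ : Coeff d M q} {α : Coeff d M (q + 1)}

/-- If the Green formula holds for `(e, ε)`, the mixed terms in the expansion of the residuals
`ρ e - δε` and `α de - ε` cancel. -/
theorem combinedNormSq_eq (hΩ : MeasurableSet Ω) (hρ : IsAdmissibleCoeff g Ω ρ)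
    (hα : IsAdmissibleCoeff g Ω α) {e : Form d M q} {de ε : Form d M (q + 1)} {δε : Form d M q}
    (he : MemL2 g Ω e) (hde : MemL2 g Ω de) (hε : MemL2 g Ω ε) (hδε : MemL2 g Ω δε)
    (hgreen : l2Inner g Ω de ε + l2Inner g Ω e δε = 0) :
    combinedNormSq g Ω ρ α e de ε δε = wNormSq g Ω ρ.inv (fun x => ρ x (e x) - δε x) +
      wNormSq g Ω α.inv (fun x => α x (de x) - ε x) := by
  rw [wNormSq_inv_sub hΩ hρ he hδε, wNormSq_inv_sub hΩ hα hde hε, combinedNormSq]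
  linarith

end MixedBoundary

theorem wNormSq_congr {d k : ℕ} {M : Type*} [TopologicalSpace M] [ChartedSpace (Euc d) M]
    [IsManifold (𝓡 d) ∞ M] [MeasurableSpace M] {g : Metric d M} {Ω : Set M} (A : Coeff d M k)
    {φ η : Form d M k} (h : ∀ᵐ x ∂((riemVolume g).restrict Ω), φ x = η x) :
    wNormSq g Ω A φ = wNormSq g Ω A η := by
  refine integral_congr_ae ?_
  filter_upwards [h] with x hx
  rw [hx]

end RiemForms

end

theorem theorem4p9 {d : ℕ} {M : Type*} [TopologicalSpace M] [T2Space M]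
    [SecondCountableTopology M] [ChartedSpace (RiemForms.Euc d) M] [IsManifold (𝓡 d) ∞ M]
    [MeasurableSpace M] [BorelSpace M] (g : RiemForms.Metric d M)
    (Ω : Set M) (hΩ : IsOpen Ω) (hΓ : IsCompact (frontier Ω))
    (hLip : RiemForms.HasLipschitzBoundary d Ω) (hext : RiemForms.BoundedOrExterior d Ω)
    (ΓD ΓN : Set M) (hΓD : ∃ U : Set M, IsOpen U ∧ ΓD = frontier Ω ∩ U)
    (hΓN : ΓN = frontier Ω \ closure ΓD)
    (q : ℕ) (ρ : RiemForms.Coeff d M q) (α : RiemForms.Coeff d M (q + 1))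
    (hρ : RiemForms.IsAdmissibleCoeff g Ω ρ) (hα : RiemForms.IsAdmissibleCoeff g Ω α)
    (f : RiemForms.Form d M q) (hf : RiemForms.MemL2 g Ω f)
    (u : RiemForms.Form d M q) (du p : RiemForms.Form d M (q + 1)) (δp : RiemForms.Form d M q)
    (hsol : RiemForms.IsSolution g Ω ΓD ΓN ρ α f u du p δp)
    (u' : RiemForms.Form d M q) (du' p' : RiemForms.Form d M (q + 1)) (δp' : RiemForms.Form d M q)
    (hu' : RiemForms.MemDBdry g Ω ΓD u' du') (hp' : RiemForms.MemDeltaBdry g Ω ΓN p' δp') :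
    RiemForms.combinedNormSq g Ω ρ α (u - u') (du - du') (p - p') (δp - δp') =
        RiemForms.majorant g Ω ρ α f u' du' p' δp' ∧
      (¬ (∀ᵐ x ∂((RiemForms.riemVolume g).restrict Ω), f x = 0) →
        0 < RiemForms.combinedNormSq g Ω ρ α u du p δp ∧
        0 < RiemForms.wNormSq g Ω ρ.inv f ∧
        RiemForms.combinedNormSq g Ω ρ α (u - u') (du - du') (p - p') (δp - δp') /
            RiemForms.combinedNormSq g Ω ρ α u du p δp =
          RiemForms.majorant g Ω ρ α f u' du' p' δp' / RiemForms.wNormSq g Ω ρ.inv f) := by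
  open RiemForms in
  have hm := hΩ.measurableSet
  have hcover : frontier Ω ⊆ closure ΓD ∪ closure ΓN := fun x hx => by
    by_cases h : x ∈ closure ΓD
    · exact Or.inl h
    · exact Or.inr (subset_closure (hΓN ▸ ⟨hx, h⟩))
  obtain ⟨hu, hp, hbal, hflux⟩ := hsol
  have Lu := hu.memD.memL2
  have Ldu := hu.memD.memL2_d
  have Lp := hp.memDelta.memL2
  have Lδp := hp.memDelta.memL2_δ
  have Lu' := hu'.memD.memL2
  have Ldu' := hu'.memD.memL2_d
  have Lp' := hp'.memDelta.memL2
  have Lδp' := hp'.memDelta.memL2_δ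
  have hgreen : l2Inner g Ω (du - du') (p - p') + l2Inner g Ω (u - u') (δp - δp') = 0 := by
    rw [l2Inner_sub_left hm Ldu Ldu' (Lp.sub hm Lp'), l2Inner_sub_right hm Ldu Lp Lp',
      l2Inner_sub_right hm Ldu' Lp Lp', l2Inner_sub_left hm Lu Lu' (Lδp.sub hm Lδp'),
      l2Inner_sub_right hm Lu Lδp Lδp', l2Inner_sub_right hm Lu' Lδp Lδp']
    linarith [l2Inner_green hΩ hcover hu hp, l2Inner_green hΩ hcover hu hp',
      l2Inner_green hΩ hcover hu' hp, l2Inner_green hΩ hcover hu' hp']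
  have herr : combinedNormSq g Ω ρ α (u - u') (du - du') (p - p') (δp - δp') =
      majorant g Ω ρ α f u' du' p' δp' := by
    rw [combinedNormSq_eq hm hρ hα (Lu.sub hm Lu') (Ldu.sub hm Ldu') (Lp.sub hm Lp')
      (Lδp.sub hm Lδp') hgreen, majorant]
    congr 1
    · refine wNormSq_congr _ ?_
      filter_upwards [hbal] with x hx
      rw [← hx, Pi.sub_apply, Pi.sub_apply, map_sub]
      abel
    · refine wNormSq_congr _ ?_
      filter_upwards [hflux] with x hx
      rw [Pi.sub_apply, Pi.sub_apply, map_sub, hx]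
      abel
  refine ⟨herr, fun hne => ?_⟩
  have hpos := wNormSq_pos hm (hρ.inv hm) hf hne
  -- the residuals of `(0, 0)` are `ρ u - δp = f` and `α du - p = 0`
  have hnorm : combinedNormSq g Ω ρ α u du p δp = wNormSq g Ω ρ.inv f := by
    rw [combinedNormSq_eq hm hρ hα Lu Ldu Lp Lδp (l2Inner_green hΩ hcover hu hp),
      wNormSq_congr (η := f) ρ.inv, wNormSq_congr (η := 0) α.inv]
    · have : wNormSq g Ω α.inv 0 = 0 := by
        unfold wNormSq l2Inner
        simp [ptInner_zero_right]
      rw [this, add_zero]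
    · filter_upwards [hflux] with x hx
      rw [hx, sub_self]
      rfl
    · filter_upwards [hbal] with x hx
      rw [← hx]
      abel
  rw [herr, hnorm]
  exact ⟨hpos, hpos, rfl⟩
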